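/- Let $R$ be a field and $q\in R^\times$ with $q\neq 1$, and let $\mu_q=\{q^j : j\in\mathbb Z\}$. For $n\ge 0$ let $H_n^{\mathrm{aff}}$ be the affine Hecke algebra over $R$, with generators $T_1,\dots,T_{n-1},X_1^{\pm1},\dots,X_n^{\pm1}$ and relations: the braid relations for the $T_j$; $(T_j+1)(T_j-q)=0$; the $X_j$ are invertible and commute with each other; $T_jX_k=X_kT_j$ for $k\neq j,j+1$; $T_jX_jT_j=qX_{j+1}$. For a function $\lambda:\mu_q\to\mathbb Z_{\ge0}$ of finite sum let $H_n^\lambda$ be the cyclotomic Hecke algebra, i.e. the quotient of $H_n^{\mathrm{aff}}$ by the two-sided ideal generated by $\prod_{s\in\mu_q}(X_1-s)^{\lambda_s}$ (and $H_0^\lambda=R$). Allow $\lambda$ also to be the symbol "aff". Let $\mathrm{Rep}_n^\lambda$ be the category of finite dimensional $H_n^\lambda$-modules on which, if $\lambda=\mathrm{aff}$ and $n\ge 1$, all eigenvalues of $X_1$ (in an algebraic closure of $R$) lie in $\mu_q$; let $K(\mathrm{Rep}_n^\lambda)$ be its Grothendieck group. Fix $i\in\mathbb Z$. For $M\in\mathrm{Rep}_n^\lambda$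 with $n\ge 1$, let $e_i^*M\in\mathrm{Rep}_{n-1}^\lambda$ be the generalized eigenspace of $X_n$ on $M$ with eigenvalue $q^i$, and let $\tilde e_iM\in\mathrm{Rep}_{n-1}^\lambda$ be the socle of the $H_{n-1}^\lambda$-module $\{m\in M: X_nm=q^im\}$; for $n=0$ put $e_i^*M=\tilde e_iM=0$. For $M\ne0$ let $\varepsilon_i(M)=\max\{k\ge0:\tilde e_i^{\,k}M\neq0\}$. Theorem. Let $N$ be an irreducible module in $\mathrm{Rep}_n^\lambda$, with $\lambda$ either "aff" or a function as above. Then (i) if $n\ge1$, $\varepsilon_i(N)$ is the maximal size of a Jordan block of $X_n$ with eigenvalue $q^i$ on $N$ (this maximum being $0$ if $q^i$ is not an eigenvalue of $X_n$ on $N$); (ii) in $K(\mathrm{Rep}_{n-1}^\lambda)$ (in $K(\mathrm{Rep}_0^\lambda)$ if $n=0$), $$[e_i^*N]=\varepsilon_i(N)\,[\tilde e_iN]+\sum_\alpha a_\alpha[M_\alpha],$$ a finite sum with $a_\alpha\in\mathbb Z_{\ge0}$, where the $M_\alpha$ are irreducible modules with $\varepsilon_i(M_\alpha)<\varepsilon_i(N)-1$;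 (iii) $\varepsilon_i(N)=\dim_R\mathrm{Hom}(e_i^*N,e_i^*N)$, where $\mathrm{Hom}$ is taken over $H_{n-1}^\lambda$ (over $H_0^\lambda$ if $n=0$). -/

import Mathlib

open scoped Polynomial ModuleCat

universe u

noncomputable section

namespace AffHecke

/-! ### The Hecke algebras -/

/-- A weight: a function `μ_q → ℕ` of finite sum (equivalently, of finite support), where
`μ_q = {q ^ i | i ∈ ℤ}`. -/
abbrev Weight {R : Type u} [Field R] (q : Rˣ) : Type u := Subgroup.zpowers q →₀ ℕ

/-- The superscript of a Hecke algebra: the symbol "aff", or a weight `lam`. -/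
inductive Level {R : Type u} [Field R] (q : Rˣ) : Type u
  | aff : Level q
  | cyc (lam : Weight q) : Level q

/-- The polynomial `∏_{s ∈ μ_q} (x - s) ^ (lam s)`. -/
def Weight.poly {R : Type u} [Field R] {q : Rˣ} (lam : Weight q) : R[X] :=
  lam.prod fun s k => (Polynomial.X - Polynomial.C ((s : Rˣ) : R)) ^ k

/-- Generators of the Hecke algebra of rank `n`. Indices start at `0`: `T i` is the usual
`T_{i+1}` (for `1 ≤ i + 1 ≤ n - 1`), `X j` is the usual `X_{j+1}` and `Xinv j` its inverse
(for `1 ≤ j + 1 ≤ n`). -/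
inductive Gen (n : ℕ) : Type
  | T (i : ℕ) (hi : i + 1 < n) : Gen n
  | X (j : ℕ) (hj : j < n) : Gen n
  | Xinv (j : ℕ) (hj : j < n) : Gen n

section Presentation

variable {R : Type u} [Field R]

/-- The generator `T_{i+1}` in the free algebra. -/
def fT (R : Type u) [Field R] {n : ℕ} (i : ℕ) (hi : i + 1 < n) : FreeAlgebra R (Gen n) :=
  FreeAlgebra.ι R (Gen.T i hi)

/-- The generator `X_{j+1}` in the free algebra. -/
def fX (R : Type u) [Field R] {n : ℕ} (j : ℕ) (hj : j < n) : FreeAlgebra R (Gen n) :=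
  FreeAlgebra.ι R (Gen.X j hj)

/-- The generator `X_{j+1}⁻¹` in the free algebra. -/
def fXinv (R : Type u) [Field R] {n : ℕ} (j : ℕ) (hj : j < n) : FreeAlgebra R (Gen n) :=
  FreeAlgebra.ι R (Gen.Xinv j hj)

/-- Defining relations. All but the last are those of the affine Hecke algebra of `GL_n`
(Bernstein presentation); the last one, present only for `L = cyc lam` and `n ≥ 1`, is the
cyclotomic relation `∏ (X_1 - s) ^ (lam s) = 0`. -/
inductive Rel (q : Rˣ) (L : Level q) (n : ℕ) :
    FreeAlgebra R (Gen n) → FreeAlgebra R (Gen n) → Prop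
  | quad (i : ℕ) (hi : i + 1 < n) :
      Rel q L n ((fT R i hi + 1) * (fT R i hi - algebraMap R _ (q : R))) 0
  | braid (i : ℕ) (hi : i + 1 < n) (hi' : i + 1 + 1 < n) :
      Rel q L n (fT R i hi * fT R (i + 1) hi' * fT R i hi)
        (fT R (i + 1) hi' * fT R i hi * fT R (i + 1) hi')
  | comm (i j : ℕ) (hi : i + 1 < n) (hj : j + 1 < n) (hij : i + 1 < j) :
      Rel q L n (fT R i hi * fT R j hj) (fT R j hj * fT R i hi)
  | mulInv (j : ℕ) (hj : j < n) : Rel q L n (fX R j hj * fXinv R j hj) 1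
  | invMul (j : ℕ) (hj : j < n) : Rel q L n (fXinv R j hj * fX R j hj) 1
  | commX (j k : ℕ) (hj : j < n) (hk : k < n) :
      Rel q L n (fX R j hj * fX R k hk) (fX R k hk * fX R j hj)
  | commTX (i j : ℕ) (hi : i + 1 < n) (hj : j < n) (h : j ≠ i) (h' : j ≠ i + 1) :
      Rel q L n (fT R i hi * fX R j hj) (fX R j hj * fT R i hi)
  | TXT (i : ℕ) (hi : i + 1 < n) (hi' : i < n) :
      Rel q L n (fT R i hi * fX R i hi' * fT R i hi)
        (algebraMap R _ (q : R) * fX R (i + 1) hi)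
  | cyclotomic (lam : Weight q) (hL : L = Level.cyc lam) (hn : 0 < n) :
      Rel q L n (Polynomial.aeval (fX R 0 hn) lam.poly) 0

end Presentation

/-- The Hecke algebra of rank `n` with parameter `q`: the affine Hecke algebra if `L = aff`, and
the cyclotomic Hecke algebra (its quotient by the two-sided ideal generated by
`∏ (X_1 - s) ^ (lam s)`) if `L = cyc lam`. For `n = 0` it is `R`. -/
def Hecke {R : Type u} [Field R] {q : Rˣ} (L : Level q) (n : ℕ) : Type u :=
  RingQuot (Rel q L n)

section Algebra

variable {R : Type u} [Field R] {q : Rˣ} (L : Level q) (n : ℕ)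

instance instRingHecke : Ring (Hecke L n) := inferInstanceAs (Ring (RingQuot (Rel q L n)))

instance instAlgebraHecke : Algebra R (Hecke L n) :=
  inferInstanceAs (Algebra R (RingQuot (Rel q L n)))

/-- The quotient map from the free algebra. -/
def mk : FreeAlgebra R (Gen n) →ₐ[R] Hecke L n := RingQuot.mkAlgHom R (Rel q L n)

variable {n}

/-- The element `X_{j+1}` of the Hecke algebra. -/
def X (j : ℕ) (hj : j < n) : Hecke L n := mk L n (fX R j hj)

variable {L}

theorem mk_rel {x y : FreeAlgebra R (Gen n)} (h : Rel q L n x y) : mk L n x = mk L n y :=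
  RingQuot.mkAlgHom_rel R h

variable (L n)

theorem mk_surjective : Function.Surjective (mk L n) := RingQuot.mkAlgHom_surjective R _

/-- The inclusion of generators of rank `n` into those of rank `n + 1`. -/
def genSucc {n : ℕ} : Gen n → Gen (n + 1)
  | .T i hi => .T i (Nat.lt_succ_of_lt hi)
  | .X j hj => .X j (Nat.lt_succ_of_lt hj)
  | .Xinv j hj => .Xinv j (Nat.lt_succ_of_lt hj)

/-- The map induced by `genSucc` from the free algebra. -/
def preIncl : FreeAlgebra R (Gen n) →ₐ[R] Hecke L (n + 1) :=
  FreeAlgebra.lift R fun g => mk L (n + 1) (FreeAlgebra.ι R (genSucc g))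

variable {n}

theorem preIncl_fT (i : ℕ) (hi : i + 1 < n) :
    preIncl L n (fT R i hi) = mk L (n + 1) (fT R i (Nat.lt_succ_of_lt hi)) := by
  simp [preIncl, fT, genSucc]

theorem preIncl_fX (j : ℕ) (hj : j < n) :
    preIncl L n (fX R j hj) = mk L (n + 1) (fX R j (Nat.lt_succ_of_lt hj)) := by
  simp [preIncl, fX, genSucc]

theorem preIncl_fXinv (j : ℕ) (hj : j < n) :
    preIncl L n (fXinv R j hj) = mk L (n + 1) (fXinv R j (Nat.lt_succ_of_lt hj)) := by
  simp [preIncl, fXinv, genSucc]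

theorem preIncl_rel {x y : FreeAlgebra R (Gen n)} (h : Rel q L n x y) :
    preIncl L n x = preIncl L n y := by
  cases h with
  | quad i hi =>
    simpa [preIncl_fT] using mk_rel (Rel.quad (L := L) i (Nat.lt_succ_of_lt hi))
  | braid i hi hi' =>
    simpa [preIncl_fT] using
      mk_rel (Rel.braid (L := L) i (Nat.lt_succ_of_lt hi) (Nat.lt_succ_of_lt hi'))
  | comm i j hi hj hij =>
    simpa [preIncl_fT] using
      mk_rel (Rel.comm (L := L) i j (Nat.lt_succ_of_lt hi) (Nat.lt_succ_of_lt hj) hij)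
  | mulInv j hj =>
    simpa [preIncl_fX, preIncl_fXinv] using
      mk_rel (Rel.mulInv (L := L) j (Nat.lt_succ_of_lt hj))
  | invMul j hj =>
    simpa [preIncl_fX, preIncl_fXinv] using
      mk_rel (Rel.invMul (L := L) j (Nat.lt_succ_of_lt hj))
  | commX j k hj hk =>
    simpa [preIncl_fX] using
      mk_rel (Rel.commX (L := L) j k (Nat.lt_succ_of_lt hj) (Nat.lt_succ_of_lt hk))
  | commTX i j hi hj h h' =>
    simpa [preIncl_fX, preIncl_fT] using
      mk_rel (Rel.commTX (L := L) i j (Nat.lt_succ_of_lt hi) (Nat.lt_succ_of_lt hj) h h')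
  | TXT i hi hi' =>
    simpa [preIncl_fX, preIncl_fT] using
      mk_rel (Rel.TXT (L := L) i (Nat.lt_succ_of_lt hi) (Nat.lt_succ_of_lt hi'))
  | cyclotomic lam hL hn =>
    have := mk_rel (Rel.cyclotomic (L := L) lam hL (Nat.lt_succ_of_lt hn))
    rw [← Polynomial.aeval_algHom_apply] at this ⊢
    rw [preIncl_fX, this]
    simp

variable (n)

/-- The standard algebra map from the Hecke algebra of rank `n` to that of rank `n + 1`, sending
each generator to the generator of the same name. -/
def incl : Hecke L n →ₐ[R] Hecke L (n + 1) :=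
  RingQuot.liftAlgHom R ⟨preIncl L n, fun _ _ h => preIncl_rel L h⟩

theorem incl_mk (x : FreeAlgebra R (Gen n)) : incl L n (mk L n x) = preIncl L n x :=
  RingQuot.liftAlgHom_mkAlgHom_apply R _ _ x

theorem incl_X (j : ℕ) (hj : j < n) : incl L n (X L j hj) = X L j (Nat.lt_succ_of_lt hj) := by
  rw [X, incl_mk, preIncl_fX, X]

/-- `X_{n+1}` commutes with the image of the Hecke algebra of rank `n`. -/
theorem commute_incl (h : Hecke L n) : Commute (X L n (Nat.lt_succ_self n)) (incl L n h) := by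
  obtain ⟨x, rfl⟩ := mk_surjective L n h
  rw [incl_mk]
  induction x using FreeAlgebra.induction with
  | grade0 r => rw [AlgHom.commutes]; exact (Algebra.commutes r _).symm
  | grade1 g =>
    have hX : ∀ (j : ℕ) (hj : j < n + 1),
        Commute (X L n (Nat.lt_succ_self n)) (mk L (n + 1) (fX R j hj)) := fun j hj => by
      have := mk_rel (Rel.commX (L := L) n j (Nat.lt_succ_self n) hj)
      rw [map_mul, map_mul] at this
      exact this
    cases g with
    | T i hi =>
      have := mk_rel (Rel.commTX (L := L) i n (Nat.lt_succ_of_lt hi) (Nat.lt_succ_self n)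
        (by omega) (by omega))
      rw [map_mul, map_mul] at this
      have h2 := preIncl_fT L i hi
      rw [fT] at h2
      rw [h2]
      exact this.symm
    | X j hj =>
      have h2 := preIncl_fX L j hj
      rw [fX] at h2
      rw [h2]
      exact hX j _
    | Xinv j hj =>
      have h2 := preIncl_fXinv L j hj
      rw [fXinv] at h2
      rw [h2]
      have h3 := mk_rel (Rel.mulInv (L := L) j (Nat.lt_succ_of_lt hj))
      have h4 := mk_rel (Rel.invMul (L := L) j (Nat.lt_succ_of_lt hj))
      rw [map_mul, map_one] at h3 h4
      exact Commute.units_inv_right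
        (u := ⟨mk L (n + 1) (fX R j (Nat.lt_succ_of_lt hj)),
          mk L (n + 1) (fXinv R j (Nat.lt_succ_of_lt hj)), h3, h4⟩) (hX j _)
  | mul a b ha hb => rw [map_mul]; exact ha.mul_right hb
  | add a b ha hb => rw [map_add]; exact ha.add_right hb

end Algebra

/-! ### The categories of representations -/

section Representations

variable {R : Type u} [Field R] {q : Rˣ}

/-- The only eigenvalues of `X_1` on `M` (in an algebraic closure of `R`) are powers of `q`: that
is, `X_1` is annihilated on `M` by some product of factors `x - s` with `s ∈ μ_q`. There is no
condition if `n = 0`. -/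
def EigenvaluesInMu {L : Level q} {n : ℕ} (M : ModuleCat.{u} (Hecke L n)) : Prop :=
  ∀ hn : 0 < n, ∃ lam : Weight q, ∀ m : M, Polynomial.aeval (X L 0 hn) lam.poly • m = 0

/-- The representations considered: finite dimensional modules and, for the affine Hecke algebra,
such that the only eigenvalues of `X_1` are powers of `q`. (In the cyclotomic case this condition
on eigenvalues holds for all modules.) -/
def IsRep : (L : Level q) → (n : ℕ) → CategoryTheory.ObjectProperty (ModuleCat.{u} (Hecke L n))
  | .aff, _ => fun M => FiniteDimensional R M ∧ EigenvaluesInMu M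
  | .cyc _, _ => fun M => FiniteDimensional R M

/-- The category of representations of the Hecke algebra of rank `n`. -/
abbrev Rep (L : Level q) (n : ℕ) : Type (u + 1) := (IsRep L n).FullSubcategory

theorem IsRep.finiteDimensional {L : Level q} {n : ℕ} {M : ModuleCat.{u} (Hecke L n)}
    (h : IsRep L n M) : FiniteDimensional R M := by
  cases L with
  | aff => exact h.1
  | cyc lam => exact h

/-- Restriction from rank `n + 1` to rank `n`. -/
abbrev res {L : Level q} {n : ℕ} (M : ModuleCat.{u} (Hecke L (n + 1))) :
    ModuleCat.{u} (Hecke L n) :=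
  (ModuleCat.restrictScalars (incl L n).toRingHom).obj M

theorem res_smul {L : Level q} {n : ℕ} (M : ModuleCat.{u} (Hecke L (n + 1))) (h : Hecke L n)
    (m : res M) : h • m = (show res M from (incl L n h • (show M from m) : M)) := rfl

/-- A submodule of a restriction of a representation is a representation. -/
theorem isRep_of_injective {L : Level q} {n : ℕ} {M : ModuleCat.{u} (Hecke L (n + 1))}
    (hM : IsRep L (n + 1) M) {N : ModuleCat.{u} (Hecke L n)} (f : N →ₗ[Hecke L n] res M)
    (hf : Function.Injective f) : IsRep L n N := by
  have hfd : FiniteDimensional R N := by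
    have := hM.finiteDimensional
    let g : N →ₗ[R] M :=
      { toFun := fun x => f x
        map_add' := fun x y => map_add f x y
        map_smul' := fun r x => by
          have h1 : r • x = (algebraMap R (Hecke L n) r) • x := (algebraMap_smul _ r x).symm
          rw [h1, map_smul, res_smul, AlgHom.commutes]
          exact algebraMap_smul (M := M) (Hecke L (n + 1)) r (show M from f x) }
    exact FiniteDimensional.of_injective g hf
  cases L with
  | cyc lam => exact hfd
  | aff =>
    refine ⟨hfd, fun hn => ?_⟩
    obtain ⟨lam, hlam⟩ := hM.2 (Nat.succ_pos n)
    refine ⟨lam, fun m => hf ?_⟩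
    rw [map_smul, map_zero, res_smul, ← Polynomial.aeval_algHom_apply, incl_X]
    exact hlam (f m)

/-- The zero representation. -/
def zeroRep (L : Level q) (n : ℕ) : Rep L n :=
  ⟨ModuleCat.of _ PUnit, by
    have hfd : FiniteDimensional R (ModuleCat.of (Hecke L n) PUnit.{u + 1}) :=
      Module.Finite.of_finite (M := PUnit.{u + 1})
    cases L with
    | cyc lam => exact hfd
    | aff => exact ⟨hfd, fun _ => ⟨0, fun _ => rfl⟩⟩⟩

/-! ### The functor `e_i^*`, the operator `ẽ_i` and the integer `ε_i` -/

theorem sub_algebraMap_commute (L : Level q) (n : ℕ) (a : R) (h : Hecke L n) :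
    Commute (X L n (Nat.lt_succ_self n) - algebraMap R _ a) (incl L n h) :=
  (commute_incl L n h).sub_left (Algebra.commutes a _)

/-- The generalized eigenspace of `X_{n+1}` on `M` with eigenvalue `a`, as a module over the
Hecke algebra of rank `n`. -/
def genEigen {L : Level q} {n : ℕ} (a : R) (M : ModuleCat.{u} (Hecke L (n + 1))) :
    Submodule (Hecke L n) (res M) where
  carrier := {m : M | ∃ k : ℕ, (X L n (Nat.lt_succ_self n) - algebraMap R _ a) ^ k • m = 0}
  zero_mem' := ⟨0, smul_zero (A := M) _⟩
  add_mem' := by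
    rintro (x : M) (y : M) ⟨k, hk⟩ ⟨l, hl⟩
    refine ⟨k + l, ?_⟩
    change _ • (x + y) = 0
    rw [smul_add]
    nth_rewrite 1 [add_comm k l]
    rw [pow_add, pow_add, mul_smul, mul_smul, hk, hl, smul_zero, smul_zero, add_zero]
  smul_mem' := by
    rintro h (x : M) ⟨k, hk⟩
    refine ⟨k, ?_⟩
    change _ • (incl L n h • x) = 0
    rw [smul_smul, ((sub_algebraMap_commute L n a h).pow_left k).eq, mul_smul, hk, smul_zero]

/-- The eigenspace of `X_{n+1}` on `M` with eigenvalue `a`, as a module over the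
Hecke algebra of rank `n`: this is `Hom` from the one dimensional `R[X_{n+1}^±]`-module with
eigenvalue `a` to `M`. -/
def eigen {L : Level q} {n : ℕ} (a : R) (M : ModuleCat.{u} (Hecke L (n + 1))) :
    Submodule (Hecke L n) (res M) where
  carrier := {m : M | (X L n (Nat.lt_succ_self n) - algebraMap R _ a) • m = 0}
  zero_mem' := smul_zero (A := M) _
  add_mem' := by
    rintro (x : M) (y : M) hx hy
    change _ • (x + y) = 0
    rw [smul_add, hx, hy, add_zero]
  smul_mem' := by
    rintro h (x : M) hx
    change _ • (incl L n h • x) = 0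
    rw [smul_smul, (sub_algebraMap_commute L n a h).eq, mul_smul, hx, smul_zero]

/-- The socle: the largest semisimple submodule, i.e. the sum of all simple submodules. -/
def socle (A : Type*) [Ring A] (M : Type*) [AddCommGroup M] [Module A M] : Submodule A M :=
  sSup {p : Submodule A M | IsSimpleModule A p}

/-- `e_i^* M` for `a = q ^ i`: the generalized eigenspace of `X_n` on `M` with eigenvalue `a`, a
module over the Hecke algebra of rank `n - 1`. It is zero if `n = 0`. -/
def eStar {L : Level q} (a : R) : {n : ℕ} → Rep L n → Rep L (n - 1)
  | 0, _ => zeroRep L 0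
  | n + 1, M => ⟨ModuleCat.of (Hecke L n) (genEigen a M.obj),
      isRep_of_injective M.property (genEigen a M.obj).subtype Subtype.val_injective⟩

/-- `ẽ_i M` for `a = q ^ i`: the socle of the eigenspace of `X_n` on `M` with eigenvalue `a`, a
module over the Hecke algebra of rank `n - 1`. It is zero if `n = 0`. -/
def eTilde {L : Level q} (a : R) : {n : ℕ} → Rep L n → Rep L (n - 1)
  | 0, _ => zeroRep L 0
  | n + 1, M => ⟨ModuleCat.of (Hecke L n) (socle (Hecke L n) (eigen a M.obj)),
      isRep_of_injective M.property
        ((eigen a M.obj).subtype ∘ₗ (socle (Hecke L n) (eigen a M.obj)).subtype)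
        (Subtype.val_injective.comp Subtype.val_injective)⟩

/-- `ẽ_i` as an operator on representations of all ranks. -/
def eTildeOp {L : Level q} (a : R) (M : Σ n, Rep L n) : Σ n, Rep L n :=
  ⟨M.1 - 1, eTilde a M.2⟩

/-- `ε_i(M) = max {k ≥ 0 | ẽ_i^k M ≠ 0}`, for `a = q ^ i`. -/
def epsilon {L : Level q} (a : R) {n : ℕ} (M : Rep L n) : ℕ :=
  sSup {k : ℕ | Nontrivial ((eTildeOp a)^[k] ⟨n, M⟩).2.obj}

/-! ### Jordan blocks -/

/-- `M`, considered as an `R[x]`-module with `x` acting by the element `y` of the algebra `A`, has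
a direct summand which is a Jordan block `R[x]/(x - a)^k` of size `k` and eigenvalue `a`. -/
def HasJordanBlock {A : Type*} [Ring A] [Algebra R A] (M : ModuleCat A) (y : A) (a : R)
    (k : ℕ) : Prop :=
  ∃ p p' : Submodule R[X] (Module.AEval R M y), IsCompl p p' ∧
    Nonempty (p ≃ₗ[R[X]] R[X] ⧸ Ideal.span {(Polynomial.X - Polynomial.C a) ^ k})

/-- The maximal size of a Jordan block of `y` with eigenvalue `a` on `M`. It is `0` if there is no
nonzero block, the zero module being the block of size `0`. -/
def maxJordanBlock {A : Type*} [Ring A] [Algebra R A] (M : ModuleCat A) (y : A) (a : R) : ℕ :=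
  sSup {k : ℕ | HasJordanBlock M y a k}

/-! ### The Grothendieck group -/

/-- Grothendieck relations: the elements `[M₂] - [M₁] - [M₃]` for all short exact sequences
`0 → M₁ → M₂ → M₃ → 0`. -/
def grothendieckRelations (L : Level q) (n : ℕ) : Set (FreeAbelianGroup (Rep L n)) :=
  {z | ∃ (M₁ M₂ M₃ : Rep L n) (f : M₁.obj →ₗ[Hecke L n] M₂.obj)
      (g : M₂.obj →ₗ[Hecke L n] M₃.obj),
      Function.Injective f ∧ Function.Exact f g ∧ Function.Surjective g ∧
      z = FreeAbelianGroup.of M₂ - FreeAbelianGroup.of M₁ - FreeAbelianGroup.of M₃}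

/-- The Grothendieck group of the category `Rep L n`. -/
abbrev GrothendieckGroup (L : Level q) (n : ℕ) : Type (u + 1) :=
  FreeAbelianGroup (Rep L n) ⧸ AddSubgroup.closure (grothendieckRelations L n)

/-- The class `[M]` in the Grothendieck group. -/
def cls {L : Level q} {n : ℕ} (M : Rep L n) : GrothendieckGroup L n :=
  QuotientAddGroup.mk (FreeAbelianGroup.of M)

end Representations

end AffHecke

end

/-! Let N be irreducible of rank k+1 and a = q^i, with operators indexed from 0, so that X_k is the
last one. Let W be the simultaneous generalized eigenspace of X_l, …, X_k on N for the eigenvalue a,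
with l minimal such that W ≠ 0 (`HasTail`; l = k+1 if a is not an eigenvalue of X_k). This tail
governs everything, and ε_i(N) is its length k+1-l.

Shuffling. If V is stable in rank k, it generates the sum of the T_r ⋯ T_{k-1} V in rank k+1, and
X_j passes through such a chain with a changed index, up to shorter chains (`HeckeAction.X_chain`).
Projecting to the tail therefore constrains the leading coefficients, and minimality of l removes
every chain starting below l (`HeckeAction.chainSpan_inf_tailSpace_le`). Hence W is irreducible over
the parabolic subalgebra (`HeckeAction.tail_le`). If V is an irreducible rank-k submodule of the
X_k-eigenspace, its tail generates W and starts at the same l (`HeckeAction.tail_le_chainSpan`,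
`HeckeAction.hasTail_socle`). So ẽ_i shortens the tail by exactly one.

Nilpotency. Each step of rank raises the index of X_k - a on W by one, because (q-1)a ≠ 0; the index
is thus the length of the tail (`HeckeAction.tail_pow`). A dimension count then puts the
X_k-eigenvectors of W inside V (`HeckeAction.tail_inf_eigenspace_le`), so the socle V of the
eigenspace is irreducible (`HeckeAction.socle_unique`). Projection to the tail carries the index
over to the whole generalized eigenspace (`HeckeAction.pow_eq_zero`) and shows that V lies in each
of its nonzero rank-k submodules (`HeckeAction.socle_le`).

Conclusion. On P = e_i^* N the operator x = X_k - a has index m+1 = ε_i(N), and tail vectors in the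
kernel of x lie in V (`TailData`). The index is the maximal Jordan block. Filtering by powers of x
gives [P] = (m+1)[V] plus irreducibles with a shorter tail (`TailData.exists_cls_eq`). Finally,
every endomorphism of P is a polynomial in x, so End P = R[x]/(x^{m+1}) (`TailData.finrank_end`).
This needs End V = R over an arbitrary field (`exists_eq_smul`), which holds because eigenvalues of
X_k are found in R itself (`HeckeAction.exists_splits_succ`). -/

noncomputable section

namespace AffHecke

/-! ### Operators satisfying the affine Hecke relations -/

section Operators

variable {R : Type*} [Field R] {A : Type*} [AddCommGroup A] [Module R A]

/-- Endomorphisms `T i` (`i + 1 < n`) and `X j` (`j < n`) of a vector space which satisfy the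
relations of the affine Hecke algebra of rank `n`, in the form of commutation rules. -/
structure HeckeAction (q : R) (n : ℕ) (T X : ℕ → Module.End R A) : Prop where
  T_T : ∀ i, i + 1 < n → ∀ v, T i (T i v) = (q - 1) • T i v + q • v
  braid : ∀ i, i + 2 < n → ∀ v, T i (T (i + 1) (T i v)) = T (i + 1) (T i (T (i + 1) v))
  T_comm : ∀ i j, i + 1 < j → j + 1 < n → ∀ v, T i (T j v) = T j (T i v)
  X_comm : ∀ i j, i < n → j < n → ∀ v, X i (X j v) = X j (X i v)
  T_X_comm : ∀ i j, i + 1 < n → j < n → j ≠ i → j ≠ i + 1 → ∀ v, T i (X j v) = X j (T i v)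
  X_succ_T : ∀ i, i + 1 < n → ∀ v, X (i + 1) (T i v) = T i (X i v) + (q - 1) • X (i + 1) v
  X_T : ∀ i, i + 1 < n → ∀ v, X i (T i v) = T i (X (i + 1) v) - (q - 1) • X (i + 1) v

/-- `Stab n T X l k U`: the subspace `U` is stable under all `X j` with `j < n` and under the
`T j` of the parabolic subalgebra of type `(l, k - l)`. For `l = 0` these are all `T j` of
rank `k`. -/
def Stab (n : ℕ) (T X : ℕ → Module.End R A) (l k : ℕ) (U : Submodule R A) : Prop :=
  (∀ j < n, ∀ v ∈ U, X j v ∈ U) ∧ ∀ j, j + 1 < k → j + 1 ≠ l → ∀ v ∈ U, T j v ∈ U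

/-- `T_i T_{i+1} ⋯ T_{i+d-1}`. -/
def chain (T : ℕ → Module.End R A) : ℕ → ℕ → Module.End R A
  | _, 0 => 1
  | i, d + 1 => T i * chain T (i + 1) d

/-- The sum of the subspaces `T_r ⋯ T_{k-1} V` for `i ≤ r ≤ k`, where `k + 1 = i + d`. -/
def chainSpan (T : ℕ → Module.End R A) (V : Submodule R A) : ℕ → ℕ → Submodule R A
  | _, 0 => ⊥
  | i, d + 1 => V.map (chain T i d) ⊔ chainSpan T V (i + 1) d

/-- The index `j'` such that `X_j T_i ⋯ T_{k-1} = T_i ⋯ T_{k-1} X_{j'}` up to lower terms. -/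
def shiftIdx (i k j : ℕ) : ℕ := if j < i ∨ k < j then j else if j = i then k else j - 1

@[simp] theorem chain_zero (T : ℕ → Module.End R A) (i : ℕ) (v : A) : chain T i 0 v = v := rfl

theorem chain_succ (T : ℕ → Module.End R A) (i d : ℕ) (v : A) :
    chain T i (d + 1) v = T i (chain T (i + 1) d v) := rfl

theorem chain_succ_last (T : ℕ → Module.End R A) (i d : ℕ) (v : A) :
    chain T i (d + 1) v = chain T i d (T (i + d) v) := by
  induction d generalizing i with
  | zero => rfl
  | succ d ih =>
    rw [chain_succ, ih, chain_succ, show i + 1 + d = i + (d + 1) by omega]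

theorem chain_mem_chainSpan (T : ℕ → Module.End R A) {V : Submodule R A} (i d : ℕ) {v : A}
    (hv : v ∈ V) : chain T i d v ∈ chainSpan T V i (d + 1) :=
  Submodule.mem_sup_left (Submodule.mem_map_of_mem hv)

theorem chainSpan_succ_le (T : ℕ → Module.End R A) (V : Submodule R A) (i d : ℕ) :
    chainSpan T V (i + 1) d ≤ chainSpan T V i (d + 1) := le_sup_right

theorem le_chainSpan (T : ℕ → Module.End R A) (V : Submodule R A) (i d : ℕ) :
    V ≤ chainSpan T V i (d + 1) := by
  induction d generalizing i with
  | zero => intro v hv; exact chain_mem_chainSpan T i 0 hv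
  | succ d ih => exact (ih (i + 1)).trans (chainSpan_succ_le T V i (d + 1))

/-- Induction for `chainSpan`. -/
theorem chainSpan_le (T : ℕ → Module.End R A) (V : Submodule R A) {S : Submodule R A} (i d : ℕ)
    (h : ∀ r e, i ≤ r → r + e + 1 = i + d → ∀ v ∈ V, chain T r e v ∈ S) :
    chainSpan T V i d ≤ S := by
  induction d generalizing i with
  | zero => exact bot_le
  | succ d ih =>
    refine sup_le ?_ (ih (i + 1) fun r e hr he => h r e (by omega) (by omega))
    rintro _ ⟨v, hv, rfl⟩
    exact h i d le_rfl (by omega) v hv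

theorem chain_mem_chainSpan_of_le (T : ℕ → Module.End R A) {V : Submodule R A} {i d r e : ℕ}
    (hr : i ≤ r) (he : r + e + 1 = i + d) {v : A} (hv : v ∈ V) :
    chain T r e v ∈ chainSpan T V i d := by
  induction d generalizing i with
  | zero => omega
  | succ d ih =>
    rcases eq_or_lt_of_le hr with rfl | hlt
    · obtain rfl : e = d := by omega
      exact chain_mem_chainSpan T _ _ hv
    · exact chainSpan_succ_le T V i d (ih hlt (by omega))

theorem chainSpan_mono (T : ℕ → Module.End R A) (V : Submodule R A) {i d r e : ℕ}
    (hr : i ≤ r) (he : r + e = i + d) : chainSpan T V r e ≤ chainSpan T V i d :=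
  chainSpan_le T V r e fun _ _ hr' he' _ hv =>
    chain_mem_chainSpan_of_le T (hr.trans hr') (by omega) hv

variable {q : R} {n : ℕ} {T X : ℕ → Module.End R A}

theorem HeckeAction.T_chain_of_lt (H : HeckeAction q n T X) {j i d : ℕ} (h : j + 1 < i)
    (hd : i + d < n) (v : A) : T j (chain T i d v) = chain T i d (T j v) := by
  induction d generalizing i with
  | zero => rfl
  | succ d ih => rw [chain_succ, chain_succ, H.T_comm j i h (by omega), ih (by omega) (by omega)]

/-- The braid relation carries `T (j + 1)` past the factors `T j`, `T (j + 1)` of the chain, where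
it becomes `T j`; all other factors commute with it. -/
theorem HeckeAction.T_chain_of_mid (H : HeckeAction q n T X) {j i d : ℕ} (h : i ≤ j)
    (h' : j + 1 < i + d) (hd : i + d < n) (v : A) :
    T (j + 1) (chain T i d v) = chain T i d (T j v) := by
  induction d generalizing i with
  | zero => omega
  | succ d ih =>
    rw [chain_succ, chain_succ]
    rcases eq_or_lt_of_le h with rfl | hlt
    · cases d with
      | zero => omega
      | succ d =>
        rw [chain_succ, chain_succ, ← H.braid _ (by omega),
          H.T_chain_of_lt (by omega) (by omega)]
    · rw [← H.T_comm i (j + 1) (by omega) (by omega), ih (by omega) (by omega) (by omega)]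

theorem HeckeAction.X_chain_of_lt (H : HeckeAction q n T X) {j i d : ℕ} (h : j < i ∨ i + d < j)
    (hj : j < n) (hd : i + d < n) (v : A) : X j (chain T i d v) = chain T i d (X j v) := by
  induction d generalizing i with
  | zero => rfl
  | succ d ih =>
    rw [chain_succ, chain_succ, ← H.T_X_comm i j (by omega) hj (by omega) (by omega),
      ih (by omega) (by omega)]

/-! ### Generation in rank `k + 1` from a subspace stable in rank `k` -/

section Span

variable {l k : ℕ} {V : Submodule R A}

theorem HeckeAction.T_mem_chainSpan_of_lt (H : HeckeAction q n T X) (hV : Stab n T X l k V)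
    (hk : k < n) {j i d : ℕ} (hj : j + 1 < i) (hjl : j + 1 ≠ l) (hd : i + d = k + 1) (z : A)
    (hz : z ∈ chainSpan T V i d) : T j z ∈ chainSpan T V i d := by
  revert z
  refine chainSpan_le (S := (chainSpan T V i d).comap (T j)) T V i d fun r e hr he v hv => ?_
  rw [Submodule.mem_comap, H.T_chain_of_lt (by omega) (by omega)]
  exact chain_mem_chainSpan_of_le T hr he (hV.2 j (by omega) hjl v hv)

/-- `X_j` moves through a chain, up to shorter chains. -/
theorem HeckeAction.X_chain (H : HeckeAction q n T X) (hV : Stab n T X l k V) (hk : k < n)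
    {i d : ℕ} (hi : l ≤ i) (hd : i + d = k) (j : ℕ) (hj : j < n) (v : A) (hv : v ∈ V) :
    X j (chain T i d v) - chain T i d (X (shiftIdx i k j) v) ∈ chainSpan T V (i + 1) d := by
  induction d generalizing i j v with
  | zero =>
    have : shiftIdx i k j = j := by unfold shiftIdx; split_ifs <;> omega
    simp [this]
  | succ d ih =>
    by_cases h1 : j < i ∨ k < j
    · rw [shiftIdx, if_pos h1, H.X_chain_of_lt (by omega) hj (by omega), sub_self]
      exact zero_mem _
    -- The error terms of the shorter chain start at `i + 2` or later, so multiplying them by `T i`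
    -- does not lengthen them.
    have hT : ∀ z ∈ chainSpan T V (i + 1 + 1) d, T i z ∈ chainSpan T V (i + 1 + 1) d :=
      H.T_mem_chainSpan_of_lt hV hk (by omega) (by omega) (by omega)
    have hle := chainSpan_succ_le T V (i + 1) d
    -- The correction `(q - 1) X (i + 1)` in the commutation rules loses the factor `T i`, so it
    -- acts on a chain that is one step shorter.
    have key : ∀ j' < n, X j' (chain T (i + 1) d v) ∈ chainSpan T V (i + 1) (d + 1) := by
      intro j' hj'
      have h2 := hle (ih (i := i + 1) (by omega) (by omega) j' hj' v hv)
      have h3 : chain T (i + 1) d (X (shiftIdx (i + 1) k j') v) ∈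
          chainSpan T V (i + 1) (d + 1) :=
        chain_mem_chainSpan T _ _ (hV.1 _ (by unfold shiftIdx; split_ifs <;> omega) v hv)
      simpa using add_mem h2 h3
    -- `X i` becomes `X (i + 1)` on crossing `T i`, then meets `T (i + 1)`, and so on up to `X k`.
    -- In the next case `X (i + 1)` becomes `X i`, which commutes with the rest of the chain.
    by_cases h2 : j = i
    · subst h2
      have h3 := ih (i := j + 1) (by omega) (by omega) (j + 1) (by omega) v hv
      rw [show shiftIdx (j + 1) k (j + 1) = k by unfold shiftIdx; split_ifs <;> omega] at h3
      rw [show shiftIdx j k j = k by unfold shiftIdx; split_ifs <;> omega, chain_succ, chain_succ,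
        H.X_T j (by omega), sub_right_comm, ← map_sub]
      exact sub_mem (hle (hT _ h3)) (Submodule.smul_mem _ _ (key _ (by omega)))
    by_cases h4 : j = i + 1
    · subst h4
      have h3 := ih (i := i + 1) (by omega) (by omega) i (by omega) v hv
      rw [show shiftIdx (i + 1) k i = i by unfold shiftIdx; split_ifs <;> omega] at h3
      rw [show shiftIdx i k (i + 1) = i by unfold shiftIdx; split_ifs; omega, chain_succ,
        chain_succ, H.X_succ_T i (by omega), add_sub_right_comm, ← map_sub]
      exact add_mem (hle (hT _ h3)) (Submodule.smul_mem _ _ (key _ (by omega)))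
    · have h3 := ih (i := i + 1) (by omega) (by omega) j hj v hv
      rw [show shiftIdx (i + 1) k j = shiftIdx i k j by unfold shiftIdx; split_ifs <;> omega]
        at h3
      rw [chain_succ, chain_succ, ← H.T_X_comm i j (by omega) hj (by omega) (by omega), ← map_sub]
      exact hle (hT _ h3)

theorem shiftIdx_lt {i k j n : ℕ} (hk : k < n) (hj : j < n) : shiftIdx i k j < n := by
  unfold shiftIdx; split_ifs <;> omega

theorem HeckeAction.X_mem_chainSpan (H : HeckeAction q n T X) (hV : Stab n T X l k V)
    (hk : k < n) {i d : ℕ} (hi : l ≤ i) (hd : i + d = k + 1) (j : ℕ) (hj : j < n) (z : A)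
    (hz : z ∈ chainSpan T V i d) : X j z ∈ chainSpan T V i d := by
  revert z
  refine chainSpan_le (S := (chainSpan T V i d).comap (X j)) T V i d fun r e hr he v hv => ?_
  have h1 := H.X_chain hV hk (i := r) (d := e) (by omega) (by omega) j hj v hv
  have h2 := chain_mem_chainSpan T r e (hV.1 _ (shiftIdx_lt (i := r) hk hj) v hv)
  have h3 := add_mem (chainSpan_succ_le T V r e h1) h2
  rw [sub_add_cancel] at h3
  exact chainSpan_mono T V hr (by omega) h3

/-- One step of induction: the subspace generated by `V` in rank `k + 1`. -/
theorem HeckeAction.stab_chainSpan (H : HeckeAction q n T X) {d : ℕ} (hV : Stab n T X l k V)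
    (hk : k < n) (hd : l + d = k) : Stab n T X l (k + 1) (chainSpan T V l (d + 1)) := by
  refine ⟨fun j hj z hz => H.X_mem_chainSpan hV hk le_rfl (by omega) j hj z hz,
    fun j hj hjl => ?_⟩
  refine chainSpan_le (S := (chainSpan T V l (d + 1)).comap (T j)) T V l (d + 1)
    fun r e hr he v hv => ?_
  rw [Submodule.mem_comap]
  -- `T j` commutes with a chain starting above `j + 1`, lengthens one starting at `j + 1`, is
  -- absorbed by the quadratic relation at `j`, and is shifted to `T (j - 1)` inside a chain. In the
  -- lengthening case `j + 1 ≠ l` ensures that the new start is still at least `l`.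
  rcases lt_trichotomy (j + 1) r with h | h | h
  · rw [H.T_chain_of_lt h (by omega)]
    exact chain_mem_chainSpan_of_le T hr (by omega) (hV.2 j (by omega) hjl v hv)
  · subst h
    exact chain_mem_chainSpan_of_le T (r := j) (e := e + 1) (by omega) (by omega) hv
  rcases eq_or_lt_of_le (Nat.lt_succ_iff.1 h) with h' | h'
  · subst h'
    cases e with
    | zero => omega
    | succ e =>
      rw [chain_succ, H.T_T _ (by omega), ← chain_succ]
      exact add_mem (Submodule.smul_mem _ _ (chain_mem_chainSpan_of_le T hr (by omega) hv))
        (Submodule.smul_mem _ _ (chain_mem_chainSpan_of_le T (r := r + 1) (e := e) (by omega)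
          (by omega) hv))
  · obtain ⟨j, rfl⟩ : ∃ j', j = j' + 1 := ⟨j - 1, by omega⟩
    rw [H.T_chain_of_mid (by omega) (by omega) (by omega)]
    exact chain_mem_chainSpan_of_le T hr (by omega) (hV.2 j (by omega) (by omega) v hv)

/-- The version of `HeckeAction.X_chain` for polynomials. -/
theorem HeckeAction.aeval_X_chain (H : HeckeAction q n T X) (hV : Stab n T X l k V) (hk : k < n)
    {i d : ℕ} (hi : l ≤ i) (hd : i + d = k) (j : ℕ) (hj : j < n) (f : R[X]) (v : A)
    (hv : v ∈ V) :
    Polynomial.aeval (X j) f (chain T i d v) -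
      chain T i d (Polynomial.aeval (X (shiftIdx i k j)) f v) ∈ chainSpan T V (i + 1) d := by
  have hQ : ∀ (f : R[X]), ∀ z ∈ chainSpan T V (i + 1) d,
      Polynomial.aeval (X j) f z ∈ chainSpan T V (i + 1) d := fun f z hz => by
    refine Polynomial.aeval_apply_smul_mem_of_le_comap hz f (X j) fun w hw => ?_
    exact H.X_mem_chainSpan hV hk (by omega) (by omega) j hj w hw
  induction f using Polynomial.induction_on' generalizing v with
  | add f g hf hg =>
    simp only [map_add, LinearMap.add_apply]
    rw [add_sub_add_comm]
    exact add_mem (hf v hv) (hg v hv)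
  | monomial r c =>
    induction r generalizing v with
    | zero => simp [Module.algebraMap_end_apply]
    | succ r ih =>
      rw [← Polynomial.monomial_mul_X, map_mul, map_mul, Polynomial.aeval_X, Polynomial.aeval_X,
        Module.End.mul_apply, Module.End.mul_apply]
      have h1 := hQ (Polynomial.monomial r c) _ (H.X_chain hV hk hi hd j hj v hv)
      have h2 := ih _ (hV.1 _ (shiftIdx_lt (i := i) hk hj) v hv)
      rw [map_sub] at h1
      simpa using add_mem h1 h2

end Span

end Operators

/-! ### Generalized eigenspaces of the last operators `X j` -/

section Tail

open Module.End (maxGenEigenspace mem_maxGenEigenspace eigenspace mem_eigenspace_iff)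

/-- For `f ≠ 0` there is a polynomial which evaluates to the projection onto the generalized
eigenspace on all vectors annihilated by `f`. -/
theorem exists_projector {R : Type*} [Field R] (a : R) {f : R[X]} (hf : f ≠ 0) :
    ∃ p : R[X], ∀ (A : Type u) [AddCommGroup A] [Module R A] (y : Module.End R A) (v : A),
      Polynomial.aeval y f v = 0 → Polynomial.aeval y p v ∈ y.maxGenEigenspace a ∧
        (v ∈ y.maxGenEigenspace a → Polynomial.aeval y p v = v) := by
  -- With f = (x-a)^K g, g prime to x-a, and u(x-a)^K + wg = 1, the projector is wg. It depends on f
  -- and a only, so the same polynomial serves the source and the target of a homomorphism.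
  obtain ⟨g, hg, hg'⟩ := Polynomial.exists_eq_pow_rootMultiplicity_mul_and_not_dvd f hf a
  have hcop : IsCoprime (Polynomial.X - Polynomial.C a) g :=
    (Polynomial.irreducible_X_sub_C a).coprime_iff_not_dvd.2 hg'
  set K := Polynomial.rootMultiplicity a f
  obtain ⟨u, w, huw⟩ := hcop.pow_left (m := K)
  refine ⟨w * g, fun A _ _ y v hy => ?_⟩
  have hsub : ∀ k, Polynomial.aeval y ((Polynomial.X - Polynomial.C a) ^ k) =
      (y - a • (1 : Module.End R A)) ^ k := fun k => by
    rw [map_pow, map_sub, Polynomial.aeval_X, Polynomial.aeval_C, Algebra.algebraMap_eq_smul_one]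
  refine ⟨?_, fun hv => ?_⟩
  · rw [mem_maxGenEigenspace]
    refine ⟨K, ?_⟩
    rw [← hsub, ← Module.End.mul_apply, ← map_mul, mul_left_comm, ← hg, map_mul,
      Module.End.mul_apply, hy, map_zero]
  · obtain ⟨k, hk⟩ := (mem_maxGenEigenspace _ _ _).1 hv
    rw [← hsub] at hk
    obtain ⟨u', w', huw'⟩ := hcop.pow_left (m := k)
    -- The exponent `k` killing `v` may exceed `K`; since `f` also kills `v` and `g` is prime to
    -- (x-a)^k, the exponent `K` already suffices.
    have h0 : Polynomial.aeval y ((Polynomial.X - Polynomial.C a) ^ K) v = 0 := by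
      have h1 : (Polynomial.X - Polynomial.C a) ^ K =
          u' * (Polynomial.X - Polynomial.C a) ^ K * (Polynomial.X - Polynomial.C a) ^ k +
            w' * f := by
        calc _ = (u' * (Polynomial.X - Polynomial.C a) ^ k + w' * g) *
              (Polynomial.X - Polynomial.C a) ^ K := by rw [huw', one_mul]
          _ = _ := by rw [hg]; ring
      rw [h1, map_add, LinearMap.add_apply, map_mul _ w' f, Module.End.mul_apply, hy, map_zero,
        add_zero, map_mul, Module.End.mul_apply, hk, map_zero]
    have h1 : Polynomial.aeval y (u * (Polynomial.X - Polynomial.C a) ^ K + w * g) v =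
      Polynomial.aeval y (1 : R[X]) v := by rw [huw]
    rw [map_add, LinearMap.add_apply, map_mul, Module.End.mul_apply, h0, map_zero, zero_add] at h1
    rw [h1, map_one, Module.End.one_apply]

variable {R : Type*} [Field R] {A : Type u} [AddCommGroup A] [Module R A]

theorem exists_common_annihilator [FiniteDimensional R A] (X : ℕ → Module.End R A) (n : ℕ) :
    ∃ f : R[X], f ≠ 0 ∧ ∀ j < n, Polynomial.aeval (X j) f = 0 := by
  refine ⟨∏ j ∈ Finset.range n, minpoly R (X j), Finset.prod_ne_zero_iff.2 fun j _ =>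
    minpoly.ne_zero (Algebra.IsIntegral.isIntegral _), fun j hj => ?_⟩
  obtain ⟨c, hc⟩ := Finset.dvd_prod_of_mem (fun j => minpoly R (X j)) (Finset.mem_range.2 hj)
  rw [hc, map_mul, minpoly.aeval, zero_mul]

/-- The simultaneous generalized eigenspace of the operators `X j` with `l ≤ j < k`. -/
def tailSpace (X : ℕ → Module.End R A) (a : R) (l k : ℕ) : Submodule R A :=
  ⨅ (j : ℕ) (_ : l ≤ j ∧ j < k), (X j).maxGenEigenspace a

theorem mem_tailSpace {X : ℕ → Module.End R A} {a : R} {l k : ℕ} {v : A} :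
    v ∈ tailSpace X a l k ↔ ∀ j, l ≤ j → j < k → v ∈ (X j).maxGenEigenspace a := by
  simp [tailSpace, Submodule.mem_iInf]

theorem mem_maxGenEigenspace_of_commute {y z : Module.End R A} {a : R}
    (h : ∀ v, z (y v) = y (z v)) {v : A} (hv : v ∈ y.maxGenEigenspace a) :
    z v ∈ y.maxGenEigenspace a :=
  Module.End.mapsTo_maxGenEigenspace_of_comm (f := y) (g := z)
    (LinearMap.ext fun v => (h v).symm) a hv

theorem mem_maxGenEigenspace_of_pow_mem {y : Module.End R A} {a : R} {r : ℕ} {v : A}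
    (hv : ((y - a • (1 : Module.End R A)) ^ r) v ∈ y.maxGenEigenspace a) :
    v ∈ y.maxGenEigenspace a := by
  rw [mem_maxGenEigenspace] at hv ⊢
  obtain ⟨s, hs⟩ := hv
  exact ⟨s + r, by rw [pow_add, Module.End.mul_apply, hs]⟩

/-- Modulo `S`, `t` turns powers of `y' - a` into powers of `y - a`. A power of `y - a` thus brings
`t v` into `S`, and a further one kills it. -/
theorem mem_maxGenEigenspace_of_twist {y y' t : Module.End R A} {a : R} {S : Submodule R A}
    (hS : S ≤ y.maxGenEigenspace a) (hy : ∀ v ∈ S, y v ∈ S) (hy' : ∀ v ∈ S, y' v ∈ S)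
    (h : ∀ v ∈ S, y (t v) - t (y' v) ∈ S) {v : A} (hv : v ∈ S)
    (hv' : v ∈ y'.maxGenEigenspace a) : t v ∈ y.maxGenEigenspace a := by
  have key : ∀ r, ∀ v ∈ S, ((y - a • (1 : Module.End R A)) ^ r) (t v) -
      t (((y' - a • (1 : Module.End R A)) ^ r) v) ∈ S := by
    intro r
    induction r with
    | zero => intro v _; simp
    | succ r ih =>
      intro v hv
      have h1 : (y - a • (1 : Module.End R A)) (t v) =
          t ((y' - a • (1 : Module.End R A)) v) + (y (t v) - t (y' v)) := by
        simp only [LinearMap.sub_apply, LinearMap.smul_apply, Module.End.one_apply, map_sub,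
          map_smul]
        abel
      have hst : ∀ r, ∀ w ∈ S, ((y - a • (1 : Module.End R A)) ^ r) w ∈ S := fun r => by
        induction r with
        | zero => intro w hw; simpa
        | succ r ih' =>
          intro w hw
          rw [pow_succ, Module.End.mul_apply]
          exact ih' _ (sub_mem (hy w hw) (Submodule.smul_mem _ _ hw))
      have h2 : (y' - a • (1 : Module.End R A)) v ∈ S :=
        sub_mem (hy' v hv) (Submodule.smul_mem _ _ hv)
      rw [pow_succ, pow_succ, Module.End.mul_apply, Module.End.mul_apply, h1, map_add,
        add_sub_right_comm]
      exact add_mem (ih _ h2) (hst r _ (h v hv))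
  obtain ⟨r, hr⟩ := (mem_maxGenEigenspace _ _ _).1 hv'
  have := key r v hv
  rw [hr, map_zero, sub_zero] at this
  exact mem_maxGenEigenspace_of_pow_mem (hS this)

variable {q a : R} {n : ℕ} {T X : ℕ → Module.End R A}

/-- `T j` exchanges `X j` and `X (j + 1)` up to a multiple of `X (j + 1)`, which preserves the tail
space. Excluding `j + 1 = l` keeps both indices on the same side of `l`. -/
theorem HeckeAction.stab_tailSpace (H : HeckeAction q n T X) {l k : ℕ} (hk : k ≤ n) :
    Stab n T X l k (tailSpace X a l k) := by
  have hX : ∀ j < n, ∀ v ∈ tailSpace X a l k, X j v ∈ tailSpace X a l k := fun j hj v hv => by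
    rw [mem_tailSpace] at hv ⊢
    exact fun i hi hi' => mem_maxGenEigenspace_of_commute
      (fun w => H.X_comm j i hj (by omega) w) (hv i hi hi')
  refine ⟨hX, fun j hj hjl v hv => mem_tailSpace.2 fun i hi hi' => ?_⟩
  have hv' := mem_tailSpace.1 hv
  have hS : ∀ r, l ≤ r → r < k → tailSpace X a l k ≤ (X r).maxGenEigenspace a :=
    fun r hr hr' v hv => mem_tailSpace.1 hv r hr hr'
  by_cases h1 : i = j
  · subst h1
    refine mem_maxGenEigenspace_of_twist (y' := X (i + 1)) (hS i hi hi') (hX _ (by omega))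
      (hX _ (by omega)) (fun w hw => ?_) hv (hv' _ (by omega) (by omega))
    rw [H.X_T i (by omega), sub_sub_cancel_left]
    exact neg_mem (Submodule.smul_mem _ _ (hX _ (by omega) w hw))
  by_cases h2 : i = j + 1
  · subst h2
    refine mem_maxGenEigenspace_of_twist (y' := X j) (hS _ hi hi') (hX _ (by omega))
      (hX _ (by omega)) (fun w hw => ?_) hv (hv' _ (by omega) (by omega))
    rw [H.X_succ_T j (by omega), add_sub_cancel_left]
    exact Submodule.smul_mem _ _ (hX _ (by omega) w hw)
  · exact mem_maxGenEigenspace_of_commute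
      (fun w => H.T_X_comm j i (by omega) (by omega) h1 h2 w) (hv' i hi hi')

theorem Stab.inf {n m l k : ℕ} {U V : Submodule R A} (hU : Stab n T X l k U)
    (hV : Stab n T X m k V) (hm : m = l ∨ m = 0) : Stab n T X l k (U ⊓ V) :=
  ⟨fun j hj v hv => ⟨hU.1 j hj v hv.1, hV.1 j hj v hv.2⟩,
    fun j hj hjl v hv => ⟨hU.2 j hj hjl v hv.1, hV.2 j hj (by omega) v hv.2⟩⟩

theorem Stab.mono {n l l' k k' : ℕ} {U : Submodule R A} (hU : Stab n T X l k U) (hk : k' ≤ k)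
    (hl : l' = l ∨ l = 0 ∨ k' ≤ l) : Stab n T X l' k' U :=
  ⟨hU.1, fun j hj hjl => hU.2 j (by omega) (by omega)⟩

/-- `p` evaluates to the projection onto the generalized eigenspace at all `X j`, `j < n`. -/
def IsProjector (X : ℕ → Module.End R A) (a : R) (n : ℕ) (p : R[X]) : Prop :=
  ∀ j < n, (∀ v, Polynomial.aeval (X j) p v ∈ (X j).maxGenEigenspace a) ∧
    ∀ v ∈ (X j).maxGenEigenspace a, Polynomial.aeval (X j) p v = v

theorem exists_isProjector [FiniteDimensional R A] (X : ℕ → Module.End R A) (a : R) (n : ℕ) :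
    ∃ p, IsProjector X a n p := by
  obtain ⟨f, hf, hf'⟩ := exists_common_annihilator X n
  obtain ⟨p, hp⟩ := exists_projector.{u} a hf
  have h : ∀ j < n, ∀ v, Polynomial.aeval (X j) f v = 0 := fun j hj v => by rw [hf' j hj]; rfl
  exact ⟨p, fun j hj => ⟨fun v => (hp A (X j) v (h j hj v)).1,
    fun v => (hp A (X j) v (h j hj v)).2⟩⟩

theorem aeval_mem_of_stable {y : Module.End R A} {U : Submodule R A} (h : ∀ v ∈ U, y v ∈ U)
    (f : R[X]) {v : A} (hv : v ∈ U) : Polynomial.aeval y f v ∈ U :=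
  Polynomial.aeval_apply_smul_mem_of_le_comap hv f y h

theorem aeval_comm_apply {y z : Module.End R A} (h : ∀ v, z (y v) = y (z v)) (f : R[X]) (v : A) :
    z (Polynomial.aeval y f v) = Polynomial.aeval y f (z v) := by
  have h1 : Commute z y := LinearMap.ext h
  have h2 : Commute z (Polynomial.aeval y f) := by
    induction f using Polynomial.induction_on' with
    | add f g hf hg => rw [map_add]; exact hf.add_right hg
    | monomial r c =>
      rw [Polynomial.aeval_monomial]
      exact Commute.mul_right (Algebra.commutes c z).symm (h1.pow_right r)
  exact LinearMap.congr_fun h2.eq v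

/-- An element of the tail space modulo shorter chains comes from the tail space. -/
theorem HeckeAction.exists_shuffle (H : HeckeAction q n T X) [FiniteDimensional R A]
    {l k i d : ℕ} {V : Submodule R A} (hV : Stab n T X 0 k V) (hk : k < n) (hd : i + d = k)
    {z : A} (hz : z ∈ chainSpan T V i (d + 1)) (hz' : z ∈ tailSpace X a l (k + 1)) :
    ∃ v ∈ V, v ∈ tailSpace X a l k ∧
      (i < l → l ≤ k → v ∈ (X (l - 1)).maxGenEigenspace a) ∧
      z - chain T i d v ∈ chainSpan T V (i + 1) d := by
  obtain ⟨p, hp⟩ := exists_isProjector X a n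
  -- Each `p (X j)` with `l ≤ j ≤ k` fixes `z`. Applied to the leading term it replaces `v` by `p (X
  -- (shiftIdx i k j)) v`, so the projections can be imposed on `v` one index at a time.
  have key : ∀ s : Finset ℕ, s ⊆ Finset.Ico l (k + 1) → ∃ v ∈ V,
      (∀ j ∈ s, v ∈ (X (shiftIdx i k j)).maxGenEigenspace a) ∧
      z - chain T i d v ∈ chainSpan T V (i + 1) d := by
    intro s
    induction s using Finset.induction_on with
    | empty =>
      intro _
      obtain ⟨_, ⟨v, hv, rfl⟩, w, hw, rfl⟩ := Submodule.mem_sup.1 hz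
      exact ⟨v, hv, by simp, by simpa using hw⟩
    | insert j s hj ih =>
      intro hs
      obtain ⟨v, hv, hvs, hvz⟩ := ih fun x hx => hs (Finset.mem_insert_of_mem hx)
      have hj' := Finset.mem_Ico.1 (hs (Finset.mem_insert_self j s))
      have hσ : ∀ j < n, shiftIdx i k j < n := fun j hj => shiftIdx_lt hk hj
      have hjn : j < n := by omega
      refine ⟨Polynomial.aeval (X (shiftIdx i k j)) p v,
        aeval_mem_of_stable (hV.1 _ (hσ j hjn)) p hv, ?_, ?_⟩
      · intro j' hj''
        rcases Finset.mem_insert.1 hj'' with rfl | hj''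
        · exact (hp _ (hσ _ hjn)).1 v
        · have hj3 := Finset.mem_Ico.1 (hs (Finset.mem_insert_of_mem hj''))
          refine mem_maxGenEigenspace_of_commute (fun w => ?_) (hvs j' hj'')
          exact (aeval_comm_apply (fun w => H.X_comm _ _ (hσ j' (by omega)) (hσ j hjn) w) p w).symm
      · have h1 := H.aeval_X_chain hV hk (Nat.zero_le i) hd j hjn p v hv
        have h2 : Polynomial.aeval (X j) p (z - chain T i d v) ∈ chainSpan T V (i + 1) d :=
          aeval_mem_of_stable
            (fun w hw => H.X_mem_chainSpan hV hk (Nat.zero_le _) (by omega) j hjn w hw) p hvz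
        rw [map_sub, (hp j hjn).2 z (mem_tailSpace.1 hz' j hj'.1 hj'.2)] at h2
        simpa using add_mem h2 h1
  obtain ⟨v, hv, hvs, hvz⟩ := key _ le_rfl
  -- The shifted indices of `l, …, k` cover `l, …, k - 1`. If `i < l` and `l ≤ k`, the index `l`
  -- itself shifts to `l - 1`, which gives the extra condition at `l - 1`.
  refine ⟨v, hv, mem_tailSpace.2 fun j hj hj' => ?_, fun hi hl => ?_, hvz⟩
  · by_cases h : j < i
    · have := hvs j (Finset.mem_Ico.2 (by omega))
      rwa [show shiftIdx i k j = j by unfold shiftIdx; split_ifs <;> omega] at this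
    · have := hvs (j + 1) (Finset.mem_Ico.2 (by omega))
      rwa [show shiftIdx i k (j + 1) = j by unfold shiftIdx; split_ifs <;> omega] at this
  · have := hvs l (Finset.mem_Ico.2 (by omega))
    rwa [show shiftIdx i k l = l - 1 by unfold shiftIdx; split_ifs <;> omega] at this

theorem Stab.chain_mem {n l k r e : ℕ} {U : Submodule R A} (hU : Stab n T X l k U)
    (hr : l ≤ r) (he : r + e < k) {v : A} (hv : v ∈ U) : chain T r e v ∈ U := by
  induction e generalizing r with
  | zero => exact hv
  | succ e ih => exact hU.2 r (by omega) (by omega) _ (ih (by omega) (by omega))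

/-- Every element of the span in rank `k + 1` which lies in the tail space belongs to the span of
the tail space of `V`. -/
theorem HeckeAction.chainSpan_inf_tailSpace_le (H : HeckeAction q n T X) [FiniteDimensional R A]
    {l k m : ℕ} {V : Submodule R A} (hV : Stab n T X 0 k V) (hk : k < n) (hl : l + m = k)
    (hVk : V ⊓ tailSpace X a l k ≤ (X k).maxGenEigenspace a)
    (hVl : 0 < l → ∀ v ∈ V, v ∈ tailSpace X a l k → v ∈ (X (l - 1)).maxGenEigenspace a → v = 0) :
    chainSpan T V 0 (k + 1) ⊓ tailSpace X a l (k + 1) ≤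
      chainSpan T (V ⊓ tailSpace X a l k) l (m + 1) := by
  have htail : V ⊓ tailSpace X a l k ≤ tailSpace X a l (k + 1) := fun v hv =>
    mem_tailSpace.2 fun j hj hj' => by
      rcases eq_or_lt_of_le (Nat.lt_succ_iff.1 hj') with rfl | h
      · exact hVk hv
      · exact mem_tailSpace.1 hv.2 j hj h
  have key : ∀ d i, i + d = k → chainSpan T V i (d + 1) ⊓ tailSpace X a l (k + 1) ≤
      chainSpan T (V ⊓ tailSpace X a l k) l (m + 1) := by
    intro d
    induction d with
    | zero =>
      rintro i hi z ⟨hz, hz'⟩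
      obtain ⟨v, hv, hvt, hvl, hvz⟩ := H.exists_shuffle hV hk hi hz hz'
      obtain rfl : z = v := sub_eq_zero.1 ((Submodule.mem_bot R).1 hvz)
      exact le_chainSpan T _ l m ⟨hv, hvt⟩
    | succ d ih =>
      rintro i hi z ⟨hz, hz'⟩
      obtain ⟨v, hv, hvt, hvl, hvz⟩ := H.exists_shuffle hV hk hi hz hz'
      -- A chain starting below `l` has its leading coefficient in the generalized eigenspace of `X
      -- (l - 1)` too, hence that coefficient is zero.
      by_cases hil : i < l
      · rw [hVl (by omega) v hv hvt (hvl hil (by omega)), map_zero, sub_zero] at hvz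
        exact ih (i + 1) (by omega) ⟨hvz, hz'⟩
      · have h1 : chain T i (d + 1) v ∈ chainSpan T (V ⊓ tailSpace X a l k) l (m + 1) :=
          chain_mem_chainSpan_of_le T (by omega) (by omega) ⟨hv, hvt⟩
        have h2 : chain T i (d + 1) v ∈ tailSpace X a l (k + 1) :=
          (H.stab_tailSpace (by omega)).chain_mem (by omega) (by omega) (htail ⟨hv, hvt⟩)
        rw [← sub_add_cancel z (chain T i (d + 1) v)]
        exact add_mem (ih (i + 1) (by omega) ⟨hvz, sub_mem hz' h2⟩) h1
  exact key k 0 (zero_add k)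

/-- A subspace of the tail space which is stable under the parabolic subalgebra is the whole tail
space of a stable subspace. -/
theorem HeckeAction.exists_envelope (H : HeckeAction q n T X) [FiniteDimensional R A]
    {l m : ℕ} (hn : l + m ≤ n) {Y : Submodule R A} (hY : Stab n T X l (l + m) Y)
    (hYt : Y ≤ tailSpace X a l (l + m))
    (hYl : 0 < l → ∀ v ∈ Y, v ∈ (X (l - 1)).maxGenEigenspace a → v = 0) :
    ∃ N, Stab n T X 0 (l + m) N ∧ Y ≤ N ∧ N ⊓ tailSpace X a l (l + m) ≤ Y := by
  induction m with
  -- For `m = 0` the parabolic of type `(l, 0)` is all of rank `l`, so `Y` is its own envelope.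
  | zero => exact ⟨Y, hY.mono le_rfl (by simp), le_rfl, inf_le_left⟩
  | succ m ih =>
    have hmono : tailSpace X a l (l + (m + 1)) ≤ tailSpace X a l (l + m) := fun v hv =>
      mem_tailSpace.2 fun j hj hj' => mem_tailSpace.1 hv j hj (by omega)
    obtain ⟨V, hV, hYV, hVY⟩ := ih (by omega) (hY.mono (by omega) (by simp)) (hYt.trans hmono)
    have hlm : l + m < n := by omega
    -- The envelope is the subspace generated in one rank higher by the previous envelope. Its tail
    -- part is spanned by chains starting at `l` or later, and these preserve `Y`.
    refine ⟨chainSpan T V 0 (l + m + 1), H.stab_chainSpan hV hlm (zero_add _),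
      hYV.trans (le_chainSpan T V 0 _), ?_⟩
    refine (H.chainSpan_inf_tailSpace_le hV hlm rfl (fun v hv => ?_)
      (fun hl v hv hvt => hYl hl v (hVY ⟨hv, hvt⟩))).trans ?_
    · exact mem_tailSpace.1 (hYt (hVY hv)) _ (by omega) (by omega)
    · exact chainSpan_le T _ l (m + 1) fun r e hr he v hv =>
        hY.chain_mem hr (by omega) (hVY hv)

/-- A minimal nonzero subspace stable under the operators of rank `k`. -/
def MinStab (n : ℕ) (T X : ℕ → Module.End R A) (k : ℕ) (N : Submodule R A) : Prop :=
  N ≠ ⊥ ∧ Stab n T X 0 k N ∧ ∀ U ≤ N, Stab n T X 0 k U → U ≠ ⊥ → U = N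

theorem exists_minStab_le [FiniteDimensional R A] {k : ℕ} {B : Submodule R A}
    (hB : Stab n T X 0 k B) (h0 : B ≠ ⊥) : ∃ V ≤ B, MinStab n T X k V := by
  obtain ⟨V, ⟨hVB, hV, hV0⟩, hmin⟩ := wellFounded_lt.has_min
    {V : Submodule R A | V ≤ B ∧ Stab n T X 0 k V ∧ V ≠ ⊥} ⟨B, le_rfl, hB, h0⟩
  exact ⟨V, hVB, hV0, hV, fun U hU hUs hU0 => hU.eq_of_not_lt (hmin U ⟨hU.trans hVB, hUs, hU0⟩)⟩

theorem MinStab.le_of_inf_ne_bot {k : ℕ} {N U : Submodule R A} (hN : MinStab n T X k N)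
    (hU : Stab n T X 0 k U) (h : N ⊓ U ≠ ⊥) : N ≤ U :=
  inf_eq_left.1 (hN.2.2 _ inf_le_left (hN.2.1.inf hU (Or.inl rfl)) h)

/-- `HasTail X a l k N`: the tail space with eigenvalue `a` of the operators `X j`, `l ≤ j < k`,
meets `N` nontrivially, and `l` is minimal with this property. -/
def HasTail (X : ℕ → Module.End R A) (a : R) (l k : ℕ) (N : Submodule R A) : Prop :=
  N ⊓ tailSpace X a l k ≠ ⊥ ∧
    (0 < l → ∀ v ∈ N, v ∈ tailSpace X a l k → v ∈ (X (l - 1)).maxGenEigenspace a → v = 0)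

theorem HeckeAction.stab_inf_tailSpace (H : HeckeAction q n T X) {l k : ℕ} (hk : k ≤ n)
    {N : Submodule R A} (hN : Stab n T X 0 k N) : Stab n T X l k (N ⊓ tailSpace X a l k) := by
  rw [inf_comm]
  exact (H.stab_tailSpace hk).inf hN (Or.inr rfl)

/-- The tail space of an irreducible representation is irreducible. -/
theorem HeckeAction.tail_le (H : HeckeAction q n T X) [FiniteDimensional R A]
    {l k : ℕ} (hlk : l ≤ k) (hk : k ≤ n) {N : Submodule R A} (hN : MinStab n T X k N)
    (ht : HasTail X a l k N) {Y : Submodule R A} (hYN : Y ≤ N ⊓ tailSpace X a l k)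
    (hY : Stab n T X l k Y) (hY0 : Y ≠ ⊥) : N ⊓ tailSpace X a l k ≤ Y := by
  obtain ⟨m, rfl⟩ := Nat.exists_eq_add_of_le hlk
  -- `Y` generates a stable subspace whose tail is no larger than `Y`, while irreducibility of `N`
  -- forces that subspace to contain `N`.
  obtain ⟨N', hN', hYN', hN'Y⟩ := H.exists_envelope hk hY (hYN.trans inf_le_right)
    (fun hl v hv => ht.2 hl v (hYN hv).1 (hYN hv).2)
  have : N ≤ N' := hN.le_of_inf_ne_bot hN' fun h =>
    hY0 (le_bot_iff.1 (h ▸ le_inf (hYN.trans inf_le_left) hYN'))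
  exact (inf_le_inf_right _ this).trans hN'Y

theorem eigenspace_le_maxGenEigenspace (y : Module.End R A) (a : R) :
    y.eigenspace a ≤ y.maxGenEigenspace a := Module.End.eigenspace_le_maxGenEigenspace

theorem HeckeAction.stab_eigenspace (H : HeckeAction q n T X) {k : ℕ} (hk : k < n) :
    Stab n T X 0 k ((X k).eigenspace a) := by
  refine ⟨fun j hj v hv => ?_, fun j hj _ v hv => ?_⟩ <;> rw [mem_eigenspace_iff] at hv ⊢
  · rw [H.X_comm k j hk hj, hv, map_smul]
  · rw [← H.T_X_comm j k (by omega) hk (by omega) (by omega), hv, map_smul]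

/-- The eigenvector is the last nonzero `(y - a) ^ r v`. This form is recorded because operators
commuting with `y` keep their eigenvalue on it, which allows common eigenvectors to be built. -/
theorem exists_mem_eigenspace {y : Module.End R A} {U : Submodule R A}
    (hU : ∀ v ∈ U, y v ∈ U) {v : A} (hv : v ∈ U) (hv' : v ∈ y.maxGenEigenspace a) (h0 : v ≠ 0) :
    ∃ w ∈ U, w ∈ y.eigenspace a ∧ w ≠ 0 ∧ ∃ r : ℕ, w = ((y - a • (1 : Module.End R A)) ^ r) v := by
  classical
  have hex := (mem_maxGenEigenspace _ _ _).1 hv'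
  have hr := Nat.find_spec hex
  have hmin := fun m h => Nat.find_min hex (m := m) h
  obtain ⟨r, hr'⟩ : ∃ r, Nat.find hex = r + 1 :=
    Nat.exists_eq_succ_of_ne_zero fun h => h0 (by simpa [h] using hr)
  rw [hr'] at hr hmin
  refine ⟨_, ?_, ?_, hmin r (Nat.lt_succ_self r), r, rfl⟩
  · have : ∀ r, ((y - a • (1 : Module.End R A)) ^ r) v ∈ U := fun r => by
      induction r with
      | zero => simpa
      | succ r ih =>
        rw [pow_succ', Module.End.mul_apply]
        exact sub_mem (hU _ ih) (Submodule.smul_mem _ _ ih)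
    exact this r
  · rw [pow_succ', Module.End.mul_apply] at hr
    exact mem_eigenspace_iff.2 (sub_eq_zero.1 hr)

/-- The socle of the eigenspace of `X k` on an irreducible representation. -/
theorem HeckeAction.exists_minStab_le_eigenspace (H : HeckeAction q n T X) [FiniteDimensional R A]
    {k : ℕ} (hk : k < n) {B : Submodule R A} (hB : Stab n T X 0 k B)
    (h : B ⊓ (X k).maxGenEigenspace a ≠ ⊥) :
    ∃ V ≤ B ⊓ (X k).eigenspace a, MinStab n T X k V := by
  obtain ⟨v, ⟨hv, hv'⟩, h0⟩ := (Submodule.ne_bot_iff _).1 h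
  obtain ⟨w, hw, hw', hw0, -⟩ := exists_mem_eigenspace (hB.1 k hk) hv hv' h0
  exact exists_minStab_le (hB.inf (H.stab_eigenspace hk) (Or.inl rfl))
    ((Submodule.ne_bot_iff _).2 ⟨w, ⟨hw, hw'⟩, hw0⟩)

variable {l k m : ℕ} {N V : Submodule R A}

/-- An irreducible subspace in the socle of the eigenspace generates the tail space. -/
theorem HeckeAction.tail_le_chainSpan (H : HeckeAction q n T X) [FiniteDimensional R A]
    (hk : k < n) (hl : l + m = k) (hN : MinStab n T X (k + 1) N) (ht : HasTail X a l (k + 1) N)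
    (hV : MinStab n T X k V) (hVN : V ≤ N ⊓ (X k).eigenspace a) :
    N ⊓ tailSpace X a l (k + 1) ≤ chainSpan T (V ⊓ tailSpace X a l k) l (m + 1) := by
  -- The irreducible `N` is generated by `V`, so the shuffling argument applies to its whole tail.
  have hNV : N ≤ chainSpan T V 0 (k + 1) := by
    refine hN.le_of_inf_ne_bot (H.stab_chainSpan hV.2.1 hk (zero_add k)) fun h => hV.1 ?_
    exact le_bot_iff.1 (h ▸ le_inf (hVN.trans inf_le_left) (le_chainSpan T V 0 k))
  have hVk : V ≤ (X k).maxGenEigenspace a :=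
    (hVN.trans inf_le_right).trans (eigenspace_le_maxGenEigenspace _ _)
  refine (inf_le_inf_right _ hNV).trans (H.chainSpan_inf_tailSpace_le hV.2.1 hk hl
    (inf_le_left.trans hVk) fun hl0 v hv hvt hvl => ht.2 hl0 v (hVN hv).1 ?_ hvl)
  refine mem_tailSpace.2 fun j hj hj' => ?_
  rcases eq_or_lt_of_le (Nat.lt_succ_iff.1 hj') with rfl | h
  · exact hVk hv
  · exact mem_tailSpace.1 hvt j hj h

theorem tailSpace_succ {X : ℕ → Module.End R A} (hlk : l ≤ k) {v : A} :
    v ∈ tailSpace X a l (k + 1) ↔ v ∈ tailSpace X a l k ∧ v ∈ (X k).maxGenEigenspace a := by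
  simp only [mem_tailSpace]
  refine ⟨fun h => ⟨fun j hj hj' => h j hj (by omega), h k hlk (by omega)⟩,
    fun h j hj hj' => ?_⟩
  rcases eq_or_lt_of_le (Nat.lt_succ_iff.1 hj') with rfl | h'
  · exact h.2
  · exact h.1 j hj h'

/-- The tail of `N` is spanned by chains on the tail of `V`, so the latter cannot vanish. Minimality
of `l` is inherited from `N` because `X k` acts on `V` by `a`. -/
theorem HeckeAction.hasTail_socle (H : HeckeAction q n T X) [FiniteDimensional R A]
    (hk : k < n) (hl : l ≤ k) (hN : MinStab n T X (k + 1) N) (ht : HasTail X a l (k + 1) N)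
    (hV : MinStab n T X k V) (hVN : V ≤ N ⊓ (X k).eigenspace a) : HasTail X a l k V := by
  obtain ⟨m, hm⟩ := Nat.exists_eq_add_of_le hl
  refine ⟨fun h => ht.1 ?_, fun hl0 v hv hvt hvl => ht.2 hl0 v (hVN hv).1
    ((tailSpace_succ hl).2 ⟨hvt, eigenspace_le_maxGenEigenspace _ _ (hVN hv).2⟩) hvl⟩
  have := H.tail_le_chainSpan hk hm.symm hN ht hV hVN
  rw [h] at this
  refine le_bot_iff.1 (this.trans (chainSpan_le T _ _ _ fun r e _ _ v hv => ?_))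
  rw [(Submodule.mem_bot R).1 hv, map_zero]
  exact zero_mem _

end Tail

/-! ### Nilpotency of `X k - a` and the socle -/

section Nilpotency

open Module.End (maxGenEigenspace mem_maxGenEigenspace eigenspace mem_eigenspace_iff)

variable {R : Type*} [Field R] {A : Type u} [AddCommGroup A] [Module R A]

/-- The endomorphism `y - a`. -/
abbrev shifted (y : Module.End R A) (a : R) : Module.End R A := y - a • (1 : Module.End R A)

theorem shifted_apply (y : Module.End R A) (a : R) (v : A) : shifted y a v = y v - a • v := rfl

theorem shifted_pow_comm {y z : Module.End R A} (h : ∀ v, z (y v) = y (z v)) (a : R) (r : ℕ)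
    (v : A) : z ((shifted y a ^ r) v) = (shifted y a ^ r) (z v) := by
  induction r generalizing v with
  | zero => rfl
  | succ r ih =>
    rw [pow_succ, Module.End.mul_apply, Module.End.mul_apply, ih, shifted_apply, shifted_apply,
      map_sub, map_smul, h]

theorem shifted_pow_mem {y : Module.End R A} {U : Submodule R A} (h : ∀ v ∈ U, y v ∈ U) (a : R)
    (r : ℕ) {v : A} (hv : v ∈ U) : (shifted y a ^ r) v ∈ U := by
  induction r with
  | zero => exact hv
  | succ r ih =>
    rw [pow_succ', Module.End.mul_apply]
    exact sub_mem (h _ ih) (Submodule.smul_mem _ _ ih)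

theorem mem_eigenspace_iff_shifted {y : Module.End R A} {a : R} {v : A} :
    v ∈ y.eigenspace a ↔ shifted y a v = 0 := by
  rw [mem_eigenspace_iff, shifted_apply, sub_eq_zero]

theorem finrank_eq_map_add_ker [FiniteDimensional R A] (y : Module.End R A) (P : Submodule R A) :
    Module.finrank R P = Module.finrank R (P.map y) +
      Module.finrank R (P ⊓ LinearMap.ker y : Submodule R A) := by
  have h := LinearMap.finrank_range_add_finrank_ker (y.domRestrict P)
  rw [LinearMap.range_domRestrict] at h
  rw [← h, LinearMap.ker_domRestrict, ← Submodule.finrank_map_subtype_eq,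
    Submodule.map_comap_subtype]

/-- A nilpotent operator whose highest power has large rank has only blocks of the same size. -/
theorem mul_finrank_ker_le [FiniteDimensional R A] {y : Module.End R A} {W : Submodule R A} {m : ℕ}
    (hW : ∀ v ∈ W, y v ∈ W) (h0 : ∀ v ∈ W, (y ^ (m + 1)) v = 0)
    (hU : Module.finrank R W ≤ (m + 1) * Module.finrank R (W.map (y ^ m))) :
    (m + 1) * Module.finrank R (W ⊓ LinearMap.ker y : Submodule R A) ≤ Module.finrank R W := by
  set d : ℕ → ℕ := fun j => Module.finrank R (W.map (y ^ j))
  have hpow : ∀ r, ∀ v ∈ W, (y ^ r) v ∈ W := fun r => by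
    induction r with
    | zero => exact fun v hv => hv
    | succ r ih => intro v hv; rw [pow_succ, Module.End.mul_apply]; exact ih _ (hW v hv)
  -- The drop `d j - d (j + 1)` is the dimension of the kernel of `y` on `y ^ j W`, which contains
  -- `y ^ m W`. Summing gives `m * d m ≤ d 1`, while `hU` bounds the kernel on `W` by `d m`.
  have hstep : ∀ j ≤ m, d (j + 1) + d m ≤ d j := by
    intro j hj
    have h1 := finrank_eq_map_add_ker y (W.map (y ^ j))
    rw [← Submodule.map_comp, ← Module.End.mul_eq_comp, ← pow_succ'] at h1
    have h2 : W.map (y ^ m) ≤ W.map (y ^ j) ⊓ LinearMap.ker y := by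
      rintro _ ⟨w, hw, rfl⟩
      refine ⟨⟨(y ^ (m - j)) w, hpow _ w hw, ?_⟩, ?_⟩
      · rw [← Module.End.mul_apply, ← pow_add, Nat.add_sub_cancel' hj]
      · change y ((y ^ m) w) = 0
        rw [← Module.End.mul_apply, ← pow_succ', h0 w hw]
    have h3 := Submodule.finrank_mono h2
    change Module.finrank R _ = Module.finrank R _ + _ at h1
    simp only [d]
    omega
  have hsum : ∀ i ≤ m, i * d m ≤ d (m + 1 - i) := by
    intro i
    induction i with
    | zero => simp
    | succ i ih =>
      intro hi
      have h1 := ih (by omega)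
      have h2 := hstep (m + 1 - (i + 1)) (by omega)
      rw [show m + 1 - (i + 1) + 1 = m + 1 - i by omega] at h2
      rw [add_mul, one_mul]
      omega
  have h1 := hsum m le_rfl
  rw [Nat.add_sub_cancel_left] at h1
  have h2 := finrank_eq_map_add_ker y W
  have h3 : Module.finrank R (W.map y) = d 1 := by
    change _ = Module.finrank R (W.map (y ^ 1))
    rw [pow_one]
  have h4 : Module.finrank R (W.map (y ^ m)) = d m := rfl
  have h5 : Module.finrank R (W ⊓ LinearMap.ker y : Submodule R A) ≤ d m := by
    rw [h4, add_mul, one_mul] at hU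
    omega
  rw [add_mul, one_mul]
  have h6 := Nat.mul_le_mul_left m h5
  omega

theorem finrank_chainSpan_le [FiniteDimensional R A] (T : ℕ → Module.End R A)
    (V : Submodule R A) (i d : ℕ) :
    Module.finrank R (chainSpan T V i d) ≤ d * Module.finrank R V := by
  induction d generalizing i with
  | zero => rw [chainSpan, finrank_bot, zero_mul]
  | succ d ih =>
    refine (Submodule.finrank_add_le_finrank_add_finrank _ _).trans ?_
    have h1 := Submodule.finrank_map_le (chain T i d) V
    have h2 := ih (i + 1)
    rw [add_mul, one_mul]
    omega

variable {q a : R} {n : ℕ} {T X : ℕ → Module.End R A} {l k m : ℕ} {N V : Submodule R A}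

/-- On vectors where `X (i + 1)` acts by `a`, the commutation rule reads (X_{i+1} - a) T_i = T_i
(X_i - a) + (q-1)a. On iterating, earlier corrections are killed by X_{i+1} - a and only the last
survives. It raises the nilpotency index. -/
theorem HeckeAction.shifted_pow_T (H : HeckeAction q n T X) {i : ℕ} (hi : i + 1 < n) {u : A}
    (hu : X (i + 1) u = a • u) (r : ℕ) :
    (shifted (X (i + 1)) a ^ (r + 1)) (T i u) =
      T i ((shifted (X i) a ^ (r + 1)) u) + ((q - 1) * a) • (shifted (X i) a ^ r) u := by
  have hstep : ∀ w, X (i + 1) w = a • w → shifted (X (i + 1)) a (T i w) =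
      T i (shifted (X i) a w) + ((q - 1) * a) • w := fun w hw => by
    rw [shifted_apply, shifted_apply, H.X_succ_T i hi, hw, map_sub, map_smul, smul_smul]
    abel
  have hcomm : ∀ r, X (i + 1) ((shifted (X i) a ^ r) u) = a • (shifted (X i) a ^ r) u :=
    fun r => by
      rw [shifted_pow_comm (fun v => H.X_comm _ _ (by omega) (by omega) v), hu, map_smul]
  induction r with
  | zero => simpa using hstep u hu
  | succ r ih =>
    rw [pow_succ' _ (r + 1), Module.End.mul_apply, ih, map_add, map_smul, hstep _ (hcomm _),
      shifted_apply (X (i + 1)) a ((shifted (X i) a ^ r) u), hcomm, sub_self, smul_zero, add_zero,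
      pow_succ' _ (r + 1), Module.End.mul_apply]

theorem HasTail.inf_ne_bot (hl : l ≤ k) (ht : HasTail X a l (k + 1) N) :
    N ⊓ (X k).maxGenEigenspace a ≠ ⊥ := fun h => ht.1 <| le_bot_iff.1 <| h ▸
  inf_le_inf_left N fun _ hv => ((tailSpace_succ hl).1 hv).2

/-- The nilpotency index of `X k - a` on the tail space. -/
theorem HeckeAction.tail_pow (H : HeckeAction q n T X) [FiniteDimensional R A]
    (ha : (q - 1) * a ≠ 0) (hk : k < n) (hl : l + m = k) (hN : MinStab n T X (k + 1) N)
    (ht : HasTail X a l (k + 1) N) :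
    (∀ w ∈ N ⊓ tailSpace X a l (k + 1), (shifted (X k) a ^ (m + 1)) w = 0) ∧
      ∃ w ∈ N ⊓ tailSpace X a l (k + 1), (shifted (X k) a ^ m) w ≠ 0 := by
  induction m generalizing k N with
  | zero =>
    obtain ⟨V, hVN, hV⟩ := H.exists_minStab_le_eigenspace hk
      (hN.2.1.mono (Nat.le_succ k) (Or.inl rfl)) (ht.inf_ne_bot (by omega))
    refine ⟨fun w hw => ?_, ?_⟩
    · have := H.tail_le_chainSpan hk hl hN ht hV hVN hw
      simp only [chainSpan, sup_bot_eq] at this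
      obtain ⟨v, hv, rfl⟩ := this
      rw [zero_add, pow_one]
      exact mem_eigenspace_iff_shifted.1 (hVN hv.1).2
    · obtain ⟨w, hw, hw0⟩ := (Submodule.ne_bot_iff _).1 ht.1
      exact ⟨w, hw, hw0⟩
  | succ m ih =>
    obtain ⟨V, hVN, hV⟩ := H.exists_minStab_le_eigenspace hk
      (hN.2.1.mono (Nat.le_succ k) (Or.inl rfl)) (ht.inf_ne_bot (by omega))
    obtain ⟨k, rfl⟩ : ∃ k', k = k' + 1 := ⟨l + m, by omega⟩
    have hVt := H.hasTail_socle hk (by omega) hN ht hV hVN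
    obtain ⟨ih1, u, hu, hu0⟩ := ih (by omega) (by omega) hV hVt
    have hmem : ∀ v ∈ V, X (k + 1) v = a • v := fun v hv => mem_eigenspace_iff.1 (hVN hv).2
    -- If `u` has top order in the tail of `V`, then `(X (k + 1) - a) ^ (m + 1)` sends `T k u` to
    -- `(q - 1) a (X k - a) ^ m u`, which is nonzero.
    refine ⟨fun w hw => ?_, T k u, ⟨hN.2.1.2 k (by omega) (by omega) u (hVN hu.1).1, ?_⟩, ?_⟩
    · have := H.tail_le_chainSpan hk hl hN ht hV hVN hw
      refine LinearMap.mem_ker.1 (chainSpan_le T _ l (m + 1 + 1)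
        (S := LinearMap.ker (shifted (X (k + 1)) a ^ (m + 1 + 1))) (fun r e hr he v hv => ?_) this)
      rw [LinearMap.mem_ker]
      cases e with
      | zero =>
        rw [chain_zero, pow_succ, Module.End.mul_apply,
          mem_eigenspace_iff_shifted.1 (hVN hv.1).2, map_zero]
      | succ e =>
        -- All factors of the chain but the last, `T k`, commute with `X (k + 1)`; only `T k v` has
        -- to be killed.
        have h1 : (shifted (X k) a ^ (m + 1)) v = 0 := ih1 v hv
        rw [chain_succ_last, show r + e = k by omega,
          ← shifted_pow_comm (z := chain T r e)
            (fun w => (H.X_chain_of_lt (by omega) (by omega) (by omega) w).symm),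
          H.shifted_pow_T hk (hmem v hv.1), h1, pow_succ', Module.End.mul_apply, h1]
        simp
    · refine (H.stab_tailSpace (by omega)).2 k (by omega) (by omega) u
        ((tailSpace_succ (by omega)).2 ⟨hu.2, ?_⟩)
      exact eigenspace_le_maxGenEigenspace _ _ (hVN hu.1).2
    · rw [H.shifted_pow_T hk (hmem u hu.1), ih1 u hu, map_zero, zero_add]
      exact smul_ne_zero ha hu0

/-- The eigenspace of `X k` on the tail space is contained in the socle of the eigenspace. -/
theorem HeckeAction.tail_inf_eigenspace_le (H : HeckeAction q n T X) [FiniteDimensional R A]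
    (ha : (q - 1) * a ≠ 0) (hk : k < n) (hl : l ≤ k) (hN : MinStab n T X (k + 1) N)
    (ht : HasTail X a l (k + 1) N) (hV : MinStab n T X k V) (hVN : V ≤ N ⊓ (X k).eigenspace a) :
    N ⊓ tailSpace X a l (k + 1) ⊓ (X k).eigenspace a ≤ V := by
  obtain ⟨m, hm⟩ := Nat.exists_eq_add_of_le hl
  obtain ⟨hb, w, hw, hw0⟩ := H.tail_pow ha hk hm.symm hN ht
  have hVt := H.hasTail_socle hk hl hN ht hV hVN
  set W := N ⊓ tailSpace X a l (k + 1) with hWdef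
  have hW : Stab n T X l (k + 1) W := H.stab_inf_tailSpace (by omega) hN.2.1
  have hUs : Stab n T X l k (W.map (shifted (X k) a ^ m)) := by
    constructor
    · rintro j hj _ ⟨w, hw, rfl⟩
      exact ⟨X j w, hW.1 j hj w hw, (shifted_pow_comm (fun v => H.X_comm j k hj hk v) a m w).symm⟩
    · rintro j hj hjl _ ⟨w, hw, rfl⟩
      exact ⟨T j w, hW.2 j (by omega) hjl w hw, (shifted_pow_comm (fun v => H.T_X_comm j k
        (by omega) hk (by omega) (by omega) v) a m w).symm⟩
  have hUW : W.map (shifted (X k) a ^ m) ≤ W := by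
    rintro _ ⟨w, hw, rfl⟩
    exact shifted_pow_mem (hW.1 k hk) a m hw
  have hU0 : W.map (shifted (X k) a ^ m) ≠ ⊥ :=
    (Submodule.ne_bot_iff _).2 ⟨_, Submodule.mem_map_of_mem hw, hw0⟩
  -- Irreducibility of the tail gives dim W ≤ (m+1) dim Y. For Y = (X_k - a)^m W this forces (m+1)
  -- dim ker(X_k - a) ≤ dim W; for Y the tail of V it gives dim ker(X_k - a) ≤ dim Y. As Y lies in
  -- this kernel, they coincide.
  have hspan : ∀ Y ≤ W, Stab n T X l k Y → Y ≠ ⊥ → W ≤ chainSpan T Y l (m + 1) := by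
    intro Y hYW hYs hY0
    refine H.tail_le (by omega) (by omega) hN ht ?_ (H.stab_chainSpan hYs hk hm.symm) ?_
    · exact chainSpan_le T Y l (m + 1) fun r e hr he v hv => hW.chain_mem hr (by omega) (hYW hv)
    · exact fun h => hY0 (le_bot_iff.1 (h ▸ le_chainSpan T Y l m))
  have hdim := mul_finrank_ker_le (hW := fun v hv => sub_mem (hW.1 k hk v hv)
    (Submodule.smul_mem W a hv)) hb ((Submodule.finrank_mono (hspan _ hUW hUs hU0)).trans
      (finrank_chainSpan_le T _ l (m + 1)))
  have hker : LinearMap.ker (shifted (X k) a) = (X k).eigenspace a :=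
    Submodule.ext fun v => (mem_eigenspace_iff_shifted (y := X k)).symm
  have hYW : V ⊓ tailSpace X a l k ≤ W ⊓ (X k).eigenspace a := fun v hv =>
    ⟨⟨(hVN hv.1).1, (tailSpace_succ hl).2 ⟨hv.2, eigenspace_le_maxGenEigenspace _ _ (hVN hv.1).2⟩⟩,
      (hVN hv.1).2⟩
  have hY := (Submodule.finrank_mono (hspan _ (hYW.trans inf_le_left)
    (H.stab_inf_tailSpace hk.le hV.2.1) hVt.1)).trans (finrank_chainSpan_le T _ l (m + 1))
  rw [hker] at hdim
  have hle := Nat.le_of_mul_le_mul_left (hdim.trans hY) (Nat.succ_pos m)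
  rw [← Submodule.eq_of_le_of_finrank_le hYW hle]
  exact inf_le_left

theorem exists_hasTail (h : N ⊓ (X k).maxGenEigenspace a ≠ ⊥) :
    ∃ l ≤ k, HasTail X a l (k + 1) N := by
  classical
  have hex : ∃ l, N ⊓ tailSpace X a l (k + 1) ≠ ⊥ := ⟨k, by
    convert h using 2
    ext v
    simp only [mem_tailSpace]
    refine ⟨fun hv => hv k le_rfl (by omega), fun hv j hj hj' => ?_⟩
    obtain rfl : j = k := by omega
    exact hv⟩
  have hk : Nat.find hex ≤ k := Nat.find_min' hex (by
    convert h using 2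
    ext v
    simp only [mem_tailSpace]
    refine ⟨fun hv => hv k le_rfl (by omega), fun hv j hj hj' => ?_⟩
    obtain rfl : j = k := by omega
    exact hv)
  refine ⟨Nat.find hex, hk, Nat.find_spec hex, fun hl v hv hvt hvl => ?_⟩
  by_contra hv0
  refine Nat.find_min hex (m := Nat.find hex - 1) (by omega)
    ((Submodule.ne_bot_iff _).2 ⟨v, ⟨hv, mem_tailSpace.2 fun j hj hj' => ?_⟩, hv0⟩)
  rcases eq_or_lt_of_le hj with rfl | h'
  · exact hvl
  · exact mem_tailSpace.1 hvt j (by omega) hj'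

/-- The socle of the eigenspace is irreducible. -/
theorem HeckeAction.socle_unique (H : HeckeAction q n T X) [FiniteDimensional R A]
    (ha : (q - 1) * a ≠ 0) (hk : k < n) (hN : MinStab n T X (k + 1) N) {V V' : Submodule R A}
    (hV : MinStab n T X k V) (hVN : V ≤ N ⊓ (X k).eigenspace a)
    (hV' : MinStab n T X k V') (hVN' : V' ≤ N ⊓ (X k).eigenspace a) : V = V' := by
  have h1 : V ≤ N ⊓ (X k).maxGenEigenspace a :=
    hVN.trans (inf_le_inf_left _ (eigenspace_le_maxGenEigenspace _ _))
  obtain ⟨l, hl, ht⟩ := exists_hasTail fun h => hV.1 (le_bot_iff.1 (h ▸ h1))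
  -- The nonzero tail of `V` consists of eigenvectors of `X k` in the tail of `N`, and these lie in
  -- every irreducible subspace of the eigenspace.
  have hK : V ⊓ tailSpace X a l k ≤ V' := fun v hv =>
    H.tail_inf_eigenspace_le ha hk hl hN ht hV' hVN' ⟨⟨(hVN hv.1).1, (tailSpace_succ hl).2
      ⟨hv.2, (h1 hv.1).2⟩⟩, (hVN hv.1).2⟩
  have hne : V ⊓ V' ≠ ⊥ := fun h => (H.hasTail_socle hk hl hN ht hV hVN).1
    (le_bot_iff.1 (h ▸ le_inf inf_le_left hK))
  exact hV'.2.2 V (hV.le_of_inf_ne_bot hV'.2.1 hne) hV.2.1 hV.1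

end Nilpotency

/-! ### From the tail to the whole generalized eigenspace -/

section TailProjection

open Module.End (maxGenEigenspace mem_maxGenEigenspace eigenspace mem_eigenspace_iff)

variable {R : Type*} [Field R] {A B : Type u} [AddCommGroup A] [Module R A]
  [AddCommGroup B] [Module R B]

theorem map_aeval_apply {y : Module.End R A} {z : Module.End R B} {f : A →ₗ[R] B}
    (h : ∀ v, f (y v) = z (f v)) (p : R[X]) (v : A) :
    f (Polynomial.aeval y p v) = Polynomial.aeval z p (f v) := by
  induction p using Polynomial.induction_on' generalizing v with
  | add p p' hp hp' => simp only [map_add, LinearMap.add_apply, hp, hp']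
  | monomial r c =>
    have : ∀ r v, f ((y ^ r) v) = (z ^ r) (f v) := fun r => by
      induction r with
      | zero => intro v; rfl
      | succ r ih => intro v; rw [pow_succ, pow_succ, Module.End.mul_apply, ih, h]; rfl
    simp [Polynomial.aeval_monomial, this, Module.algebraMap_end_apply]

/-- The product of the operators `p (X j)` for `l ≤ j < l + m`. -/
def tailProj (X : ℕ → Module.End R A) (p : R[X]) (l : ℕ) : ℕ → Module.End R A
  | 0 => 1
  | m + 1 => tailProj X p l m * Polynomial.aeval (X (l + m)) p

theorem map_tailProj {X : ℕ → Module.End R A} {Y : ℕ → Module.End R B} {f : A →ₗ[R] B}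
    (p : R[X]) (l m : ℕ) (h : ∀ j, l ≤ j → j < l + m → ∀ v, f (X j v) = Y j (f v)) (v : A) :
    f (tailProj X p l m v) = tailProj Y p l m (f v) := by
  induction m generalizing v with
  | zero => rfl
  | succ m ih =>
    rw [tailProj, tailProj, Module.End.mul_apply, Module.End.mul_apply,
      ih (fun j hj hj' => h j hj (by omega)),
      map_aeval_apply (h (l + m) (by omega) (by omega))]

theorem tailProj_mem {X : ℕ → Module.End R A} {U : Submodule R A} (p : R[X]) (l m : ℕ)
    (h : ∀ j, l ≤ j → j < l + m → ∀ v ∈ U, X j v ∈ U) {v : A} (hv : v ∈ U) :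
    tailProj X p l m v ∈ U := by
  induction m generalizing v with
  | zero => exact hv
  | succ m ih =>
    rw [tailProj, Module.End.mul_apply]
    exact ih (fun j hj hj' => h j hj (by omega))
      (aeval_mem_of_stable (h _ (by omega) (by omega)) p hv)

variable {q a : R} {n : ℕ} {T X : ℕ → Module.End R A} {l k m : ℕ} {N V : Submodule R A}

theorem IsProjector.tailProj_mem_tailSpace {p : R[X]} (hp : IsProjector X a n p)
    (hX : ∀ i j, i < n → j < n → ∀ v, X i (X j v) = X j (X i v)) (hm : l + m ≤ n) (v : A) :
    tailProj X p l m v ∈ tailSpace X a l (l + m) := by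
  refine mem_tailSpace.2 fun j hj hj' => ?_
  induction m generalizing v with
  | zero => omega
  | succ m ih =>
    rcases eq_or_lt_of_le (Nat.lt_succ_iff.1 hj') with rfl | h
    · exact tailProj_mem p l m (fun j hj hj' v hv => mem_maxGenEigenspace_of_commute
        (fun w => hX _ _ (by omega) (by omega) w) hv) ((hp _ (by omega)).1 v)
    · exact ih (by omega) _ h

theorem tailProj_eq_self {X : ℕ → Module.End R A} {p : R[X]} {v : A}
    (h : ∀ j, l ≤ j → j < l + m → Polynomial.aeval (X j) p v = v) : tailProj X p l m v = v := by
  induction m with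
  | zero => rfl
  | succ m ih =>
    rw [tailProj, Module.End.mul_apply, h _ (by omega) (by omega),
      ih fun j hj hj' => h j hj (by omega)]

theorem IsProjector.tailProj_of_mem {p : R[X]} (hp : IsProjector X a n p) (hm : l + m ≤ n) {v : A}
    (hv : v ∈ tailSpace X a l (l + m)) : tailProj X p l m v = v :=
  tailProj_eq_self fun j hj hj' => (hp j (by omega)).2 v (mem_tailSpace.1 hv j hj hj')

/-- The sum of the operators `X j - a`, `l ≤ j < k`. -/
def tailSum (X : ℕ → Module.End R A) (a : R) (l k : ℕ) : Module.End R A :=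
  ∑ j ∈ Finset.Ico l k, shifted (X j) a

theorem HeckeAction.X_tailSum (H : HeckeAction q n T X) (hk : k ≤ n) {i : ℕ} (hi : i < n) (v : A) :
    X i (tailSum X a l k v) = tailSum X a l k (X i v) := by
  simp only [tailSum, LinearMap.sum_apply, map_sum]
  refine Finset.sum_congr rfl fun j hj => ?_
  have := (Finset.mem_Ico.1 hj).2
  rw [shifted_apply, shifted_apply, map_sub, map_smul, H.X_comm i j hi (by omega)]

/-- The corrections from `X i` and `X (i + 1)` have opposite signs and cancel, and `i + 1 ≠ l`
excludes that only one of the two occurs in the sum. -/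
theorem HeckeAction.T_tailSum (H : HeckeAction q n T X) (hk : k ≤ n) {i : ℕ} (hi : i + 1 < k)
    (hil : i + 1 ≠ l) (v : A) : T i (tailSum X a l k v) = tailSum X a l k (T i v) := by
  simp only [tailSum, LinearMap.sum_apply, map_sum]
  rw [← sub_eq_zero, ← Finset.sum_sub_distrib]
  have h1 : ∀ j, T i (shifted (X j) a v) - shifted (X j) a (T i v) = T i (X j v) - X j (T i v) :=
    fun j => by rw [shifted_apply, shifted_apply, map_sub, map_smul]; abel
  simp only [h1]
  by_cases hl : i < l
  · refine Finset.sum_eq_zero fun j hj => ?_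
    have := Finset.mem_Ico.1 hj
    rw [H.T_X_comm i j (by omega) (by omega) (by omega) (by omega), sub_self]
  · have hsub : ({i, i + 1} : Finset ℕ) ⊆ Finset.Ico l k := by
      intro j hj
      simp only [Finset.mem_insert, Finset.mem_singleton] at hj
      rw [Finset.mem_Ico]
      omega
    rw [← Finset.sum_subset hsub, Finset.sum_pair (by omega), H.X_T i (by omega),
      H.X_succ_T i (by omega)]
    · abel
    · intro j hj hj'
      have := Finset.mem_Ico.1 hj
      simp only [Finset.mem_insert, Finset.mem_singleton, not_or] at hj'
      rw [H.T_X_comm i j (by omega) (by omega) (by omega) (by omega), sub_self]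

theorem HeckeAction.exists_common_eigenvector (H : HeckeAction q n T X) (hk : k ≤ n)
    {W : Submodule R A} (hW : ∀ j < n, ∀ v ∈ W, X j v ∈ W) (hWt : W ≤ tailSpace X a l k)
    (h0 : W ≠ ⊥) : ∃ w ∈ W, w ≠ 0 ∧ ∀ j, l ≤ j → j < k → X j w = a • w := by
  have key : ∀ s ⊆ Finset.Ico l k, ∃ w ∈ W, w ≠ 0 ∧ ∀ j ∈ s, X j w = a • w := by
    intro s
    induction s using Finset.induction_on with
    | empty =>
      intro _
      obtain ⟨w, hw, hw0⟩ := (Submodule.ne_bot_iff _).1 h0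
      exact ⟨w, hw, hw0, by simp⟩
    | insert j s hj ih =>
      intro hs
      obtain ⟨w, hw, hw0, hws⟩ := ih fun x hx => hs (Finset.mem_insert_of_mem hx)
      have hj' := Finset.mem_Ico.1 (hs (Finset.mem_insert_self j s))
      obtain ⟨w', hw', hwe, hw0', r, rfl⟩ := exists_mem_eigenspace (hW j (by omega)) hw
        (mem_tailSpace.1 (hWt hw) j hj'.1 hj'.2) hw0
      refine ⟨_, hw', hw0', fun i hi => ?_⟩
      rcases Finset.mem_insert.1 hi with rfl | hi
      · exact mem_eigenspace_iff.1 hwe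
      · have hi' := Finset.mem_Ico.1 (hs (Finset.mem_insert_of_mem hi))
        rw [shifted_pow_comm (fun v => H.X_comm i j (by omega) (by omega) v), hws i hi, map_smul]
  obtain ⟨w, hw, hw0, h⟩ := key _ le_rfl
  exact ⟨w, hw, hw0, fun j hj hj' => h j (Finset.mem_Ico.2 ⟨hj, hj'⟩)⟩

/-- The sum commutes with the parabolic subalgebra and kills a common eigenvector, so it kills the
irreducible tail. Thus the last `X j` is determined on the tail by the others. -/
theorem HeckeAction.tailSum_eq_zero (H : HeckeAction q n T X) [FiniteDimensional R A]
    (hk : k ≤ n) (hl : l ≤ k) (hN : MinStab n T X k N) (ht : HasTail X a l k N) {w : A}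
    (hw : w ∈ N ⊓ tailSpace X a l k) : tailSum X a l k w = 0 := by
  have hW := H.stab_inf_tailSpace (a := a) (l := l) hk hN.2.1
  obtain ⟨v, hv, hv0, hvX⟩ := H.exists_common_eigenvector hk hW.1 inf_le_right ht.1
  have hv1 : tailSum X a l k v = 0 := by
    rw [tailSum, LinearMap.sum_apply]
    refine Finset.sum_eq_zero fun j hj => ?_
    have := Finset.mem_Ico.1 hj
    rw [shifted_apply, hvX j this.1 this.2, sub_self]
  refine LinearMap.mem_ker.1 (H.tail_le hl hk hN ht
    (Y := N ⊓ tailSpace X a l k ⊓ LinearMap.ker (tailSum X a l k)) inf_le_left ⟨?_, ?_⟩ ?_ hw).2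
  · exact fun j hj u hu => ⟨hW.1 j hj u hu.1, LinearMap.mem_ker.2 (by
      rw [← H.X_tailSum hk hj, LinearMap.mem_ker.1 hu.2, map_zero])⟩
  · exact fun j hj hjl u hu => ⟨hW.2 j hj hjl u hu.1, LinearMap.mem_ker.2 (by
      rw [← H.T_tailSum hk hj hjl, LinearMap.mem_ker.1 hu.2, map_zero])⟩
  · exact (Submodule.ne_bot_iff _).2 ⟨v, ⟨hv, LinearMap.mem_ker.2 hv1⟩, hv0⟩

theorem HeckeAction.stab_map_shifted_pow (H : HeckeAction q n T X) (hk : k < n) (n' : ℕ)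
    (hn' : n' ≤ n) {B : Submodule R A} (hB : Stab n' T X 0 k B) (r : ℕ) :
    Stab n' T X 0 k (B.map (shifted (X k) a ^ r)) := by
  constructor
  · rintro j hj _ ⟨w, hw, rfl⟩
    exact ⟨X j w, hB.1 j hj w hw,
      (shifted_pow_comm (fun v => H.X_comm j k (by omega) hk v) a r w).symm⟩
  · rintro j hj hjl _ ⟨w, hw, rfl⟩
    exact ⟨T j w, hB.2 j hj hjl w hw, (shifted_pow_comm (fun v => H.T_X_comm j k
      (by omega) hk (by omega) (by omega) v) a r w).symm⟩

theorem HeckeAction.stab_maxGenEigenspace (H : HeckeAction q n T X) (hk : k < n) :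
    Stab n T X 0 k ((X k).maxGenEigenspace a) :=
  ⟨fun j hj _ hv => mem_maxGenEigenspace_of_commute (fun w => H.X_comm j k hj hk w) hv,
    fun j hj _ _ hv => mem_maxGenEigenspace_of_commute
      (fun w => H.T_X_comm j k (by omega) hk (by omega) (by omega) w) hv⟩

/-- The nilpotency index of `X k - a` on the generalized eigenspace. -/
theorem HeckeAction.pow_eq_zero (H : HeckeAction q n T X) [FiniteDimensional R A]
    (ha : (q - 1) * a ≠ 0) (hk : k < n) (hl : l + m = k) (hN : MinStab n T X (k + 1) N)
    (ht : HasTail X a l (k + 1) N) {v : A} (hv : v ∈ N) (hv' : v ∈ (X k).maxGenEigenspace a) :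
    (shifted (X k) a ^ (m + 1)) v = 0 := by
  subst hl
  obtain ⟨p, hp⟩ := exists_isProjector X a n
  by_contra hne
  have hE : Stab n T X 0 (l + m) (N ⊓ (X (l + m)).maxGenEigenspace a) :=
    (hN.2.1.mono (Nat.le_succ _) (Or.inl rfl)).inf (H.stab_maxGenEigenspace hk) (Or.inl rfl)
  have hB := H.stab_map_shifted_pow (a := a) hk n le_rfl hE (m + 1)
  have hBE : (N ⊓ (X (l + m)).maxGenEigenspace a).map (shifted (X (l + m)) a ^ (m + 1)) ≤
      N ⊓ (X (l + m)).maxGenEigenspace a := by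
    rintro _ ⟨w, hw, rfl⟩
    exact shifted_pow_mem (hE.1 _ hk) a _ hw
  have hB0 : (N ⊓ (X (l + m)).maxGenEigenspace a).map (shifted (X (l + m)) a ^ (m + 1)) ≠ ⊥ :=
    (Submodule.ne_bot_iff _).2 ⟨_, Submodule.mem_map_of_mem ⟨hv, hv'⟩, hne⟩
  -- A nonzero image of the power would contain an irreducible `V` of the eigenspace, hence a tail
  -- vector of the form `(X k - a) ^ (m + 1) e`.
  obtain ⟨V, hVB, hV⟩ := H.exists_minStab_le_eigenspace hk hB (a := a) (by
    rwa [inf_eq_left.2 (hBE.trans inf_le_right)])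
  have hVt := H.hasTail_socle hk (by omega) hN ht hV
    (hVB.trans (inf_le_inf_right _ (hBE.trans inf_le_left)))
  obtain ⟨_, ⟨hv1, hv2⟩, hv0⟩ := (Submodule.ne_bot_iff _).1 hVt.1
  obtain ⟨e, he, rfl⟩ := (hVB hv1).1
  -- The projection commutes with the last operator and fixes the tail vector, so `e` may be
  -- replaced by its projection. On the tail, however, the power is zero.
  have hPe : tailProj X p l m e ∈ N ⊓ (X (l + m)).maxGenEigenspace a :=
    tailProj_mem p l m (fun j _ hj => hE.1 j (by omega)) he
  have h1 := (H.tail_pow ha hk rfl hN ht).1 (tailProj X p l m e) ⟨hPe.1,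
    (tailSpace_succ (by omega)).2 ⟨hp.tailProj_mem_tailSpace H.X_comm hk.le e, hPe.2⟩⟩
  rw [map_tailProj (f := shifted (X (l + m)) a ^ (m + 1)) (Y := X) p l m
    (fun j _ hj v => (shifted_pow_comm (fun w => H.X_comm _ _ (by omega) hk w) a _ v).symm),
    hp.tailProj_of_mem hk.le hv2] at h1
  exact hv0 h1

/-- Every nonzero subspace of the generalized eigenspace which is stable in rank `k` contains the
socle of the eigenspace. -/
theorem HeckeAction.socle_le (H : HeckeAction q (k + 1) T X) [FiniteDimensional R A]
    (ha : (q - 1) * a ≠ 0) (hN : MinStab (k + 1) T X (k + 1) N)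
    (hV : MinStab (k + 1) T X k V) (hVN : V ≤ N ⊓ (X k).eigenspace a) {B : Submodule R A}
    (hB : Stab k T X 0 k B) (hBN : B ≤ N ⊓ (X k).maxGenEigenspace a) (hB0 : B ≠ ⊥) : V ≤ B := by
  classical
  have hk := Nat.lt_succ_self k
  -- Inside the eigenspace `X k` is a scalar, so stability in rank `k` includes stability under `X
  -- k` and uniqueness of the socle applies.
  have hscal : ∀ C : Submodule R A, Stab k T X 0 k C → C ≠ ⊥ →
      C ≤ N ⊓ (X k).eigenspace a → V ≤ C := by
    intro C hC hC0 hCN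
    have hC' : Stab (k + 1) T X 0 k C := by
      refine ⟨fun j hj v hv => ?_, hC.2⟩
      rcases eq_or_lt_of_le (Nat.lt_succ_iff.1 hj) with rfl | h
      · rw [mem_eigenspace_iff.1 (hCN hv).2]
        exact Submodule.smul_mem _ _ hv
      · exact hC.1 j h v hv
    obtain ⟨V', hVC, hV'⟩ := exists_minStab_le hC' hC0
    rwa [H.socle_unique ha hk hN hV hVN hV' (hVC.trans hCN)]
  obtain ⟨l, hl, ht⟩ := exists_hasTail (fun h => hB0 (le_bot_iff.1 (h ▸ hBN)))
  obtain ⟨m, hm⟩ := Nat.exists_eq_add_of_le hl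
  obtain ⟨p, hp⟩ := exists_isProjector X a (k + 1)
  have hN' : Stab (k + 1) T X 0 k N := hN.2.1.mono (Nat.le_succ k) (Or.inl rfl)
  have hE := hN'.inf (H.stab_maxGenEigenspace (a := a) hk) (Or.inl rfl)
  have hex : ∃ r, ∀ b ∈ B, (shifted (X k) a ^ r) b = 0 := ⟨m + 1, fun b hb =>
    H.pow_eq_zero ha hk hm.symm hN ht (hBN hb).1 (hBN hb).2⟩
  obtain ⟨r, hr⟩ : ∃ r, Nat.find hex = r + 1 := Nat.exists_eq_succ_of_ne_zero fun h =>
    hB0 ((Submodule.eq_bot_iff _).2 fun b hb => by simpa [h] using Nat.find_spec hex b hb)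
  have hspec := Nat.find_spec hex
  have hmin := Nat.find_min hex (m := r) (by omega)
  rw [hr] at hspec
  push Not at hmin
  obtain ⟨b₀, hb₀, hb₀'⟩ := hmin
  have hVB : V ≤ B.map (shifted (X k) a ^ r) := by
    refine hscal _ (H.stab_map_shifted_pow hk k (by omega) hB r)
      ((Submodule.ne_bot_iff _).2 ⟨_, Submodule.mem_map_of_mem hb₀, hb₀'⟩) ?_
    rintro _ ⟨b, hb, rfl⟩
    refine ⟨(shifted_pow_mem (hE.1 k hk) a r (hBN hb)).1, mem_eigenspace_iff_shifted.2 ?_⟩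
    rw [← Module.End.mul_apply, ← pow_succ', hspec b hb]
  obtain ⟨_, ⟨hv1, hv2⟩, hv0⟩ := (Submodule.ne_bot_iff _).1 (H.hasTail_socle hk hl hN ht hV hVN).1
  obtain ⟨b, hb, rfl⟩ := hVB hv1
  subst hm
  -- The projection uses `X j` for `j < k` only and so stays in `B`. It is nonzero because its image
  -- under the highest power is a nonzero tail vector of `V`.
  have hw : tailProj X p l m b ∈ B := tailProj_mem p l m (fun j _ hj => hB.1 j hj) hb
  have hwt := hp.tailProj_mem_tailSpace H.X_comm (l := l) (m := m) hk.le b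
  have hw0 : tailProj X p l m b ≠ 0 := fun h => hv0 (by
    rw [← hp.tailProj_of_mem hk.le hv2, ← map_tailProj (f := shifted (X (l + m)) a ^ r) p l m
      (fun j _ hj v => (shifted_pow_comm (fun w => H.X_comm _ _ (by omega) hk w) a _ v).symm), h,
      map_zero])
  -- `B` need not be stable under the last operator. On its tail part that operator equals `a` minus
  -- the sum of the other `X j - a`, and these do preserve `B`.
  have hstab : ∀ v ∈ B ⊓ tailSpace X a l (l + m), X (l + m) v ∈ B ⊓ tailSpace X a l (l + m) := by
    intro v hv
    have hS : Stab (l + m) T X l (l + m) (B ⊓ tailSpace X a l (l + m)) := by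
      refine ⟨fun j hj u hu => ⟨hB.1 j hj u hu.1, ?_⟩, fun j hj hjl u hu =>
        ⟨hB.2 j hj (by omega) u hu.1, (H.stab_tailSpace hk.le).2 j hj hjl u hu.2⟩⟩
      exact (H.stab_tailSpace (l := l) hk.le).1 j (by omega) u hu.2
    have h1 := H.tailSum_eq_zero le_rfl (by omega) hN ht (w := v)
      ⟨(hBN hv.1).1, (tailSpace_succ hl).2 ⟨hv.2, (hBN hv.1).2⟩⟩
    rw [tailSum, Finset.sum_Ico_succ_top hl, LinearMap.add_apply, shifted_apply,
      LinearMap.sum_apply, add_sub, sub_eq_zero] at h1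
    rw [eq_sub_of_add_eq' h1]
    refine sub_mem (Submodule.smul_mem _ _ hv) (sum_mem fun j hj => ?_)
    exact sub_mem (hS.1 j (Finset.mem_Ico.1 hj).2 v hv) (Submodule.smul_mem _ _ hv)
  obtain ⟨w', hw', hwe, hw0', -⟩ := exists_mem_eigenspace hstab ⟨hw, hwt⟩ (hBN hw).2 hw0
  have hBe : Stab (l + m) T X 0 (l + m) (B ⊓ (X (l + m)).eigenspace a) := by
    have := H.stab_eigenspace (a := a) hk
    exact hB.inf ⟨fun j hj => this.1 j (by omega), this.2⟩ (Or.inl rfl)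
  exact (hscal _ hBe ((Submodule.ne_bot_iff _).2 ⟨w', ⟨hw'.1, hwe⟩, hw0'⟩)
    (inf_le_inf_right _ (hBN.trans inf_le_left))).trans inf_le_left

/-! ### Splitting of the eigenvalues -/

theorem exists_aeval_sub_eq_mul {y z : Module.End R A} (h : Commute y z) (f : R[X]) :
    (∃ w, Polynomial.aeval y f - Polynomial.aeval z f = (y - z) * w) ∧
      ∃ w, Polynomial.aeval y f - Polynomial.aeval z f = w * (y - z) := by
  induction f using Polynomial.induction_on' with
  | add f g hf hg =>
    obtain ⟨⟨w1, h1⟩, w2, h2⟩ := hf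
    obtain ⟨⟨w3, h3⟩, w4, h4⟩ := hg
    refine ⟨⟨w1 + w3, ?_⟩, w2 + w4, ?_⟩
    · rw [map_add, map_add, add_sub_add_comm, h1, h3, mul_add]
    · rw [map_add, map_add, add_sub_add_comm, h2, h4, add_mul]
  | monomial r c =>
    rw [Polynomial.aeval_monomial, Polynomial.aeval_monomial, ← mul_sub, ← Algebra.smul_def]
    refine ⟨⟨c • ∑ i ∈ Finset.range r, y ^ i * z ^ (r - 1 - i), ?_⟩,
      c • ∑ i ∈ Finset.range r, y ^ i * z ^ (r - 1 - i), ?_⟩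
    · rw [← h.mul_geom_sum₂, mul_smul_comm]
    · rw [← h.geom_sum₂_mul, smul_mul_assoc]

/-- The square of the intertwining operator. -/
theorem HeckeAction.intertwiner_sq (H : HeckeAction q n T X) {i : ℕ} (hi : i + 1 < n) (v : A) :
    (T i * (X i - X (i + 1)) + (q - 1) • X (i + 1))
      ((T i * (X i - X (i + 1)) + (q - 1) • X (i + 1)) v) =
    (q • X i - X (i + 1)) ((q • X (i + 1) - X i) v) := by
  simp only [LinearMap.add_apply, Module.End.mul_apply, LinearMap.sub_apply, LinearMap.smul_apply,
    map_add, map_sub, map_smul, H.X_succ_T i hi, H.X_T i hi, H.T_T i hi,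
    H.X_comm (i + 1) i hi (by omega)]
  module

theorem HeckeAction.X_succ_intertwiner (H : HeckeAction q n T X) {i : ℕ} (hi : i + 1 < n) (v : A) :
    (T i * (X i - X (i + 1)) + (q - 1) • X (i + 1)) (X i v) =
    X (i + 1) ((T i * (X i - X (i + 1)) + (q - 1) • X (i + 1)) v) := by
  simp only [LinearMap.add_apply, Module.End.mul_apply, LinearMap.sub_apply, LinearMap.smul_apply,
    map_add, map_sub, map_smul, H.X_succ_T i hi, H.X_comm (i + 1) i hi (by omega)]
  module

/-- If `X i` is annihilated by a split polynomial, then so is `X (i + 1)`. -/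
theorem HeckeAction.exists_splits_succ (H : HeckeAction q n T X) (hq : q ≠ 0) {i : ℕ}
    (hi : i + 1 < n) {f : R[X]} (hf0 : f ≠ 0) (hfs : f.Splits)
    (hf : Polynomial.aeval (X i) f = 0) :
    ∃ g : R[X], g ≠ 0 ∧ g.Splits ∧ Polynomial.aeval (X (i + 1)) g = 0 := by
  have hdeg : ∀ c : R, c ≠ 0 → (Polynomial.C c * Polynomial.X).natDegree = 1 := fun c hc => by
    rw [Polynomial.natDegree_C_mul_X c hc]
  have hne : ∀ c : R, c ≠ 0 → f.comp (Polynomial.C c * Polynomial.X) ≠ 0 := fun c hc h => by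
    rcases Polynomial.comp_eq_zero_iff.1 h with h | ⟨_, h⟩
    · exact hf0 h
    · have := hdeg c hc
      rw [h, Polynomial.natDegree_C] at this
      omega
  have hsp : ∀ c : R, c ≠ 0 → (f.comp (Polynomial.C c * Polynomial.X)).Splits := fun c hc =>
    hfs.comp_of_natDegree_le_one (hdeg c hc).le
  have haev : ∀ c : R, Polynomial.aeval (X (i + 1)) (f.comp (Polynomial.C c * Polynomial.X)) =
      Polynomial.aeval (c • X (i + 1)) f := fun c => by
    rw [Polynomial.aeval_comp, map_mul, Polynomial.aeval_C, Polynomial.aeval_X, Algebra.smul_def]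
  have hq' : q⁻¹ ≠ 0 := inv_ne_zero hq
  -- Take f(qx) f(x) f(x/q). Since f(X_i) = 0, the outer factors at X_{i+1} are divisible by
  -- qX_{i+1} - X_i and by X_{i+1}/q - X_i, whose product is a scalar times the square of the
  -- intertwiner. Moving one intertwiner across f(X_{i+1}) turns it into f(X_i) = 0.
  refine ⟨f.comp (Polynomial.C q * Polynomial.X) * f * f.comp (Polynomial.C q⁻¹ * Polynomial.X),
    mul_ne_zero (mul_ne_zero (hne q hq) hf0) (hne _ hq'),
    ((hsp q hq).mul hfs).mul (hsp _ hq'), ?_⟩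
  have hcomm : Commute (X (i + 1)) (X i) :=
    LinearMap.ext fun v => H.X_comm (i + 1) i hi (by omega) v
  obtain ⟨-, w, hw⟩ := exists_aeval_sub_eq_mul (hcomm.smul_left q) f
  obtain ⟨⟨w', hw'⟩, -⟩ := exists_aeval_sub_eq_mul (hcomm.smul_left q⁻¹) f
  rw [hf, sub_zero] at hw hw'
  rw [map_mul, map_mul, haev, haev, hw, hw']
  ext v
  simp only [Module.End.mul_apply, LinearMap.zero_apply]
  have h1 : (q⁻¹ • X (i + 1) - X i) (w' v) = -q⁻¹ • (q • X i - X (i + 1)) (w' v) := by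
    simp only [LinearMap.sub_apply, LinearMap.smul_apply, smul_sub, smul_smul, neg_mul,
      inv_mul_cancel₀ hq, neg_smul, one_smul]
    abel
  have hc : ∀ u, (q • X (i + 1) - X i) (X (i + 1) u) = X (i + 1) ((q • X (i + 1) - X i) u) :=
    fun u => by
      simp only [LinearMap.sub_apply, LinearMap.smul_apply, map_sub, map_smul,
        H.X_comm i (i + 1) (by omega) hi]
  have hc' : ∀ u, (q • X (i + 1) - X i) ((q • X i - X (i + 1)) u) =
      (q • X i - X (i + 1)) ((q • X (i + 1) - X i) u) := fun u => by
    simp only [LinearMap.sub_apply, LinearMap.smul_apply, map_sub, map_smul,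
      H.X_comm i (i + 1) (by omega) hi]
    module
  rw [h1, map_smul, map_smul, aeval_comm_apply hc, hc', ← H.intertwiner_sq hi,
    ← map_aeval_apply (H.X_succ_intertwiner hi), hf]
  simp

theorem HeckeAction.exists_splits (H : HeckeAction q n T X) (hq : q ≠ 0)
    {f : R[X]} (hf0 : f ≠ 0) (hfs : f.Splits)
    (hf : Polynomial.aeval (X 0) f = 0) {i : ℕ} (hi : i < n) :
    ∃ g : R[X], g ≠ 0 ∧ g.Splits ∧ Polynomial.aeval (X i) g = 0 := by
  induction i with
  | zero => exact ⟨f, hf0, hfs, hf⟩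
  | succ i ih =>
    obtain ⟨g, hg0, hgs, hg⟩ := ih (by omega)
    exact H.exists_splits_succ hq hi hg0 hgs hg

theorem exists_eigenvector_of_splits [FiniteDimensional R A] [Nontrivial A] {y : Module.End R A}
    {g : R[X]} (hg0 : g ≠ 0) (hgs : g.Splits) (hg : Polynomial.aeval y g = 0) :
    ∃ b : R, ∃ v : A, v ≠ 0 ∧ y v = b • v := by
  have hs : (minpoly R y).Splits := hgs.of_dvd hg0 (minpoly.dvd R y hg)
  obtain ⟨b, hb⟩ := hs.exists_eval_eq_zero
    (minpoly.degree_pos (Algebra.IsIntegral.isIntegral y)).ne'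
  obtain ⟨v, hv⟩ := (Module.End.hasEigenvalue_of_isRoot (f := y) hb).exists_hasEigenvector
  exact ⟨b, v, hv.2, hv.apply_eq_smul⟩

end TailProjection

/-! ### The operators of a module over the Hecke algebra -/

section Modules

open Module.End (maxGenEigenspace mem_maxGenEigenspace eigenspace mem_eigenspace_iff)

variable {R : Type u} [Field R] {q : Rˣ} {L : Level q} {n : ℕ}

/-- The action of `T_{j+1}`, extended by `0` to all `j`. -/
def opT (L : Level q) (n : ℕ) (M : Type u) [AddCommGroup M] [Module R M] [Module (Hecke L n) M]
    [IsScalarTower R (Hecke L n) M] (j : ℕ) : Module.End R M :=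
  if h : j + 1 < n then Algebra.lsmul R R M (mk L n (fT R j h)) else 0

/-- The action of `X_{j+1}`, extended by `0` to all `j`. -/
def opX (L : Level q) (n : ℕ) (M : Type u) [AddCommGroup M] [Module R M] [Module (Hecke L n) M]
    [IsScalarTower R (Hecke L n) M] (j : ℕ) : Module.End R M :=
  if h : j < n then Algebra.lsmul R R M (X L j h) else 0

theorem mk_fXinv_smul_X {M : Type u} [AddCommGroup M] [Module (Hecke L n) M] {j : ℕ}
    (hj : j < n) (v : M) :
    mk L n (fXinv R j hj) • X L j hj • v = v := by
  have h := mk_rel (Rel.invMul (L := L) j hj)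
  rw [map_mul, map_one] at h
  rw [smul_smul, X, h, one_smul]

variable {M : Type u} [AddCommGroup M] [Module R M] [Module (Hecke L n) M]
    [IsScalarTower R (Hecke L n) M]

theorem opT_apply {j : ℕ} (h : j + 1 < n) (v : M) : opT L n M j v = mk L n (fT R j h) • v := by
  rw [opT, dif_pos h, Algebra.lsmul_coe]

theorem opX_apply {j : ℕ} (h : j < n) (v : M) : opX L n M j v = X L j h • v := by
  rw [opX, dif_pos h, Algebra.lsmul_coe]

theorem mk_T_mul_T {i : ℕ} (hi : i + 1 < n) :
    mk L n (fT R i hi) * mk L n (fT R i hi) =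
      ((q : R) - 1) • mk L n (fT R i hi) + (q : R) • 1 := by
  have h := mk_rel (Rel.quad (L := L) i hi)
  simp only [map_mul, map_add, map_sub, map_one, map_zero, AlgHom.commutes] at h
  rw [Algebra.algebraMap_eq_smul_one] at h
  rw [← sub_eq_zero, ← h, mul_sub, add_mul, one_mul, mul_smul_comm, mul_one, sub_smul, one_smul,
    smul_add]
  abel

theorem mk_TXT {i : ℕ} (hi : i + 1 < n) :
    mk L n (fT R i hi) * X L i (Nat.lt_of_succ_lt hi) * mk L n (fT R i hi) =
      (q : R) • X L (i + 1) hi := by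
  have h := mk_rel (Rel.TXT (L := L) i hi (Nat.lt_of_succ_lt hi))
  simp only [map_mul, AlgHom.commutes] at h
  rw [Algebra.smul_def]
  exact h

/-- Multiply T_i X_i T_i = q X_{i+1} by T_i on the right, expand T_i² and cancel q. Multiplication
on the left gives the companion rule. -/
theorem mk_X_succ_mul_T {i : ℕ} (hi : i + 1 < n) :
    X L (i + 1) hi * mk L n (fT R i hi) =
      mk L n (fT R i hi) * X L i (Nat.lt_of_succ_lt hi) + ((q : R) - 1) • X L (i + 1) hi := by
  have h1 := mk_TXT (L := L) hi
  have h2 := mk_T_mul_T (L := L) hi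
  have hq : (q : R) ≠ 0 := q.ne_zero
  refine smul_right_injective _ hq ?_
  change (q : R) • (X L (i + 1) hi * mk L n (fT R i hi)) = (q : R) • (_ + _)
  rw [← smul_mul_assoc, ← h1, mul_assoc, h2, mul_add, mul_smul_comm, mul_smul_comm, mul_one, h1,
    smul_add, add_comm, smul_smul, smul_smul, mul_comm]

theorem mk_X_mul_T {i : ℕ} (hi : i + 1 < n) :
    X L i (Nat.lt_of_succ_lt hi) * mk L n (fT R i hi) =
      mk L n (fT R i hi) * X L (i + 1) hi - ((q : R) - 1) • X L (i + 1) hi := by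
  have h1 := mk_TXT (L := L) hi
  have h2 := mk_T_mul_T (L := L) hi
  have hq : (q : R) ≠ 0 := q.ne_zero
  refine smul_right_injective _ hq ?_
  change (q : R) • _ = (q : R) • (_ - _)
  rw [smul_sub, ← mul_smul_comm (q : R) (mk L n (fT R i hi)) (X L (i + 1) hi), ← h1, mul_assoc,
    ← mul_assoc (mk L n (fT R i hi)), h2, add_mul,
    smul_mul_assoc, smul_mul_assoc, one_mul, ← mul_assoc, h1, smul_smul, smul_smul, mul_comm,
    add_sub_cancel_left]

variable (L n M) in
theorem heckeAction : HeckeAction (q : R) n (opT L n M) (opX L n M) where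
  T_T i hi v := by
    rw [opT_apply hi, opT_apply hi, smul_smul, mk_T_mul_T, add_smul, smul_assoc, smul_assoc,
      one_smul]
  braid i hi v := by
    have h := mk_rel (Rel.braid (L := L) i (Nat.lt_of_succ_lt hi) hi)
    simp only [map_mul] at h
    simp only [opT_apply (Nat.lt_of_succ_lt hi), opT_apply (j := i + 1) hi, smul_smul, ← mul_assoc,
      h]
  T_comm i j hij hj v := by
    have h := mk_rel (Rel.comm (L := L) i j (by omega) hj hij)
    simp only [map_mul] at h
    rw [opT_apply hj, opT_apply (j := i) (by omega), opT_apply (j := i) (by omega), opT_apply hj,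
      smul_smul, smul_smul, h]
  X_comm i j hi hj v := by
    have h := mk_rel (Rel.commX (L := L) i j hi hj)
    simp only [map_mul] at h
    rw [opX_apply hj, opX_apply hi, opX_apply hi, opX_apply hj, smul_smul, smul_smul, X, X, h]
  T_X_comm i j hi hj h1 h2 v := by
    have h := mk_rel (Rel.commTX (L := L) i j hi hj h1 h2)
    simp only [map_mul] at h
    rw [opX_apply hj, opT_apply hi, opT_apply hi, opX_apply hj, smul_smul, smul_smul, X, h]
  X_succ_T i hi v := by
    rw [opT_apply hi, opX_apply hi, opX_apply (Nat.lt_of_succ_lt hi), opT_apply hi, opX_apply hi,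
      smul_smul, mk_X_succ_mul_T, add_smul, smul_smul, smul_assoc]
  X_T i hi v := by
    rw [opT_apply hi, opX_apply hi, opX_apply (Nat.lt_of_succ_lt hi), opT_apply hi,
      smul_smul, mk_X_mul_T, sub_smul, smul_smul, smul_assoc]

/-- On finite dimensional modules, stability under the `T j` and `X j` suffices. -/
theorem smul_mem_of_stab [FiniteDimensional R M] {U : Submodule R M}
    (hU : Stab n (opT L n M) (opX L n M) 0 n U) (h : Hecke L n) {v : M} (hv : v ∈ U) :
    h • v ∈ U := by
  obtain ⟨x, rfl⟩ := mk_surjective L n h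
  induction x using FreeAlgebra.induction generalizing v with
  | grade0 r =>
    rw [AlgHom.commutes, algebraMap_smul]
    exact U.smul_mem r hv
  | grade1 g =>
    cases g with
    | T i hi =>
      have := hU.2 i hi (by omega) v hv
      rwa [opT_apply hi] at this
    | X j hj =>
      have := hU.1 j hj v hv
      rwa [opX_apply hj] at this
    | Xinv j hj =>
      have hmaps : ∀ v ∈ U, opX L n M j v ∈ U := hU.1 j hj
      -- Stability under the inverse comes from finite dimension: `X j` is injective on `U`, hence
      -- maps `U` onto itself.
      have hinj : Function.Injective ((opX L n M j).restrict hmaps) := by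
        intro v w hvw
        have h1 := congrArg Subtype.val hvw
        simp only [LinearMap.coe_restrict_apply, opX_apply hj] at h1
        rw [Subtype.ext_iff, ← mk_fXinv_smul_X (L := L) hj (v : M), h1,
          mk_fXinv_smul_X (L := L) hj]
      obtain ⟨w, hw⟩ := LinearMap.injective_iff_surjective.1 hinj ⟨v, hv⟩
      have h1 : X L j hj • (w : M) = v := by
        have := congrArg Subtype.val hw
        simpa only [LinearMap.coe_restrict_apply, opX_apply hj] using this
      have h2 := mk_fXinv_smul_X (L := L) hj (w : M)
      rw [h1] at h2
      change mk L n (fXinv R j hj) • v ∈ U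
      rw [h2]
      exact w.2
  | mul a b ha hb =>
    rw [map_mul, mul_smul]
    exact ha (hb hv)
  | add a b ha hb =>
    rw [map_add, add_smul]
    exact add_mem (ha hv) (hb hv)

theorem stab_restrictScalars (S : Submodule (Hecke L n) M) :
    Stab n (opT L n M) (opX L n M) 0 n (S.restrictScalars R) :=
  ⟨fun j hj v hv => by rw [opX_apply hj]; exact S.smul_mem _ hv,
    fun j hj _ v hv => by rw [opT_apply hj]; exact S.smul_mem _ hv⟩

theorem minStab_top [FiniteDimensional R M] [IsSimpleModule (Hecke L n) M] :
    MinStab n (opT L n M) (opX L n M) n ⊤ := by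
  have : Nontrivial M := IsSimpleModule.nontrivial (Hecke L n) M
  refine ⟨top_ne_bot, ⟨fun _ _ _ _ => trivial, fun _ _ _ _ _ => trivial⟩, fun U _ hU hU0 => ?_⟩
  let S : Submodule (Hecke L n) M :=
    { U with smul_mem' := fun h v hv => smul_mem_of_stab hU h hv }
  have hS : ∀ v, v ∈ S ↔ v ∈ U := fun _ => Iff.rfl
  rcases eq_bot_or_eq_top S with h | h
  · exact (hU0 ((Submodule.eq_bot_iff _).2 fun v hv => by
      have := (hS v).2 hv
      rwa [h] at this)).elim
  · exact (Submodule.eq_top_iff'.2 fun v => (hS v).1 (h ▸ trivial))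

variable {M' : Type u} [AddCommGroup M'] [Module R M'] [Module (Hecke L n) M']
    [IsScalarTower R (Hecke L n) M']

theorem map_opX (f : M →ₗ[Hecke L n] M') (j : ℕ) (v : M) :
    f.restrictScalars R (opX L n M j v) = opX L n M' j (f.restrictScalars R v) := by
  by_cases h : j < n
  · rw [opX_apply h, opX_apply h]
    exact map_smul f _ v
  · rw [opX, opX, dif_neg h, dif_neg h]
    exact map_zero f

end Modules

/-! ### Restriction -/

section Restriction

open Module.End (maxGenEigenspace mem_maxGenEigenspace eigenspace mem_eigenspace_iff)

variable {R : Type u} [Field R] {q : Rˣ} {L : Level q} {k : ℕ}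

/-- The identity map from the restriction, as a linear map. -/
def resEquiv (M : ModuleCat.{u} (Hecke L (k + 1))) : res M ≃ₗ[R] M where
  toFun x := (show M from x)
  invFun x := (show res M from x)
  map_add' _ _ := rfl
  map_smul' r x := by
    have h1 : r • x = (algebraMap R (Hecke L k) r) • x := (algebraMap_smul _ r x).symm
    rw [h1, res_smul, AlgHom.commutes]
    exact algebraMap_smul (M := M) (Hecke L (k + 1)) r (show M from x)
  left_inv _ := rfl
  right_inv _ := rfl

theorem resEquiv_smul {M : ModuleCat.{u} (Hecke L (k + 1))} (h : Hecke L k) (x : res M) :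
    resEquiv M (h • x) = incl L k h • resEquiv M x := rfl

variable {M : ModuleCat.{u} (Hecke L (k + 1))}

theorem resEquiv_opX {j : ℕ} (hj : j < k) (x : res M) :
    resEquiv M (opX L k (res M) j x) = opX L (k + 1) M j (resEquiv M x) := by
  rw [opX_apply hj, opX_apply (Nat.lt_succ_of_lt hj), resEquiv_smul, incl_X]

theorem resEquiv_opT {j : ℕ} (hj : j + 1 < k) (x : res M) :
    resEquiv M (opT L k (res M) j x) = opT L (k + 1) M j (resEquiv M x) := by
  rw [opT_apply hj, opT_apply (Nat.lt_succ_of_lt hj), resEquiv_smul, incl_mk, preIncl_fT]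

/-- A subspace of the restriction, as a subspace of the representation. -/
def ofRes (S : Submodule (Hecke L k) (res M)) : Submodule R M :=
  (S.restrictScalars R).map (resEquiv M).toLinearMap

theorem resEquiv_mem_ofRes {S : Submodule (Hecke L k) (res M)} {x : res M} :
    resEquiv M x ∈ ofRes S ↔ x ∈ S :=
  ⟨fun ⟨_, hy, h⟩ => (resEquiv M).injective h ▸ hy, fun h => ⟨x, h, rfl⟩⟩

theorem mem_ofRes {S : Submodule (Hecke L k) (res M)} {x : M} :
    x ∈ ofRes S ↔ (resEquiv M).symm x ∈ S := resEquiv_mem_ofRes (x := (resEquiv M).symm x)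

theorem ofRes_le_ofRes {S S' : Submodule (Hecke L k) (res M)} : ofRes S ≤ ofRes S' ↔ S ≤ S' :=
  ⟨fun h _ hx => resEquiv_mem_ofRes.1 (h (resEquiv_mem_ofRes.2 hx)),
    fun h _ hx => mem_ofRes.2 (h (mem_ofRes.1 hx))⟩

theorem ofRes_injective : Function.Injective (ofRes (M := M)) := fun _ _ h =>
  le_antisymm (ofRes_le_ofRes.1 h.le) (ofRes_le_ofRes.1 h.ge)

theorem ofRes_eq_bot {S : Submodule (Hecke L k) (res M)} : ofRes S = ⊥ ↔ S = ⊥ := by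
  rw [← ofRes_injective.eq_iff]
  have : ofRes (⊥ : Submodule (Hecke L k) (res M)) = ⊥ := (Submodule.eq_bot_iff _).2 fun x hx =>
    (resEquiv M).symm.injective (((Submodule.mem_bot _).1 (mem_ofRes.1 hx)).trans
      (map_zero (resEquiv M).symm).symm)
  rw [this]

theorem stab_ofRes (S : Submodule (Hecke L k) (res M)) :
    Stab k (opT L (k + 1) M) (opX L (k + 1) M) 0 k (ofRes S) := by
  have h := stab_restrictScalars (R := R) S
  constructor
  · rintro j hj _ ⟨x, hx, rfl⟩
    exact ⟨_, h.1 j hj x hx, resEquiv_opX hj x⟩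
  · rintro j hj hjl _ ⟨x, hx, rfl⟩
    exact ⟨_, h.2 j hj hjl x hx, resEquiv_opT hj x⟩

theorem exists_ofRes_eq [FiniteDimensional R M] {U : Submodule R M}
    (hU : Stab k (opT L (k + 1) M) (opX L (k + 1) M) 0 k U) :
    ∃ S : Submodule (Hecke L k) (res M), ofRes S = U := by
  have : FiniteDimensional R (res M) := (resEquiv M).symm.finiteDimensional
  have hU' : Stab k (opT L k (res M)) (opX L k (res M)) 0 k
      (U.comap (resEquiv M).toLinearMap) := by
    refine ⟨fun j hj v hv => ?_, fun j hj hjl v hv => ?_⟩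
    · change resEquiv M (opX L k (res M) j v) ∈ U
      rw [resEquiv_opX hj]
      exact hU.1 j hj _ hv
    · change resEquiv M (opT L k (res M) j v) ∈ U
      rw [resEquiv_opT hj]
      exact hU.2 j hj hjl _ hv
  exact ⟨{ U.comap (resEquiv M).toLinearMap with
    smul_mem' := fun h v hv => smul_mem_of_stab hU' h hv }, Submodule.ext fun x => mem_ofRes⟩

theorem shifted_opX_pow (a : R) (r : ℕ) (x : M) :
    (shifted (opX L (k + 1) M k) a ^ r) x =
      (X L k (Nat.lt_succ_self k) - algebraMap R _ a) ^ r • x := by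
  induction r with
  | zero => rw [pow_zero, pow_zero, one_smul]; rfl
  | succ r ih =>
    rw [pow_succ', pow_succ', Module.End.mul_apply, ih, mul_smul, shifted_apply,
      opX_apply (Nat.lt_succ_self k), sub_smul, algebraMap_smul]

theorem ofRes_genEigen (a : R) : ofRes (genEigen a M) = (opX L (k + 1) M k).maxGenEigenspace a := by
  ext x
  rw [mem_ofRes, mem_maxGenEigenspace]
  exact exists_congr fun r => by rw [shifted_opX_pow]; rfl

theorem ofRes_eigen (a : R) : ofRes (eigen a M) = (opX L (k + 1) M k).eigenspace a := by
  ext x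
  rw [mem_ofRes, mem_eigenspace_iff_shifted, ← pow_one (shifted _ a), shifted_opX_pow, pow_one]
  rfl

/-- On the eigenspace `X k` acts by `a`, so submodules over the rank-`k` algebra are automatically
stable under all `k + 1` operators `X j`. -/
theorem minStab_ofRes [FiniteDimensional R M] {a : R} {S : Submodule (Hecke L k) (res M)}
    (hS : IsSimpleModule (Hecke L k) S) (hSe : S ≤ eigen a M) :
    MinStab (k + 1) (opT L (k + 1) M) (opX L (k + 1) M) k (ofRes S) := by
  have hA := isSimpleModule_iff_isAtom.1 hS
  have hSt := stab_ofRes S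
  refine ⟨fun h => hA.1 (ofRes_eq_bot.1 h), ⟨fun j hj v hv => ?_, hSt.2⟩, fun U hU hUs hU0 => ?_⟩
  · rcases eq_or_lt_of_le (Nat.lt_succ_iff.1 hj) with rfl | h
    · have := ofRes_le_ofRes.2 hSe hv
      rw [ofRes_eigen, mem_eigenspace_iff] at this
      rw [this]
      exact Submodule.smul_mem _ _ hv
    · exact hSt.1 j h v hv
  · obtain ⟨S', rfl⟩ := exists_ofRes_eq (U := U) ⟨fun j hj => hUs.1 j (by omega), hUs.2⟩
    rcases hA.le_iff.1 (ofRes_le_ofRes.1 hU) with h | h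
    · exact (hU0 (ofRes_eq_bot.2 h)).elim
    · rw [h]

theorem isSimpleModule_of_minStab [FiniteDimensional R M] {a : R}
    {S : Submodule (Hecke L k) (res M)} (hSe : S ≤ eigen a M)
    (h : MinStab (k + 1) (opT L (k + 1) M) (opX L (k + 1) M) k (ofRes S)) :
    IsSimpleModule (Hecke L k) S := by
  refine isSimpleModule_iff_isAtom.2 ⟨fun h0 => h.1 (ofRes_eq_bot.2 h0), fun S' hS' => ?_⟩
  by_contra h0
  have hSt := stab_ofRes S'
  refine hS'.ne (ofRes_injective (h.2.2 _ (ofRes_le_ofRes.2 hS'.le)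
    ⟨fun j hj v hv => ?_, hSt.2⟩ fun h1 => h0 (ofRes_eq_bot.1 h1)))
  rcases eq_or_lt_of_le (Nat.lt_succ_iff.1 hj) with rfl | h
  · have := ofRes_le_ofRes.2 (hS'.le.trans hSe) hv
    rw [ofRes_eigen, mem_eigenspace_iff] at this
    rw [this]
    exact Submodule.smul_mem _ _ hv
  · exact hSt.1 j h v hv

end Restriction

/-! ### Classes in the Grothendieck group -/

section Grothendieck

variable {R : Type u} [Field R] {q : Rˣ} {L : Level q} {k : ℕ}

/-- Apart from finite dimension, being a representation depends on the annihilator only, which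
treats submodules and quotients at once. -/
theorem IsRep.of_linearMap {P P' : ModuleCat.{u} (Hecke L k)} (hP : IsRep L k P)
    (hfd : FiniteDimensional R P')
    (h : ∀ x : Hecke L k, (∀ v : P, x • v = 0) → ∀ v : P', x • v = 0) : IsRep L k P' := by
  cases L with
  | cyc lam => exact hfd
  | aff =>
    refine ⟨hfd, fun hn => ?_⟩
    obtain ⟨lam, hlam⟩ := hP.2 hn
    exact ⟨lam, h _ hlam⟩

/-- A subrepresentation. -/
def subRep (P : Rep L k) (S : Submodule (Hecke L k) P.obj) : Rep L k :=
  ⟨ModuleCat.of (Hecke L k) S, P.property.of_linearMap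
    (by
      have := P.property.finiteDimensional
      exact FiniteDimensional.of_injective
        (S.subtype.restrictScalars R : ModuleCat.of (Hecke L k) S →ₗ[R] P.obj)
        Subtype.val_injective)
    fun x hx v => Subtype.ext (hx (v : S))⟩

/-- A quotient representation. -/
def quotRep (P : Rep L k) (S : Submodule (Hecke L k) P.obj) : Rep L k :=
  ⟨ModuleCat.of (Hecke L k) (P.obj ⧸ S), P.property.of_linearMap
    (by
      have := P.property.finiteDimensional
      exact Module.Finite.of_surjective
        (S.mkQ.restrictScalars R : P.obj →ₗ[R] ModuleCat.of (Hecke L k) (P.obj ⧸ S))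
        S.mkQ_surjective)
    fun x hx v => by
      obtain ⟨w, rfl⟩ := S.mkQ_surjective v
      rw [← map_smul, hx, map_zero]⟩

theorem cls_exact {M₁ M₂ M₃ : Rep L k} (f : M₁.obj →ₗ[Hecke L k] M₂.obj)
    (g : M₂.obj →ₗ[Hecke L k] M₃.obj) (hf : Function.Injective f) (hfg : Function.Exact f g)
    (hg : Function.Surjective g) : cls M₂ = cls M₁ + cls M₃ := by
  have h : (QuotientAddGroup.mk (FreeAbelianGroup.of M₂ - FreeAbelianGroup.of M₁ -
      FreeAbelianGroup.of M₃) : GrothendieckGroup L k) = 0 :=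
    (QuotientAddGroup.eq_zero_iff _).2
      (AddSubgroup.subset_closure ⟨M₁, M₂, M₃, f, g, hf, hfg, hg, rfl⟩)
  rw [QuotientAddGroup.mk_sub, QuotientAddGroup.mk_sub, sub_sub, sub_eq_zero] at h
  exact h

/-- For P = 0 the identities form a short exact sequence 0 → P → P → P → 0, so [P] = 2[P]. -/
theorem cls_eq_zero {P : Rep L k} (hP : Subsingleton P.obj) : cls P = 0 := by
  have := cls_exact (M₁ := P) (M₂ := P) (M₃ := P) LinearMap.id LinearMap.id
    Function.injective_id (fun x => by simp [Subsingleton.elim x 0]) Function.surjective_id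
  simpa using this

theorem cls_equiv {P P' : Rep L k} (e : P.obj ≃ₗ[Hecke L k] P'.obj) : cls P = cls P' := by
  have h0 : Subsingleton (subRep P ⊥).obj := inferInstanceAs (Subsingleton (⊥ : Submodule _ P.obj))
  have := cls_exact (M₁ := subRep P ⊥) (M₂ := P) (M₃ := P') (Submodule.subtype ⊥) e.toLinearMap
    Subtype.val_injective (fun x => by
      refine ⟨fun h => ⟨0, (e.injective (h.trans (map_zero e).symm)).symm⟩, ?_⟩
      rintro ⟨y, rfl⟩
      rw [Subsingleton.elim y 0]
      exact map_zero e) e.surjective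
  rw [this, cls_eq_zero h0, zero_add]

theorem cls_eq_subRep_add_quotRep (P : Rep L k) (S : Submodule (Hecke L k) P.obj) :
    cls P = cls (subRep P S) + cls (quotRep P S) :=
  cls_exact (M₁ := subRep P S) (M₃ := quotRep P S) S.subtype S.mkQ Subtype.val_injective
    (LinearMap.exact_subtype_mkQ S) S.mkQ_surjective

/-- The generalized eigenspaces of `X j`, `l ≤ j < k`, with eigenvalue `a` do not meet. -/
def NoTail (a : R) (l : ℕ) (P : Rep L k) : Prop := tailSpace (opX L k P.obj) a l k = ⊥

theorem map_mem_maxGenEigenspace {A B : Type u} [AddCommGroup A] [Module R A] [AddCommGroup B]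
    [Module R B] {y : Module.End R A} {z : Module.End R B} {f : A →ₗ[R] B}
    (h : ∀ v, f (y v) = z (f v)) {a : R} {v : A} (hv : v ∈ y.maxGenEigenspace a) :
    f v ∈ z.maxGenEigenspace a := by
  rw [Module.End.mem_maxGenEigenspace] at hv ⊢
  obtain ⟨r, hr⟩ := hv
  refine ⟨r, ?_⟩
  have : ∀ v, f ((shifted y a ^ r) v) = (shifted z a ^ r) (f v) := by
    clear hr
    induction r with
    | zero => intro v; rfl
    | succ r ih =>
      intro v
      rw [pow_succ, pow_succ, Module.End.mul_apply, Module.End.mul_apply, ih, shifted_apply,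
        shifted_apply, map_sub, map_smul, h]
  rw [← this, hr, map_zero]

theorem map_mem_tailSpace {P P' : ModuleCat.{u} (Hecke L k)} (f : P →ₗ[Hecke L k] P') {a : R}
    {l : ℕ} {v : P} (hv : v ∈ tailSpace (opX L k P) a l k) :
    f v ∈ tailSpace (opX L k P') a l k :=
  mem_tailSpace.2 fun j hj hj' =>
    map_mem_maxGenEigenspace (f := f.restrictScalars R) (map_opX f j) (mem_tailSpace.1 hv j hj hj')

/-- Elements of the tail space of a quotient lift to the tail space. -/
theorem exists_lift_tailSpace {P P' : ModuleCat.{u} (Hecke L k)} [FiniteDimensional R P]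
    (f : P →ₗ[Hecke L k] P') {a : R} {l : ℕ} (hl : l ≤ k) (v : P)
    (hv : f v ∈ tailSpace (opX L k P') a l k) :
    ∃ w ∈ tailSpace (opX L k P) a l k, f w = f v ∧
      ∀ (Q : ModuleCat.{u} (Hecke L k)) (g : P →ₗ[Hecke L k] Q),
        g v = 0 → g w = 0 := by
  obtain ⟨m, rfl⟩ := Nat.exists_eq_add_of_le hl
  obtain ⟨r, hr, hr'⟩ := exists_common_annihilator (opX L (l + m) P) (l + m)
  obtain ⟨p, hp⟩ := exists_projector.{u} a hr
  have h0 : ∀ j < l + m, ∀ v, Polynomial.aeval (opX L (l + m) P j) r v = 0 := fun j hj v => by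
    rw [hr' j hj]; rfl
  have hpP : IsProjector (opX L (l + m) P) a (l + m) p := fun j hj =>
    ⟨fun v => (hp P _ v (h0 j hj v)).1, fun v => (hp P _ v (h0 j hj v)).2⟩
  -- The projection is a polynomial in the `X j` and so commutes with every homomorphism. Hence the
  -- lift is killed by whatever kills `v`. It keeps the image `f v`, since `r` annihilates that too
  -- and `p` therefore fixes it.
  have hmap : ∀ (Q : ModuleCat.{u} (Hecke L (l + m))) (g : P →ₗ[Hecke L (l + m)] Q),
      g (tailProj (opX L (l + m) P) p l m v) = tailProj (opX L (l + m) Q) p l m (g v) :=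
    fun Q g => map_tailProj (f := g.restrictScalars R) p l m (fun j _ _ => map_opX g j) v
  refine ⟨tailProj (opX L (l + m) P) p l m v,
    hpP.tailProj_mem_tailSpace (heckeAction L (l + m) P).X_comm le_rfl v, ?_, ?_⟩
  · rw [hmap]
    refine tailProj_eq_self fun j hj hj' => ?_
    refine (hp P' _ (f v) ?_).2 (mem_tailSpace.1 hv j hj hj')
    have := map_aeval_apply (f := f.restrictScalars R) (map_opX f j) r v
    rw [h0 j hj', map_zero] at this
    exact this.symm
  · intro Q g hg
    rw [hmap, hg, map_zero]

theorem NoTail.of_injective {a : R} {l : ℕ} {P P' : Rep L k} (hP : NoTail a l P)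
    (f : P'.obj →ₗ[Hecke L k] P.obj) (hf : Function.Injective f) : NoTail a l P' :=
  (Submodule.eq_bot_iff _).2 fun v hv => hf (by
    have := map_mem_tailSpace f hv
    rw [show tailSpace _ a l k = ⊥ from hP, Submodule.mem_bot] at this
    rw [this, map_zero])

theorem NoTail.of_surjective {a : R} {l : ℕ} (hl : l ≤ k) {P P' : Rep L k} (hP : NoTail a l P)
    (f : P.obj →ₗ[Hecke L k] P'.obj) (hf : Function.Surjective f) : NoTail a l P' :=
  (Submodule.eq_bot_iff _).2 fun v hv => by
    have := P.property.finiteDimensional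
    obtain ⟨v, rfl⟩ := hf v
    obtain ⟨w, hw, hwv, -⟩ := exists_lift_tailSpace f hl v hv
    rw [show tailSpace _ a l k = ⊥ from hP, Submodule.mem_bot] at hw
    rw [← hwv, hw, map_zero]

/-- The classes of the irreducible representations without a tail of length `k - l`. -/
def simpleClasses (L : Level q) (k : ℕ) (a : R) (l : ℕ) : AddSubmonoid (GrothendieckGroup L k) :=
  AddSubmonoid.closure (cls '' {S | IsSimpleModule (Hecke L k) S.obj ∧ NoTail a l S})

/-- Induction on the dimension, splitting off a simple submodule: absence of the tail passes to
submodules and, since tail vectors lift, to quotients. -/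
theorem cls_mem_simpleClasses {a : R} {l : ℕ} (hl : l ≤ k) {P : Rep L k} (hP : NoTail a l P) :
    cls P ∈ simpleClasses L k a l := by
  induction hd : Module.finrank R P.obj using Nat.strong_induction_on generalizing P with
  | _ d ih =>
    have hfd := P.property.finiteDimensional
    rcases subsingleton_or_nontrivial P.obj with h | h
    · rw [cls_eq_zero h]
      exact zero_mem _
    have : IsArtinian (Hecke L k) P.obj := isArtinian_of_tower R inferInstance
    obtain ⟨S, hS⟩ := IsAtomic.exists_atom (Submodule (Hecke L k) P.obj)
    rw [cls_eq_subRep_add_quotRep P S]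
    refine add_mem (AddSubmonoid.subset_closure ⟨_, ⟨isSimpleModule_iff_isAtom.2 hS,
      hP.of_injective (P' := subRep P S) S.subtype Subtype.val_injective⟩, rfl⟩) ?_
    refine ih _ ?_ (hP.of_surjective hl (P' := quotRep P S) S.mkQ S.mkQ_surjective) rfl
    rw [← hd]
    let f : P.obj →ₗ[R] (quotRep P S).obj := S.mkQ.restrictScalars R
    have h1 := LinearMap.finrank_range_add_finrank_ker f
    have h2 : LinearMap.range f = ⊤ := LinearMap.range_eq_top.2 S.mkQ_surjective
    rw [h2, finrank_top] at h1
    have h3 : 0 < Module.finrank R (LinearMap.ker f) := by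
      obtain ⟨v, hv, hv0⟩ := (Submodule.ne_bot_iff _).1 hS.1
      rw [Module.finrank_pos_iff, Submodule.nontrivial_iff_ne_bot, Submodule.ne_bot_iff]
      exact ⟨v, (Submodule.Quotient.mk_eq_zero S).2 hv, hv0⟩
    omega

theorem exists_sum_of_mem_simpleClasses {a : R} {l : ℕ} {x : GrothendieckGroup L k}
    (hx : x ∈ simpleClasses L k a l) :
    ∃ (m : ℕ) (c : Fin m → ℕ) (M : Fin m → Rep L k),
      (∀ α, IsSimpleModule (Hecke L k) (M α).obj) ∧ (∀ α, NoTail a l (M α)) ∧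
      x = ∑ α, c α • cls (M α) := by
  induction hx using AddSubmonoid.closure_induction with
  | mem x hx =>
    obtain ⟨S, hS, rfl⟩ := hx
    exact ⟨1, fun _ => 1, fun _ => S, fun _ => hS.1, fun _ => hS.2, by simp⟩
  | zero => exact ⟨0, Fin.elim0, Fin.elim0, fun α => α.elim0, fun α => α.elim0, by simp⟩
  | add x y _ _ hx hy =>
    obtain ⟨m, c, M, h1, h2, rfl⟩ := hx
    obtain ⟨m', c', M', h1', h2', rfl⟩ := hy
    refine ⟨m + m', Fin.append c c', Fin.append M M', fun α => ?_, fun α => ?_, ?_⟩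
    · refine Fin.addCases (fun i => ?_) (fun i => ?_) α
      · rw [Fin.append_left]; exact h1 i
      · rw [Fin.append_right]; exact h1' i
    · refine Fin.addCases (fun i => ?_) (fun i => ?_) α
      · rw [Fin.append_left]; exact h2 i
      · rw [Fin.append_right]; exact h2' i
    · rw [Fin.sum_univ_add]
      simp only [Fin.append_left, Fin.append_right]

end Grothendieck

/-! ### The socle of the eigenspace and the integer `ε` -/

section Socle

open Module.End (maxGenEigenspace mem_maxGenEigenspace eigenspace mem_eigenspace_iff)

variable {R : Type u} [Field R] {q : Rˣ} {L : Level q} {k : ℕ}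

/-- A submodule of the restriction, as a linear map into the representation. -/
def toAmbient {M : ModuleCat.{u} (Hecke L (k + 1))} {B : ModuleCat.{u} (Hecke L k)}
    (g : B →ₗ[Hecke L k] res M) : B →ₗ[R] M :=
  (resEquiv M).toLinearMap ∘ₗ g.restrictScalars R

theorem toAmbient_apply {M : ModuleCat.{u} (Hecke L (k + 1))} {B : ModuleCat.{u} (Hecke L k)}
    (g : B →ₗ[Hecke L k] res M) (v : B) : toAmbient g v = resEquiv M (g v) := rfl

theorem toAmbient_opX {M : ModuleCat.{u} (Hecke L (k + 1))} {B : ModuleCat.{u} (Hecke L k)}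
    (g : B →ₗ[Hecke L k] res M) {j : ℕ} (hj : j < k) (v : B) :
    toAmbient g (opX L k B j v) = opX L (k + 1) M j (toAmbient g v) := by
  rw [toAmbient_apply, toAmbient_apply, ← resEquiv_opX hj]
  exact congrArg (resEquiv M) (map_opX g j v)

theorem map_mem_maxGenEigenspace_iff {A B : Type u} [AddCommGroup A] [Module R A] [AddCommGroup B]
    [Module R B] {y : Module.End R A} {z : Module.End R B} {f : A →ₗ[R] B}
    (hf : Function.Injective f) (h : ∀ v, f (y v) = z (f v)) {a : R} {v : A} :
    f v ∈ z.maxGenEigenspace a ↔ v ∈ y.maxGenEigenspace a := by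
  refine ⟨fun hv => ?_, map_mem_maxGenEigenspace h⟩
  rw [mem_maxGenEigenspace] at hv ⊢
  obtain ⟨r, hr⟩ := hv
  refine ⟨r, hf ?_⟩
  rw [map_zero, ← hr]
  have : ∀ v, f ((shifted y a ^ r) v) = (shifted z a ^ r) (f v) := by
    clear hr
    induction r with
    | zero => intro v; rfl
    | succ r ih =>
      intro v
      rw [pow_succ, pow_succ, Module.End.mul_apply, Module.End.mul_apply, ih, shifted_apply,
        shifted_apply, map_sub, map_smul, h]
  exact this v

theorem toAmbient_mem_tailSpace {M : ModuleCat.{u} (Hecke L (k + 1))}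
    {B : ModuleCat.{u} (Hecke L k)} {g : B →ₗ[Hecke L k] res M} (hg : Function.Injective g) {a : R}
    {l : ℕ} {v : B} : toAmbient g v ∈ tailSpace (opX L (k + 1) M) a l k ↔
      v ∈ tailSpace (opX L k B) a l k := by
  have hinj : Function.Injective (toAmbient g) := (resEquiv M).injective.comp hg
  rw [mem_tailSpace, mem_tailSpace]
  exact forall_congr' fun j => forall_congr' fun _ => forall_congr' fun hj =>
    map_mem_maxGenEigenspace_iff hinj (toAmbient_opX g hj)

theorem hasTail_of_range {M : ModuleCat.{u} (Hecke L (k + 1))}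
    {B : ModuleCat.{u} (Hecke L k)} {g : B →ₗ[Hecke L k] res M} (hg : Function.Injective g) {a : R}
    {l : ℕ} (hl : l ≤ k) (h : HasTail (opX L (k + 1) M) a l k (ofRes (LinearMap.range g))) :
    HasTail (opX L k B) a l k ⊤ := by
  have hinj : Function.Injective (toAmbient g) := (resEquiv M).injective.comp hg
  refine ⟨?_, fun hl0 v _ hv hv' => hinj ?_⟩
  · obtain ⟨w, ⟨hw, hwt⟩, hw0⟩ := (Submodule.ne_bot_iff _).1 h.1
    obtain ⟨v, hv⟩ := mem_ofRes.1 hw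
    obtain rfl : toAmbient g v = w := congrArg (resEquiv M) hv
    exact (Submodule.ne_bot_iff _).2 ⟨v, ⟨trivial, (toAmbient_mem_tailSpace hg).1 hwt⟩,
      fun h0 => hw0 (by rw [h0, map_zero])⟩
  · rw [map_zero]
    exact h.2 hl0 _ (resEquiv_mem_ofRes.2 ⟨v, rfl⟩) ((toAmbient_mem_tailSpace hg).2 hv)
      ((map_mem_maxGenEigenspace_iff hinj (toAmbient_opX g (by omega))).2 hv')

/-- The data of the irreducible socle of the eigenspace. -/
theorem exists_socle {a : R} (ha : ((q : R) - 1) * a ≠ 0) (N : Rep L (k + 1))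
    (hN : IsSimpleModule (Hecke L (k + 1)) N.obj)
    (hE : (opX L (k + 1) N.obj k).maxGenEigenspace a ≠ ⊥) :
    ∃ S : Submodule (Hecke L k) (res N.obj), S ≤ eigen a N.obj ∧ IsSimpleModule (Hecke L k) S ∧
      MinStab (k + 1) (opT L (k + 1) N.obj) (opX L (k + 1) N.obj) k (ofRes S) ∧
      socle (Hecke L k) (eigen a N.obj) = S.comap (eigen a N.obj).subtype := by
  have hfd := N.property.finiteDimensional
  have H := heckeAction L (k + 1) N.obj
  have hT := minStab_top (L := L) (n := k + 1) (M := N.obj)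
  obtain ⟨V, hV, hVm⟩ := H.exists_minStab_le_eigenspace (Nat.lt_succ_self k)
    (hT.2.1.mono (Nat.le_succ k) (Or.inl rfl)) (a := a) (by rwa [top_inf_eq])
  obtain ⟨S, rfl⟩ := exists_ofRes_eq (U := V) ⟨fun j hj => hVm.2.1.1 j (by omega), hVm.2.1.2⟩
  have hSe : S ≤ eigen a N.obj := by
    rw [← ofRes_le_ofRes, ofRes_eigen]
    exact hV.trans inf_le_right
  have hS := isSimpleModule_of_minStab hSe hVm
  refine ⟨S, hSe, hS, hVm, ?_⟩
  have h1 : IsSimpleModule (Hecke L k) (S.comap (eigen a N.obj).subtype) :=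
    IsSimpleModule.congr (Submodule.comapSubtypeEquivOfLe hSe)
  -- The socle is the sum of all simple submodules of the eigenspace, and by uniqueness each of them
  -- is `S`.
  refine le_antisymm (sSup_le fun p hp => ?_) (le_sSup h1)
  have hp' : IsSimpleModule (Hecke L k) (p.map (eigen a N.obj).subtype) := by
    have : IsSimpleModule (Hecke L k) p := hp
    exact IsSimpleModule.congr
      (Submodule.equivMapOfInjective _ (Submodule.injective_subtype _) p).symm
  have hple : p.map (eigen a N.obj).subtype ≤ eigen a N.obj := Submodule.map_subtype_le _ _
  have h2 := minStab_ofRes hp' hple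
  have h3 := H.socle_unique ha (Nat.lt_succ_self k) hT h2 (le_inf le_top (by
    rw [← ofRes_eigen]; exact ofRes_le_ofRes.2 hple)) hVm hV
  rw [← Submodule.map_le_iff_le_comap, ofRes_injective h3]

/-- The inclusion of `ẽ_i N` into the restriction of `N`. -/
def eTildeIncl (a : R) (N : Rep L (k + 1)) : (eTilde a N).obj →ₗ[Hecke L k] res N.obj :=
  (eigen a N.obj).subtype ∘ₗ (socle (Hecke L k) (eigen a N.obj)).subtype

theorem eTildeIncl_injective (a : R) (N : Rep L (k + 1)) :
    Function.Injective (eTildeIncl a N) := Subtype.val_injective.comp Subtype.val_injective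

theorem range_eTildeIncl {a : R} {N : Rep L (k + 1)} {S : Submodule (Hecke L k) (res N.obj)}
    (hS : S ≤ eigen a N.obj)
    (hsoc : socle (Hecke L k) (eigen a N.obj) = S.comap (eigen a N.obj).subtype) :
    LinearMap.range (eTildeIncl a N) = S := by
  ext x
  constructor
  · rintro ⟨⟨y, hy⟩, rfl⟩
    rw [hsoc] at hy
    exact hy
  · exact fun hx => ⟨⟨⟨x, hS hx⟩, by rw [hsoc]; exact hx⟩, rfl⟩

theorem eTilde_subsingleton {a : R} {N : Rep L k} (h : Subsingleton N.obj) :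
    Subsingleton (eTilde a N).obj := by
  cases k with
  | zero => exact inferInstanceAs (Subsingleton PUnit)
  | succ k =>
    have : Subsingleton (res N.obj) := h
    exact inferInstanceAs (Subsingleton (socle (Hecke L k) (eigen a N.obj)))

theorem iterate_subsingleton {a : R} (r : ℕ) (N : Σ n, Rep L n) (h : Subsingleton N.2.obj) :
    Subsingleton ((eTildeOp a)^[r] N).2.obj := by
  induction r generalizing N with
  | zero => exact h
  | succ r ih => exact ih _ (eTilde_subsingleton h)

/-- Each ẽ_i lowers the rank, and in rank 0 it gives zero. This bounds the set defining `epsilon`,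
so that its `sSup` is a genuine maximum. -/
theorem iterate_subsingleton_of_lt {a : R} {n r : ℕ} (h : n < r) (N : Rep L n) :
    Subsingleton ((eTildeOp a)^[r] ⟨n, N⟩).2.obj := by
  obtain ⟨r, rfl⟩ : ∃ r', r = r' + 1 := ⟨r - 1, by omega⟩
  induction n generalizing r with
  | zero => exact iterate_subsingleton r _ (inferInstanceAs (Subsingleton PUnit))
  | succ n ih =>
    obtain ⟨r, rfl⟩ : ∃ r', r = r' + 1 := ⟨r - 1, by omega⟩
    exact ih (eTilde a N) r (by omega)

theorem epsilon_eq_zero {a : R} {n : ℕ} {N : Rep L n} (h : Subsingleton (eTilde a N).obj) :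
    epsilon a N = 0 := by
  refine Nat.le_zero.1 (csSup_le' fun r hr => ?_)
  cases r with
  | zero => exact le_rfl
  | succ r =>
    have := iterate_subsingleton (a := a) r ⟨n - 1, eTilde a N⟩ h
    exact (not_nontrivial_iff_subsingleton.2 this hr).elim

theorem epsilon_eq_succ {a : R} {n : ℕ} {N : Rep L n} (h : Nontrivial (eTilde a N).obj) :
    epsilon a N = epsilon a (eTilde a N) + 1 := by
  have hbdd : BddAbove {r : ℕ | Nontrivial ((eTildeOp a)^[r] ⟨n - 1, eTilde a N⟩).2.obj} :=
    ⟨n - 1, fun r hr => not_lt.1 fun hlt =>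
      not_nontrivial_iff_subsingleton.2 (iterate_subsingleton_of_lt hlt _) hr⟩
  refine IsGreatest.csSup_eq ⟨?_, fun r hr => ?_⟩
  · exact Nat.sSup_mem (s := {r : ℕ | Nontrivial ((eTildeOp a)^[r] ⟨n - 1, eTilde a N⟩).2.obj})
      ⟨0, h⟩ hbdd
  · cases r with
    | zero => exact Nat.zero_le _
    | succ r => exact Nat.succ_le_succ (le_csSup hbdd hr)

/-- `ε` is the length of the tail. -/
theorem epsilon_eq {a : R} (ha : ((q : R) - 1) * a ≠ 0) {n : ℕ} (N : Rep L n)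
    (hN : IsSimpleModule (Hecke L n) N.obj) {l : ℕ} (hl : l ≤ n)
    (ht : HasTail (opX L n N.obj) a l n ⊤) : epsilon a N = n - l := by
  induction n generalizing l with
  | zero =>
    rw [epsilon_eq_zero (inferInstanceAs (Subsingleton PUnit)), Nat.zero_sub]
  | succ k ih =>
    have hfd := N.property.finiteDimensional
    rcases eq_or_lt_of_le hl with rfl | hl'
    · rw [Nat.sub_self]
      refine epsilon_eq_zero ?_
      -- For `l = k + 1` the tail condition on vectors is empty, and minimality says that `a` is not
      -- an eigenvalue of `X k`.
      have h0 : eigen a N.obj = ⊥ := by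
        rw [← ofRes_eq_bot, ofRes_eigen]
        refine (Submodule.eq_bot_iff _).2 fun v hv => ht.2 (Nat.succ_pos k) v trivial ?_
          (eigenspace_le_maxGenEigenspace _ _ hv)
        exact mem_tailSpace.2 fun j hj hj' => by omega
      have : Subsingleton (eigen a N.obj) := by
        rw [h0]
        infer_instance
      exact inferInstanceAs (Subsingleton (socle (Hecke L k) (eigen a N.obj)))
    · have hl'' : l ≤ k := Nat.lt_succ_iff.1 hl'
      have hE := ht.inf_ne_bot hl''
      rw [top_inf_eq] at hE
      obtain ⟨S, hSe, hS, hSm, hsoc⟩ := exists_socle ha N hN hE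
      have hg := eTildeIncl_injective a N
      have hrange := range_eTildeIncl hSe hsoc
      have hsimple : IsSimpleModule (Hecke L k) (eTilde a N).obj :=
        IsSimpleModule.congr ((LinearEquiv.ofInjective _ hg).trans (LinearEquiv.ofEq _ _ hrange))
      -- The module ẽ_i N is simple and its tail starts at the same `l`, one rank lower; so each
      -- application of ẽ_i shortens the tail by one.
      have htail : HasTail (opX L k (eTilde a N).obj) a l k ⊤ := by
        refine hasTail_of_range hg hl'' ?_
        rw [hrange]
        refine (heckeAction L (k + 1) N.obj).hasTail_socle (Nat.lt_succ_self k) hl'' minStab_top ht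
          hSm (le_inf le_top ?_)
        rw [← ofRes_eigen]
        exact ofRes_le_ofRes.2 hSe
      have h1 := ih (eTilde a N) hsimple hl'' htail
      rw [epsilon_eq_succ (IsSimpleModule.nontrivial (Hecke L k) (eTilde a N).obj)]
      change epsilon a (n := k) (eTilde a N) + 1 = _
      rw [h1]
      omega

theorem exists_repTail (a : R) {n : ℕ} (N : Rep L n) (hN : Nontrivial N.obj) :
    ∃ l ≤ n, HasTail (opX L n N.obj) a l n ⊤ := by
  cases n with
  | zero =>
    refine ⟨0, le_rfl, ?_, fun h => absurd h (lt_irrefl 0)⟩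
    obtain ⟨v, hv⟩ := exists_ne (0 : N.obj)
    exact (Submodule.ne_bot_iff _).2 ⟨v, ⟨trivial, mem_tailSpace.2 fun j _ hj => by omega⟩, hv⟩
  | succ k =>
    by_cases h : (⊤ : Submodule R N.obj) ⊓ (opX L (k + 1) N.obj k).maxGenEigenspace a = ⊥
    · refine ⟨k + 1, le_rfl, ?_, fun _ v _ _ hv => ?_⟩
      · obtain ⟨v, hv⟩ := exists_ne (0 : N.obj)
        exact (Submodule.ne_bot_iff _).2 ⟨v, ⟨trivial, mem_tailSpace.2 fun j _ hj => by omega⟩, hv⟩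
      · have : v ∈ (⊤ : Submodule R N.obj) ⊓ (opX L (k + 1) N.obj k).maxGenEigenspace a :=
          ⟨trivial, hv⟩
        rwa [h] at this
    · obtain ⟨l, hl, ht⟩ := exists_hasTail h
      exact ⟨l, by omega, ht⟩

/-- Otherwise the tail of `N` would start at some `l' ≤ l` and be contained in the tail space
starting at `l`, which is zero. -/
theorem epsilon_lt_of_noTail {a : R} (ha : ((q : R) - 1) * a ≠ 0) (N : Rep L k)
    (hN : IsSimpleModule (Hecke L k) N.obj) {l : ℕ} (hl : l ≤ k) (ht : NoTail a l N) :
    epsilon a N < k - l := by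
  obtain ⟨l', hl', ht'⟩ := exists_repTail a N (IsSimpleModule.nontrivial (Hecke L k) N.obj)
  rw [epsilon_eq ha N hN hl' ht']
  by_contra h
  refine ht'.1 (le_bot_iff.1 ?_)
  rw [← show tailSpace _ a l k = ⊥ from ht, top_inf_eq]
  exact fun v hv => mem_tailSpace.2 fun j hj hj' => mem_tailSpace.1 hv j (by omega) hj'

end Socle

/-! ### The generalized eigenspace -/

section GenEigen

open Module.End (maxGenEigenspace mem_maxGenEigenspace eigenspace mem_eigenspace_iff)

variable {R : Type u} [Field R] {q : Rˣ} {L : Level q} {k : ℕ}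

/-- A representation `P` with a nilpotent endomorphism `x` of index `m + 1`, such that `V` is an
irreducible submodule contained in all others and the elements of the kernel of `x` in the tail
space of `P` belong to `V`. -/
structure TailData (a : R) (l m : ℕ) (P : Rep L k) (x : Module.End (Hecke L k) P.obj)
    (V : Submodule (Hecke L k) P.obj) : Prop where
  pow_eq_zero : x ^ (m + 1) = 0
  pow_ne_zero : x ^ m ≠ 0
  isSimple : IsSimpleModule (Hecke L k) V
  le_of_ne_bot : ∀ B : Submodule (Hecke L k) P.obj, B ≠ ⊥ → V ≤ B
  mem_of_tail : ∀ v ∈ tailSpace (opX L k P.obj) a l k, x v = 0 → v ∈ V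
  exists_tail : ∃ v ∈ V, v ≠ 0 ∧ v ∈ tailSpace (opX L k P.obj) a l k

/-! ### Composition factors and endomorphisms from the tail data -/

section Consequences

variable {a : R} {l m : ℕ} {P : Rep L k} {x : Module.End (Hecke L k) P.obj}
  {V : Submodule (Hecke L k) P.obj}

/-- `C` contains `V`, and all tail vectors of `C` lie in `V` because `x` kills `C`. Tail vectors of
C/V lift to `C`, so C/V has none. -/
theorem TailData.exists_cls_eq_of_le_ker (D : TailData a l m P x V) (hl : l ≤ k)
    {C : Submodule (Hecke L k) P.obj} (hC : C ≠ ⊥) (hCx : ∀ v ∈ C, x v = 0) :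
    ∃ c ∈ simpleClasses L k a l, cls (subRep P C) = cls (subRep P V) + c := by
  have hVC := D.le_of_ne_bot C hC
  let V' : Submodule (Hecke L k) (subRep P C).obj := V.comap C.subtype
  refine ⟨cls (quotRep (subRep P C) V'), cls_mem_simpleClasses hl ?_, ?_⟩
  · refine (Submodule.eq_bot_iff _).2 fun v hv => ?_
    have := (subRep P C).property.finiteDimensional
    obtain ⟨v, rfl⟩ := V'.mkQ_surjective v
    obtain ⟨w, hw, hwv, -⟩ := exists_lift_tailSpace (P' := (quotRep (subRep P C) V').obj)
      V'.mkQ hl v hv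
    have h1 : (C.subtype w) ∈ tailSpace (opX L k P.obj) a l k :=
      map_mem_tailSpace (P := (subRep P C).obj) (P' := P.obj) C.subtype hw
    have h2 : w ∈ V' := D.mem_of_tail _ h1 (hCx _ (show C from w).2)
    exact hwv.symm.trans ((Submodule.Quotient.mk_eq_zero V').2 h2)
  · rw [cls_eq_subRep_add_quotRep (subRep P C) V',
      cls_equiv (P := subRep (subRep P C) V') (P' := subRep P V)
        (Submodule.comapSubtypeEquivOfLe hVC)]

/-- Induction along 0 → B ∩ ker x → B → xB → 0: the kernel contributes one copy of `V`, and the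
index drops by one on xB. The hypothesis `h1` says that `r` is the exact index on `B`, and is empty
for `r = 0`. -/
theorem TailData.exists_cls_eq (D : TailData a l m P x V) (hl : l ≤ k) (r : ℕ)
    (B : Submodule (Hecke L k) P.obj) (hB : ∀ v ∈ B, x v ∈ B) (h0 : ∀ v ∈ B, (x ^ r) v = 0)
    (h1 : ∀ s, r = s + 1 → ∃ v ∈ B, (x ^ s) v ≠ 0) :
    ∃ c ∈ simpleClasses L k a l, cls (subRep P B) = r • cls (subRep P V) + c := by
  induction r generalizing B with
  | zero =>
    refine ⟨0, zero_mem _, ?_⟩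
    have : Subsingleton (subRep P B).obj := ⟨fun v w => Subtype.ext
      ((h0 _ (show B from v).2).trans (h0 _ (show B from w).2).symm)⟩
    rw [cls_eq_zero this, zero_smul, add_zero]
  | succ r ih =>
    obtain ⟨v₀, hv₀, hv₀'⟩ := h1 r rfl
    have hpow : ∀ r, ∀ v ∈ B, (x ^ r) v ∈ B := fun r => by
      induction r with
      | zero => exact fun v hv => hv
      | succ r ih => intro v hv; rw [pow_succ', Module.End.mul_apply]; exact hB _ (ih v hv)
    obtain ⟨c, hc, hc'⟩ := ih (B.map x)
      (by rintro _ ⟨v, hv, rfl⟩; exact ⟨x v, hB v hv, rfl⟩)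
      (by
        rintro _ ⟨v, hv, rfl⟩
        rw [← Module.End.mul_apply, ← pow_succ]
        exact h0 v hv)
      (by
        rintro s rfl
        refine ⟨x v₀, ⟨v₀, hv₀, rfl⟩, ?_⟩
        rw [← Module.End.mul_apply, ← pow_succ]
        exact hv₀')
    have hC0 : B ⊓ LinearMap.ker x ≠ ⊥ := (Submodule.ne_bot_iff _).2
      ⟨_, ⟨hpow r v₀ hv₀, by
        rw [SetLike.mem_coe, LinearMap.mem_ker, ← Module.End.mul_apply, ← pow_succ', h0 v₀ hv₀]⟩,
        hv₀'⟩
    obtain ⟨c', hd, hd'⟩ := D.exists_cls_eq_of_le_ker hl hC0 fun v hv => hv.2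
    let f : (subRep P (B ⊓ LinearMap.ker x)).obj →ₗ[Hecke L k] (subRep P B).obj :=
      Submodule.inclusion inf_le_left
    let g : (subRep P B).obj →ₗ[Hecke L k] (subRep P (B.map x)).obj :=
      x.restrict fun v hv => Submodule.mem_map_of_mem hv
    have hg : ∀ w : B, ((show B.map x from g w) : P.obj) = x w := fun w => rfl
    have hfg : Function.Exact f g := by
      intro w
      constructor
      · intro hw
        have h2 : x (show B from w) = 0 := (hg w).symm.trans (congrArg (fun z : B.map x =>
          (z : P.obj)) hw)
        exact ⟨⟨(show B from w), (show B from w).2, h2⟩, rfl⟩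
      · rintro ⟨w, rfl⟩
        exact Subtype.ext (show (B ⊓ LinearMap.ker x : Submodule _ _) from w).2.2
    have hgs : Function.Surjective g := by
      rintro ⟨_, v, hv, rfl⟩
      exact ⟨⟨v, hv⟩, rfl⟩
    refine ⟨c' + c, add_mem hd hc, ?_⟩
    rw [cls_exact f g (Submodule.inclusion_injective _) hfg hgs, hc', hd', add_smul, one_smul]
    abel

theorem TailData.exists_cls_self (D : TailData a l m P x V) (hl : l ≤ k) :
    ∃ c ∈ simpleClasses L k a l, cls P = (m + 1) • cls (subRep P V) + c := by
  obtain ⟨c, hc, h⟩ := D.exists_cls_eq hl (m + 1) ⊤ (fun _ _ => trivial)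
    (fun v _ => by rw [D.pow_eq_zero]; rfl) (by
      intro s hs
      obtain rfl : m = s := by omega
      by_contra! h
      exact D.pow_ne_zero (LinearMap.ext fun v => h v trivial))
  refine ⟨c, hc, ?_⟩
  rw [← h]
  exact (cls_equiv (P := subRep P ⊤) (P' := P) Submodule.topEquiv).symm

theorem TailData.le_range (D : TailData a l m P x V) {j : ℕ} (hj : j ≤ m) :
    V ≤ LinearMap.range (x ^ j) := by
  refine D.le_of_ne_bot _ fun h => D.pow_ne_zero ?_
  rw [LinearMap.range_eq_bot] at h
  rw [← Nat.sub_add_cancel hj, pow_add, h, mul_zero]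

/-- An endomorphism which vanishes on the kernel of `x ^ j` is a multiple of `x ^ j` on the
preimage of `V` under `x ^ j`. -/
theorem TailData.exists_scalar (D : TailData a l m P x V)
    (hschur : ∀ ψ : V →ₗ[Hecke L k] V, ∃ c : R, ∀ v : V, ((ψ v : V) : P.obj) = c • (v : P.obj))
    {j : ℕ} (hj : j ≤ m) {φ : Module.End (Hecke L k) P.obj}
    (hφ : ∀ v, (x ^ j) v = 0 → φ v = 0) : ∃ c : R, ∀ w, (x ^ j) w ∈ V → φ w = c • (x ^ j) w := by
  let f : V.comap (x ^ j) →ₗ[Hecke L k] V := (x ^ j).restrict fun v hv => hv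
  have hf : Function.Surjective f := by
    rintro ⟨v, hv⟩
    obtain ⟨w, rfl⟩ := D.le_range hj hv
    exact ⟨⟨w, hv⟩, rfl⟩
  have hker : LinearMap.ker f ≤ LinearMap.ker (φ ∘ₗ (V.comap (x ^ j)).subtype) := fun w hw =>
    hφ w (congrArg (fun z : V => (z : P.obj)) (LinearMap.mem_ker.1 hw))
  -- As x^j maps the preimage of `V` onto `V` and `φ` kills its kernel, `φ` factors as `ψ` after
  -- x^j.
  let ψ : V →ₗ[Hecke L k] P.obj := (LinearMap.ker f).liftQ _ hker ∘ₗ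
    (f.quotKerEquivOfSurjective hf).symm.toLinearMap
  have hψ : ∀ w, ψ (f w) = φ w := fun w => by
    have h1 : (f.quotKerEquivOfSurjective hf).symm (f w) = (LinearMap.ker f).mkQ w := by
      rw [LinearEquiv.symm_apply_eq]
      rfl
    change (LinearMap.ker f).liftQ _ hker ((f.quotKerEquivOfSurjective hf).symm (f w)) = _
    rw [h1]
    rfl
  -- A nonzero image of `ψ` contains `V`; the part of `V` mapped into `V` is then a nonzero
  -- submodule of a simple module. So Schur's lemma for `V` applies to `ψ`.
  have hψV : ∀ v, ψ v ∈ V := by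
    have := D.isSimple
    by_cases h0 : LinearMap.range ψ = ⊥
    · intro v
      rw [LinearMap.range_eq_bot] at h0
      rw [h0]
      exact zero_mem V
    · have hle := D.le_of_ne_bot _ h0
      obtain ⟨v₀, hv₀, hne, -⟩ := D.exists_tail
      obtain ⟨u, rfl⟩ := hle hv₀
      rcases eq_bot_or_eq_top (V.comap ψ) with h | h
      · have : u ∈ V.comap ψ := hv₀
        rw [h, Submodule.mem_bot] at this
        exact (hne (by rw [this, map_zero])).elim
      · intro v
        have : v ∈ V.comap ψ := h ▸ trivial
        exact this
  obtain ⟨c, hc⟩ := hschur (ψ.codRestrict V hψV)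
  refine ⟨c, fun w hw => ?_⟩
  have h1 := hc (f ⟨w, hw⟩)
  rw [LinearMap.codRestrict_apply, hψ] at h1
  exact h1

/-- The polynomial is found one coefficient at a time: once `φ` agrees with `g` on ker x^j, the
difference is a scalar times x^j over `V`, and that scalar is the next coefficient. -/
theorem TailData.exists_polynomial (D : TailData a l m P x V) (hl : l ≤ k)
    (hschur : ∀ ψ : V →ₗ[Hecke L k] V, ∃ c : R, ∀ v : V, ((ψ v : V) : P.obj) = c • (v : P.obj))
    (φ : Module.End (Hecke L k) P.obj) (j : ℕ) (hj : j ≤ m + 1) :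
    ∃ g ∈ Polynomial.degreeLT R j, ∀ v, (x ^ j) v = 0 → φ v = Polynomial.aeval x g v := by
  have hfd := P.property.finiteDimensional
  induction j with
  | zero => exact ⟨0, zero_mem _, fun v hv => by rw [show v = 0 from hv]; simp⟩
  | succ j ih =>
    obtain ⟨g, hg, hgφ⟩ := ih (by omega)
    obtain ⟨c, hc⟩ := D.exists_scalar hschur (j := j) (by omega) (φ := φ - Polynomial.aeval x g)
      (fun v hv => by rw [LinearMap.sub_apply, hgφ v hv, sub_self])
    refine ⟨g + Polynomial.monomial j c, add_mem (Polynomial.degreeLT_mono (Nat.le_succ j) hg)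
      (Polynomial.mem_degreeLT.2 ((Polynomial.degree_monomial_le j c).trans_lt
        (by exact_mod_cast Nat.lt_succ_self j))), ?_⟩
    have hmon : ∀ v, Polynomial.aeval x (Polynomial.monomial j c) v = c • (x ^ j) v := fun v => by
      rw [Polynomial.aeval_monomial, ← Algebra.smul_def, LinearMap.smul_apply]
    set φ' : Module.End (Hecke L k) P.obj := φ - Polynomial.aeval x (g + Polynomial.monomial j c)
      with hφ'
    have hφ'V : ∀ w, (x ^ j) w ∈ V → φ' w = 0 := fun w hw => by
      have := hc w hw
      rw [hφ', map_add, ← sub_sub, LinearMap.sub_apply, hmon, this, sub_self]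
    -- If φ' were nonzero on ker x^{j+1}, its image would contain a tail vector of `V`, the image of
    -- a tail vector w in ker x^{j+1}. Then x^j w is a tail vector in ker x, hence in `V`, and φ' w
    -- = 0, a contradiction.
    suffices h : (LinearMap.ker (x ^ (j + 1))).map φ' = ⊥ by
      intro v hv
      have h1 : φ' v ∈ (LinearMap.ker (x ^ (j + 1))).map φ' := Submodule.mem_map_of_mem hv
      rw [h, Submodule.mem_bot, hφ', LinearMap.sub_apply, sub_eq_zero] at h1
      exact h1
    by_contra h
    obtain ⟨v, hv, hv0, hvt⟩ := D.exists_tail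
    obtain ⟨e, he, rfl⟩ := D.le_of_ne_bot _ h hv
    obtain ⟨w, hw, hwe, hwg⟩ := exists_lift_tailSpace φ' hl e hvt
    have h1 := hwg P.obj (x ^ (j + 1)) he
    refine hv0 (hwe ▸ hφ'V w (D.mem_of_tail _ (map_mem_tailSpace (x ^ j) hw) ?_))
    rw [← Module.End.mul_apply, ← pow_succ', h1]

/-- Evaluation at `x` identifies polynomials of degree at most `m` with the endomorphisms. It is
injective because the minimal polynomial is a power of X, and x^m ≠ 0. -/
theorem TailData.finrank_end (D : TailData a l m P x V) (hl : l ≤ k)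
    (hschur : ∀ ψ : V →ₗ[Hecke L k] V, ∃ c : R, ∀ v : V, ((ψ v : V) : P.obj) = c • (v : P.obj)) :
    Module.finrank R (P.obj →ₗ[Hecke L k] P.obj) = m + 1 := by
  let f : Polynomial.degreeLT R (m + 1) →ₗ[R] Module.End (Hecke L k) P.obj :=
    (Polynomial.aeval x).toLinearMap.domRestrict _
  have hsurj : Function.Surjective f := fun φ => by
    obtain ⟨g, hg, h⟩ := D.exists_polynomial hl hschur φ (m + 1) le_rfl
    exact ⟨⟨g, hg⟩, LinearMap.ext fun v => (h v (by rw [D.pow_eq_zero]; rfl)).symm⟩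
  have hinj : Function.Injective f := by
    rw [← LinearMap.ker_eq_bot, LinearMap.ker_eq_bot']
    rintro ⟨g, hg⟩ hgx
    have hgx' : Polynomial.aeval x g = 0 := hgx
    by_contra hg0
    have hg0' : g ≠ 0 := fun h => hg0 (Subtype.ext h)
    have h1 : minpoly R x ∣ Polynomial.X ^ (m + 1) :=
      minpoly.dvd R x (by rw [map_pow, Polynomial.aeval_X, D.pow_eq_zero])
    obtain ⟨s, -, hs⟩ := (dvd_prime_pow Polynomial.prime_X _).1 h1
    have h2 : Polynomial.X ^ s ∣ g := hs.symm.dvd.trans (minpoly.dvd R x hgx')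
    have h3 : s ≤ m := by
      have h4 := Polynomial.natDegree_le_of_dvd h2 hg0'
      rw [Polynomial.natDegree_X_pow] at h4
      have h5 := (Polynomial.natDegree_lt_iff_degree_lt hg0').2 (Polynomial.mem_degreeLT.1 hg)
      omega
    have h4 : x ^ s = 0 := by
      obtain ⟨r, hr⟩ := hs.dvd
      have := congrArg (Polynomial.aeval x) hr
      rwa [map_mul, minpoly.aeval, zero_mul, map_pow, Polynomial.aeval_X] at this
    exact D.pow_ne_zero (by rw [← Nat.sub_add_cancel h3, pow_add, h4, mul_zero])
  rw [← (LinearEquiv.ofBijective f ⟨hinj, hsurj⟩).finrank_eq,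
    (Polynomial.degreeLTEquiv R (m + 1)).finrank_eq, Module.finrank_fin_fun]

end Consequences

end GenEigen

/-! ### Generalized eigenspaces of irreducible representations -/

section Irreducible

open Module.End (maxGenEigenspace mem_maxGenEigenspace eigenspace mem_eigenspace_iff)

variable {R : Type u} [Field R] {q : Rˣ} {L : Level q} {k : ℕ}

/-- The nilpotent endomorphism `X_{k+1} - a` of the generalized eigenspace. -/
def shiftEnd (a : R) (M : ModuleCat.{u} (Hecke L (k + 1))) :
    Module.End (Hecke L k) (genEigen a M) where
  toFun e := ⟨(resEquiv M).symm (shifted (opX L (k + 1) M k) a (resEquiv M e)), by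
    rw [← mem_ofRes, ofRes_genEigen]
    have h : resEquiv M e ∈ (opX L (k + 1) M k).maxGenEigenspace a := by
      rw [← ofRes_genEigen, resEquiv_mem_ofRes]
      exact e.2
    exact sub_mem (mem_maxGenEigenspace_of_commute (fun _ => rfl) h) (Submodule.smul_mem _ _ h)⟩
  map_add' e e' := Subtype.ext (by
    change (resEquiv M).symm (shifted _ a (resEquiv M ((e : res M) + e'))) = _
    rw [map_add, map_add, map_add]
    rfl)
  map_smul' h e := Subtype.ext (by
    change (resEquiv M).symm (shifted _ a (resEquiv M (h • (e : res M)))) =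
      h • (resEquiv M).symm (shifted _ a (resEquiv M e))
    apply (resEquiv M).injective
    rw [resEquiv_smul, resEquiv_smul, LinearEquiv.apply_symm_apply, LinearEquiv.apply_symm_apply,
      ← pow_one (shifted _ a), shifted_opX_pow, shifted_opX_pow, pow_one, smul_smul, smul_smul,
      (sub_algebraMap_commute L k a h).eq])

theorem resEquiv_shiftEnd_pow (a : R) (M : ModuleCat.{u} (Hecke L (k + 1))) (r : ℕ)
    (e : genEigen a M) : resEquiv M ((shiftEnd a M ^ r) e : genEigen a M) =
      (shifted (opX L (k + 1) M k) a ^ r) (resEquiv M e) := by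
  induction r with
  | zero => rfl
  | succ r ih => rw [pow_succ', pow_succ', Module.End.mul_apply, Module.End.mul_apply, ← ih]; rfl

/-- The structure of the generalized eigenspace of an irreducible representation. -/
theorem exists_tailData {a : R} (ha : ((q : R) - 1) * a ≠ 0) (N : Rep L (k + 1))
    (hN : IsSimpleModule (Hecke L (k + 1)) N.obj) {l m : ℕ} (hl : l + m = k)
    (ht : HasTail (opX L (k + 1) N.obj) a l (k + 1) ⊤) :
    ∃ (x : Module.End (Hecke L k) (eStar a N).obj) (V : Submodule (Hecke L k) (eStar a N).obj),
      TailData (k := k) a l m (eStar a N) x V ∧ Nonempty ((eTilde a N).obj ≃ₗ[Hecke L k] V) := by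
  have hfd := N.property.finiteDimensional
  have H := heckeAction L (k + 1) N.obj
  have hT := minStab_top (L := L) (n := k + 1) (M := N.obj)
  have hk := Nat.lt_succ_self k
  have hlk : l ≤ k := by omega
  have hE := ht.inf_ne_bot hlk
  rw [top_inf_eq] at hE
  obtain ⟨S, hSe, hS, hSm, hsoc⟩ := exists_socle ha N hN hE
  have hSe' : ofRes S ≤ ⊤ ⊓ (opX L (k + 1) N.obj k).eigenspace a := by
    rw [top_inf_eq, ← ofRes_eigen]
    exact ofRes_le_ofRes.2 hSe
  have hSg : S ≤ genEigen a N.obj := by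
    rw [← ofRes_le_ofRes, ofRes_genEigen]
    exact (hSe'.trans inf_le_right).trans (eigenspace_le_maxGenEigenspace _ _)
  let incl : (eStar a N).obj →ₗ[Hecke L k] res N.obj := (genEigen a N.obj).subtype
  have hincl : Function.Injective incl := Subtype.val_injective
  have hgen : ∀ e : genEigen a N.obj, resEquiv N.obj e ∈
      (opX L (k + 1) N.obj k).maxGenEigenspace a := fun e => by
    rw [← ofRes_genEigen, resEquiv_mem_ofRes]
    exact e.2
  have hlift : ∀ w ∈ (opX L (k + 1) N.obj k).maxGenEigenspace a,
      ∃ e : genEigen a N.obj, resEquiv N.obj e = w := fun w hw => by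
    rw [← ofRes_genEigen, mem_ofRes] at hw
    exact ⟨⟨_, hw⟩, rfl⟩
  have htail : ∀ e : genEigen a N.obj,
      resEquiv N.obj e ∈ tailSpace (opX L (k + 1) N.obj) a l k ↔
        e ∈ tailSpace (opX L k (eStar a N).obj) a l k := fun e =>
    toAmbient_mem_tailSpace (g := incl) hincl (v := e)
  have hker : ∀ e : genEigen a N.obj, shiftEnd a N.obj e = 0 ↔
      resEquiv N.obj e ∈ (opX L (k + 1) N.obj k).eigenspace a := fun e => by
    have h1 := resEquiv_shiftEnd_pow a N.obj 1 e
    rw [pow_one, pow_one] at h1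
    rw [mem_eigenspace_iff_shifted, ← h1, LinearEquiv.map_eq_zero_iff]
    exact Subtype.ext_iff
  have hpow : shiftEnd a N.obj ^ (m + 1) = 0 := by
    refine LinearMap.ext fun e => Subtype.ext ((resEquiv N.obj).injective ?_)
    rw [resEquiv_shiftEnd_pow, H.pow_eq_zero ha hk hl hT ht trivial (hgen e)]
    exact (map_zero _).symm
  have hpow' : shiftEnd a N.obj ^ m ≠ 0 := by
    obtain ⟨-, w, hw, hw0⟩ := H.tail_pow ha hk hl hT ht
    obtain ⟨e, rfl⟩ := hlift w ((tailSpace_succ hlk).1 hw.2).2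
    intro h
    rw [← resEquiv_shiftEnd_pow, h] at hw0
    exact hw0 (map_zero _)
  refine ⟨shiftEnd a N.obj, S.comap (genEigen a N.obj).subtype,
    ⟨hpow, hpow', ?_, ?_, ?_, ?_⟩, ?_⟩
  · exact IsSimpleModule.congr (Submodule.comapSubtypeEquivOfLe hSg)
  · intro B hB
    have h1 := H.socle_le ha hT hSm hSe' (stab_ofRes (B.map (genEigen a N.obj).subtype)) ?_ ?_
    · rintro v hv
      obtain ⟨b, hb, hbv⟩ := ofRes_le_ofRes.1 h1 hv
      rwa [← Subtype.ext hbv]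
    · rw [top_inf_eq, ← ofRes_genEigen]
      exact ofRes_le_ofRes.2 (Submodule.map_subtype_le _ _)
    · intro h
      obtain ⟨b, hb, hb0⟩ := (Submodule.ne_bot_iff _).1 hB
      have : ((show genEigen a N.obj from b) : res N.obj) ∈ B.map (genEigen a N.obj).subtype :=
        ⟨b, hb, rfl⟩
      rw [ofRes_eq_bot.1 h, Submodule.mem_bot] at this
      exact hb0 (Subtype.ext this)
  · intro v hv hv0
    refine resEquiv_mem_ofRes.1 (H.tail_inf_eigenspace_le ha hk hlk hT ht hSm hSe'
      ⟨⟨trivial, (tailSpace_succ hlk).2 ⟨(htail v).2 hv, hgen v⟩⟩, (hker v).1 hv0⟩)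
  · obtain ⟨w, ⟨hw, hwt⟩, hw0⟩ := (Submodule.ne_bot_iff _).1
      (H.hasTail_socle hk hlk hT ht hSm hSe').1
    obtain ⟨e, rfl⟩ := hlift w (eigenspace_le_maxGenEigenspace _ _ (hSe' hw).2)
    refine ⟨e, resEquiv_mem_ofRes.1 hw, fun h => hw0 ?_, (htail e).1 hwt⟩
    have h' : (e : res N.obj) = 0 := congrArg Subtype.val h
    rw [h', map_zero]
  · exact ⟨((LinearEquiv.ofInjective _ (eTildeIncl_injective a N)).trans (LinearEquiv.ofEq _ _
      (range_eTildeIncl hSe hsoc))).trans (Submodule.comapSubtypeEquivOfLe hSg).symm⟩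

/-! ### Absolute irreducibility -/

theorem Weight.poly_ne_zero (lam : Weight q) : lam.poly ≠ 0 :=
  Finset.prod_ne_zero_iff.2 fun _ _ => pow_ne_zero _ (Polynomial.X_sub_C_ne_zero _)

theorem Weight.poly_splits (lam : Weight q) : lam.poly.Splits :=
  Polynomial.Splits.prod fun _ _ => (Polynomial.Splits.X_sub_C _).pow _

/-- A split polynomial annihilates `X 0`, by the condition on representations or by the cyclotomic
relation, and splitting propagates to `X k`. The eigenvalue is nonzero because `X k` is invertible.
-/
theorem exists_eigenvector (N : Rep L (k + 1)) (hN : Nontrivial N.obj) :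
    ∃ b : R, b ≠ 0 ∧ (opX L (k + 1) N.obj k).maxGenEigenspace b ≠ ⊥ := by
  have hfd := N.property.finiteDimensional
  have hX : ∃ lam : Weight q, ∀ v : N.obj,
      Polynomial.aeval (X L 0 (Nat.succ_pos k)) lam.poly • v = 0 := by
    cases L with
    | aff => exact N.property.2 (Nat.succ_pos k)
    | cyc lam =>
      refine ⟨lam, fun v => ?_⟩
      have := mk_rel (Rel.cyclotomic (L := Level.cyc lam) lam rfl (Nat.succ_pos k))
      rw [← Polynomial.aeval_algHom_apply, map_zero] at this
      rw [X, this, zero_smul]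
  obtain ⟨lam, hlam⟩ := hX
  have h0 : Polynomial.aeval (opX L (k + 1) N.obj 0) lam.poly = 0 := by
    rw [opX, dif_pos (Nat.succ_pos k), Polynomial.aeval_algHom_apply]
    exact LinearMap.ext hlam
  obtain ⟨g, hg0, hgs, hg⟩ := (heckeAction L (k + 1) N.obj).exists_splits q.ne_zero
    lam.poly_ne_zero lam.poly_splits h0 (Nat.lt_succ_self k)
  obtain ⟨b, v, hv, hbv⟩ := exists_eigenvector_of_splits hg0 hgs hg
  refine ⟨b, fun hb => hv ?_, (Submodule.ne_bot_iff _).2 ⟨v, eigenspace_le_maxGenEigenspace _ _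
    (mem_eigenspace_iff.2 hbv), hv⟩⟩
  rw [hb, zero_smul, opX_apply (Nat.lt_succ_self k)] at hbv
  rw [← mk_fXinv_smul_X (L := L) (Nat.lt_succ_self k) v, hbv, smul_zero]

/-- An irreducible subspace of an eigenspace is preserved by intertwining operators. -/
theorem HeckeAction.map_mem_socle {A : Type u} [AddCommGroup A] [Module R A]
    [FiniteDimensional R A] {p a : R} {T X : ℕ → Module.End R A}
    (H : HeckeAction p (k + 1) T X) (ha : (p - 1) * a ≠ 0)
    (hN : MinStab (k + 1) T X (k + 1) ⊤) {V : Submodule R A} (hV : MinStab (k + 1) T X k V)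
    (hVe : V ≤ (X k).eigenspace a) {φ : Module.End R A}
    (hφT : ∀ j, j + 1 < k + 1 → ∀ v, φ (T j v) = T j (φ v))
    (hφX : ∀ j, j < k + 1 → ∀ v, φ (X j v) = X j (φ v)) {v : A} (hv : v ∈ V) : φ v ∈ V := by
  by_cases h0 : V.map φ = ⊥
  · have : φ v ∈ V.map φ := Submodule.mem_map_of_mem hv
    rw [h0, Submodule.mem_bot] at this
    rw [this]
    exact zero_mem V
  have hs : Stab (k + 1) T X 0 k (V.map φ) := by
    constructor
    · rintro j hj _ ⟨w, hw, rfl⟩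
      exact ⟨X j w, hV.2.1.1 j hj w hw, hφX j hj w⟩
    · rintro j hj hjl _ ⟨w, hw, rfl⟩
      exact ⟨T j w, hV.2.1.2 j hj hjl w hw, hφT j (by omega) w⟩
  have he : V.map φ ≤ (X k).eigenspace a := by
    rintro _ ⟨w, hw, rfl⟩
    rw [mem_eigenspace_iff, ← hφX k (Nat.lt_succ_self k), mem_eigenspace_iff.1 (hVe hw), map_smul]
  obtain ⟨V', hV', hV'm⟩ := exists_minStab_le hs h0
  have h1 := H.socle_unique ha (Nat.lt_succ_self k) hN hV (le_inf le_top hVe) hV'm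
    (le_inf le_top (hV'.trans he))
  have hcs : Stab (k + 1) T X 0 k (V.comap φ) := by
    constructor
    · intro j hj w hw
      change φ (X j w) ∈ V
      rw [hφX j hj]
      exact hV.2.1.1 j hj _ hw
    · intro j hj hjl w hw
      change φ (T j w) ∈ V
      rw [hφT j (by omega)]
      exact hV.2.1.2 j hj hjl _ hw
  -- By uniqueness the image of `V` contains `V`, so the preimage of `V` meets `V` and hence
  -- contains it.
  refine hV.le_of_inf_ne_bot hcs ?_ hv
  obtain ⟨u, hu, hu0⟩ := (Submodule.ne_bot_iff _).1 hV.1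
  obtain ⟨w, hw, rfl⟩ := hV' (h1 ▸ hu)
  exact (Submodule.ne_bot_iff _).2 ⟨w, ⟨hw, hu⟩, fun h => hu0 (by rw [h, map_zero])⟩

theorem exists_algebraMap_eq (h : Hecke L 0) : ∃ r : R, algebraMap R (Hecke L 0) r = h := by
  obtain ⟨x, rfl⟩ := mk_surjective L 0 h
  induction x using FreeAlgebra.induction with
  | grade0 r => exact ⟨r, (AlgHom.commutes _ r).symm⟩
  | grade1 g =>
    cases g with
    | T i hi => omega
    | X j hj => omega
    | Xinv j hj => omega
  | mul a b ha hb =>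
    obtain ⟨r, hr⟩ := ha
    obtain ⟨s, hs⟩ := hb
    exact ⟨r * s, by rw [map_mul, map_mul, hr, hs]⟩
  | add a b ha hb =>
    obtain ⟨r, hr⟩ := ha
    obtain ⟨s, hs⟩ := hb
    exact ⟨r + s, by rw [map_add, map_add, hr, hs]⟩

/-- Irreducible representations are absolutely irreducible. -/
theorem exists_eq_smul (hq : q ≠ 1) {n : ℕ} (N : Rep L n)
    (hN : IsSimpleModule (Hecke L n) N.obj) (φ : N.obj →ₗ[Hecke L n] N.obj) :
    ∃ c : R, ∀ v, φ v = c • v := by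
  induction n with
  | zero =>
    have := IsSimpleModule.nontrivial (Hecke L 0) N.obj
    obtain ⟨v, hv⟩ := exists_ne (0 : N.obj)
    have hgen := IsSimpleModule.toSpanSingleton_surjective (Hecke L 0) hv
    obtain ⟨h, hh⟩ := hgen (φ v)
    obtain ⟨c, rfl⟩ := exists_algebraMap_eq h
    refine ⟨c, fun w => ?_⟩
    obtain ⟨h', rfl⟩ := hgen w
    rw [LinearMap.toSpanSingleton_apply] at hh ⊢
    rw [map_smul, ← hh, algebraMap_smul, smul_comm]
  | succ k ih =>
    have hfd := N.property.finiteDimensional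
    have H := heckeAction L (k + 1) N.obj
    have hT := minStab_top (L := L) (n := k + 1) (M := N.obj)
    -- Any nonzero eigenvalue of `X k` in `R` will do. The irreducible socle of its eigenspace is
    -- preserved by `φ`, which is a scalar `c` there by induction; so `φ - c` has a nonzero kernel
    -- on a simple module.
    obtain ⟨b, hb, hE⟩ := exists_eigenvector N (IsSimpleModule.nontrivial (Hecke L (k + 1)) N.obj)
    have ha : ((q : R) - 1) * b ≠ 0 :=
      mul_ne_zero (sub_ne_zero.2 fun h => hq (Units.ext h)) hb
    obtain ⟨S, hSe, hS, hSm, -⟩ := exists_socle ha N hN hE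
    have hSe' : ofRes S ≤ (opX L (k + 1) N.obj k).eigenspace b := by
      rw [← ofRes_eigen]
      exact ofRes_le_ofRes.2 hSe
    let φR : Module.End R N.obj := φ.restrictScalars R
    have hφS : ∀ v ∈ S, (show res N.obj from φ v) ∈ S := fun v hv =>
      resEquiv_mem_ofRes.1 (H.map_mem_socle ha hT hSm hSe' (φ := φR)
        (fun j hj w => by
          rw [opT_apply hj, opT_apply hj]
          exact map_smul φ _ w)
        (fun j _ w => map_opX φ j w) (resEquiv_mem_ofRes.2 hv))
    let N' : Rep L k := ⟨ModuleCat.of (Hecke L k) S,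
      isRep_of_injective N.property S.subtype Subtype.val_injective⟩
    let ψ : N'.obj →ₗ[Hecke L k] N'.obj :=
      { toFun := fun v => (⟨φ (show S from v).1, hφS _ (show S from v).2⟩ : S)
        map_add' := fun v w => Subtype.ext (map_add φ (show S from v).1 (show S from w).1)
        map_smul' := fun h v => Subtype.ext (map_smul φ (incl L k h) (show S from v).1) }
    obtain ⟨c, hc⟩ := ih N' hS ψ
    refine ⟨c, fun v => ?_⟩
    have hker : LinearMap.ker (φ - algebraMap R (Module.End (Hecke L (k + 1)) N.obj) c) = ⊤ := by
      refine (eq_bot_or_eq_top _).resolve_left fun h => ?_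
      have : Nontrivial S := IsSimpleModule.nontrivial (Hecke L k) S
      obtain ⟨s, hs⟩ := exists_ne (0 : S)
      refine hs (Subtype.ext ?_)
      have h1 : resEquiv N.obj s ∈
          LinearMap.ker (φ - algebraMap R (Module.End (Hecke L (k + 1)) N.obj) c) := by
        rw [LinearMap.mem_ker, LinearMap.sub_apply, sub_eq_zero, Module.algebraMap_end_apply,
          ← map_smul]
        exact congrArg (fun z : S => resEquiv N.obj z) (hc s)
      rw [h, Submodule.mem_bot] at h1
      exact h1
    have h2 : v ∈ LinearMap.ker (φ - algebraMap R (Module.End (Hecke L (k + 1)) N.obj) c) :=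
      hker ▸ trivial
    rw [LinearMap.mem_ker, LinearMap.sub_apply, sub_eq_zero, Module.algebraMap_end_apply] at h2
    exact h2

end Irreducible

/-! ### Jordan blocks -/

section JordanBlocks

open scoped DirectSum

variable {R : Type u} [Field R]

theorem dvd_of_smul_mk_eq_zero {f g : R[X]}
    (h : f • (Submodule.Quotient.mk 1 : R[X] ⧸ Ideal.span {g}) = 0) : g ∣ f := by
  rw [← Submodule.Quotient.mk_smul, Submodule.Quotient.mk_eq_zero, smul_eq_mul, mul_one] at h
  exact Ideal.mem_span_singleton.1 h

theorem smul_quotient_eq_zero {f g : R[X]} (h : g ∣ f) (z : R[X] ⧸ Ideal.span {g}) :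
    f • z = 0 := by
  obtain ⟨z, rfl⟩ := Submodule.Quotient.mk_surjective _ z
  rw [← Submodule.Quotient.mk_smul, Submodule.Quotient.mk_eq_zero]
  exact Ideal.mem_span_singleton.2 (h.mul_right z)

/-- A direct summand of the form `R[x] / (x - a) ^ m` exists as soon as `x - a` is nilpotent of
index `m` on the primary part. -/
theorem exists_isCompl_quotient {W : Type u} [AddCommGroup W] [Module R[X] W]
    [Module.Finite R[X] W] (hW : Module.IsTorsion R[X] W) {a : R} {m : ℕ}
    (h : ∀ (w : W) (r : ℕ), (Polynomial.X - Polynomial.C a) ^ r • w = 0 →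
      (Polynomial.X - Polynomial.C a) ^ (m + 1) • w = 0)
    {w : W} (hw : (Polynomial.X - Polynomial.C a) ^ (m + 1) • w = 0)
    (hw' : (Polynomial.X - Polynomial.C a) ^ m • w ≠ 0) :
    ∃ p p' : Submodule R[X] W, IsCompl p p' ∧
      Nonempty (p ≃ₗ[R[X]] R[X] ⧸ Ideal.span {(Polynomial.X - Polynomial.C a) ^ (m + 1)}) := by
  classical
  set t : R[X] := Polynomial.X - Polynomial.C a with ht
  have htp : Prime t := Polynomial.prime_X_sub_C a
  obtain ⟨ι, _, p, hp, e, ⟨E⟩⟩ := Module.equiv_directSum_of_isTorsion hW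
  -- Choose a primary summand on which `t ^ m` does not kill the component of `w`. Its prime must be
  -- `t`, as `t ^ (m + 1)` is invertible on the other summands.
  obtain ⟨i, hi⟩ : ∃ i, t ^ m • E w i ≠ 0 := by
    by_contra! h0
    refine hw' (E.injective (DFinsupp.ext fun i => ?_))
    rw [map_smul, map_zero]
    exact h0 i
  have hi' : t ^ (m + 1) • E w i = 0 := by
    have := congrArg (fun z => z i) (congrArg E hw)
    rwa [map_smul, map_zero] at this
  have hpt : Associated (p i) t := by
    by_contra hne
    have hco : IsCoprime (p i ^ e i) (t ^ (m + 1)) :=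
      (((hp i).coprime_iff_not_dvd).2 fun hd =>
        hne ((hp i).associated_of_dvd htp.irreducible hd)).pow
    obtain ⟨b, c, hbc⟩ := hco
    apply hi
    rw [← one_smul R[X] (E w i), ← hbc, add_smul, mul_smul, mul_smul, hi', smul_zero, add_zero,
      smul_quotient_eq_zero dvd_rfl, smul_zero, smul_zero]
  have hspan : Ideal.span {p i ^ e i} = Ideal.span {t ^ e i} :=
    Ideal.span_singleton_eq_span_singleton.2 (hpt.pow_pow)
  let s : (R[X] ⧸ Ideal.span {p i ^ e i}) →ₗ[R[X]] W :=
    E.symm.toLinearMap ∘ₗ DirectSum.lof R[X] ι (fun i => R[X] ⧸ Ideal.span {p i ^ e i}) i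
  let π : W →ₗ[R[X]] (R[X] ⧸ Ideal.span {p i ^ e i}) :=
    DirectSum.component R[X] ι (fun i => R[X] ⧸ Ideal.span {p i ^ e i}) i ∘ₗ E.toLinearMap
  have hπs : ∀ z, π (s z) = z := fun z => by
    change DirectSum.component R[X] ι _ i (E (E.symm (DirectSum.lof R[X] ι _ i z))) = z
    rw [LinearEquiv.apply_symm_apply, DirectSum.component.lof_self]
  have hs : Function.Injective s := Function.LeftInverse.injective hπs
  -- The bound `h` applied to the generator of the summand gives `e i ≤ m + 1`; the nonzero
  -- component of `t ^ m • w` gives the reverse.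
  have hei : e i = m + 1 := by
    refine le_antisymm ?_ ?_
    · have h1 : t ^ (m + 1) • s (Submodule.Quotient.mk 1) = 0 := by
        refine h _ (e i) ?_
        rw [← map_smul, smul_quotient_eq_zero (hpt.pow_pow).dvd, map_zero]
      rw [← map_smul, LinearMap.map_eq_zero_iff _ hs] at h1
      have h2 := (hpt.symm.pow_pow (n := e i)).dvd.trans (dvd_of_smul_mk_eq_zero h1)
      exact (pow_dvd_pow_iff htp.ne_zero htp.not_isUnit).1 h2
    · by_contra! hlt
      exact hi (smul_quotient_eq_zero ((hpt.pow_pow).dvd.trans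
        (pow_dvd_pow t (Nat.lt_succ_iff.1 hlt))) _)
  refine ⟨LinearMap.range s, LinearMap.ker π, ⟨?_, ?_⟩, ?_⟩
  · rw [Submodule.disjoint_def]
    rintro _ ⟨z, rfl⟩ hz
    rw [LinearMap.mem_ker, hπs] at hz
    rw [hz, map_zero]
  · rw [codisjoint_iff, Submodule.eq_top_iff']
    intro v
    refine Submodule.mem_sup.2 ⟨s (π v), ⟨_, rfl⟩, v - s (π v), ?_, add_sub_cancel _ _⟩
    rw [LinearMap.mem_ker, map_sub, hπs, sub_self]
  · rw [← hei]
    exact ⟨(LinearEquiv.ofInjective s hs).symm.trans (Submodule.quotEquivOfEq _ _ hspan)⟩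

variable {A : Type u} [Ring A] [Algebra R A] (M : ModuleCat.{u} A) {y : A} {a : R} {m : ℕ}

theorem sub_pow_smul_of (r : ℕ) (v : M) :
    (Polynomial.X - Polynomial.C a) ^ r • Module.AEval.of R M y v =
      Module.AEval.of R M y ((y - algebraMap R A a) ^ r • v) := by
  rw [← Module.AEval.of_aeval_smul, map_pow, map_sub, Polynomial.aeval_X, Polynomial.aeval_C]

/-- The class of 1 in the block is annihilated by (x-a)^k, hence by (x-a)^m, and its annihilator is
generated by (x-a)^k. -/
theorem HasJordanBlock.le (h : ∀ (v : M) (r : ℕ), (y - algebraMap R A a) ^ r • v = 0 →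
    (y - algebraMap R A a) ^ m • v = 0) {k : ℕ} (hk : HasJordanBlock M y a k) : k ≤ m := by
  obtain ⟨p, -, -, ⟨e⟩⟩ := hk
  set t : R[X] := Polynomial.X - Polynomial.C a with ht
  have h' : ∀ (w : Module.AEval R M y) (r : ℕ), t ^ r • w = 0 → t ^ m • w = 0 := fun w r hw => by
    obtain ⟨v, rfl⟩ := (Module.AEval.of R M y).surjective w
    rw [sub_pow_smul_of, LinearEquiv.map_eq_zero_iff] at hw ⊢
    exact h v r hw
  have h1 : t ^ m • e.symm (Submodule.Quotient.mk 1) = 0 := by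
    refine Subtype.ext (h' _ k ?_)
    rw [← Submodule.coe_smul, ← map_smul, smul_quotient_eq_zero dvd_rfl, map_zero,
      Submodule.coe_zero]
  rw [← map_smul, LinearEquiv.map_eq_zero_iff] at h1
  have htp : Prime t := Polynomial.prime_X_sub_C a
  exact (pow_dvd_pow_iff htp.ne_zero htp.not_isUnit).1 (dvd_of_smul_mk_eq_zero h1)

theorem maxJordanBlock_eq_zero (h : ∀ (v : M) (r : ℕ), (y - algebraMap R A a) ^ r • v = 0 → v = 0) :
    maxJordanBlock M y a = 0 :=
  Nat.le_zero.1 (csSup_le' fun _ hr => HasJordanBlock.le M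
    (fun v r hv => by rw [h v r hv, smul_zero]) hr)

theorem isTorsion_aeval [FiniteDimensional R M] :
    Module.IsTorsion R[X] (Module.AEval R M y) := fun {w} => by
  obtain ⟨v, rfl⟩ := (Module.AEval.of R M y).surjective w
  let z : Module.End R M := Algebra.lsmul R R M y
  refine ⟨⟨minpoly R z, mem_nonZeroDivisors_of_ne_zero
    (minpoly.ne_zero (Algebra.IsIntegral.isIntegral z))⟩, ?_⟩
  have h : Polynomial.aeval y (minpoly R z) • v = 0 := by
    have := LinearMap.congr_fun (minpoly.aeval R z) v
    rwa [Polynomial.aeval_algHom_apply] at this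
  change minpoly R z • Module.AEval.of R M y v = 0
  rw [← Module.AEval.of_aeval_smul, h, map_zero]

/-- The maximal size of a Jordan block is the index of nilpotency. -/
theorem maxJordanBlock_eq_succ [FiniteDimensional R M]
    (h : ∀ (v : M) (r : ℕ), (y - algebraMap R A a) ^ r • v = 0 →
      (y - algebraMap R A a) ^ (m + 1) • v = 0)
    {v : M} (hv : (y - algebraMap R A a) ^ (m + 1) • v = 0)
    (hv' : (y - algebraMap R A a) ^ m • v ≠ 0) : maxJordanBlock M y a = m + 1 := by
  refine IsGreatest.csSup_eq ⟨?_, fun k hk => HasJordanBlock.le M h hk⟩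
  refine exists_isCompl_quotient (W := Module.AEval R M y)
    (isTorsion_aeval M) (fun w r hw => ?_) (w := Module.AEval.of R M y v) ?_ ?_
  · obtain ⟨v, rfl⟩ := (Module.AEval.of R M y).surjective w
    rw [sub_pow_smul_of, LinearEquiv.map_eq_zero_iff] at hw ⊢
    exact h v r hw
  · rw [sub_pow_smul_of, hv, map_zero]
  · rw [sub_pow_smul_of, ne_eq, LinearEquiv.map_eq_zero_iff]
    exact hv'

end JordanBlocks

/-! ### The three assertions -/

section Assertions

open Module.End (maxGenEigenspace mem_maxGenEigenspace eigenspace mem_eigenspace_iff)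

variable {R : Type u} [Field R] {q : Rˣ} {L : Level q} {k : ℕ}

theorem shifted_opX_pow_apply {M : ModuleCat.{u} (Hecke L (k + 1))} (a : R) (r : ℕ) (v : M) :
    (shifted (opX L (k + 1) M k) a ^ r) v =
      (X L k (Nat.lt_succ_self k) - algebraMap R _ a) ^ r • v :=
  shifted_opX_pow a r v

theorem maxJordanBlock_X {a : R} (ha : ((q : R) - 1) * a ≠ 0) (N : Rep L (k + 1))
    (hN : IsSimpleModule (Hecke L (k + 1)) N.obj) {l : ℕ} (hl : l ≤ k + 1)
    (ht : HasTail (opX L (k + 1) N.obj) a l (k + 1) ⊤) :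
    maxJordanBlock N.obj (X L k (Nat.lt_succ_self k)) a = k + 1 - l := by
  have hfd := N.property.finiteDimensional
  have H := heckeAction L (k + 1) N.obj
  have hT := minStab_top (L := L) (n := k + 1) (M := N.obj)
  have hk := Nat.lt_succ_self k
  have hmem : ∀ (v : N.obj) (r : ℕ), (X L k hk - algebraMap R _ a) ^ r • v = 0 →
      v ∈ (opX L (k + 1) N.obj k).maxGenEigenspace a := fun v r hv =>
    (mem_maxGenEigenspace _ _ _).2 ⟨r, (shifted_opX_pow_apply a r v).trans hv⟩
  rcases eq_or_lt_of_le hl with rfl | hl'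
  · rw [Nat.sub_self]
    refine maxJordanBlock_eq_zero _ fun v r hv => ht.2 (Nat.succ_pos k) v trivial ?_ (hmem v r hv)
    exact mem_tailSpace.2 fun j hj hj' => by omega
  · obtain ⟨m, hm⟩ := Nat.exists_eq_add_of_le (Nat.lt_succ_iff.1 hl')
    obtain ⟨-, w, hw, hw0⟩ := H.tail_pow ha hk hm.symm hT ht
    have hpow : ∀ v ∈ (opX L (k + 1) N.obj k).maxGenEigenspace a,
        (X L k hk - algebraMap R _ a) ^ (m + 1) • v = 0 := fun v hv => by
      rw [← shifted_opX_pow_apply]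
      exact H.pow_eq_zero ha hk hm.symm hT ht trivial hv
    rw [show k + 1 - l = m + 1 by omega]
    refine maxJordanBlock_eq_succ _ (fun v r hv => hpow v (hmem v r hv))
      (hpow w ((tailSpace_succ (by omega)).1 hw.2).2) ?_
    rwa [← shifted_opX_pow_apply]

theorem eStar_subsingleton {a : R} (N : Rep L (k + 1))
    (ht : HasTail (opX L (k + 1) N.obj) a (k + 1) (k + 1) ⊤) : Subsingleton (eStar a N).obj := by
  have h0 : genEigen a N.obj = ⊥ := by
    rw [← ofRes_eq_bot, ofRes_genEigen]
    exact (Submodule.eq_bot_iff _).2 fun v hv => ht.2 (Nat.succ_pos k) v trivial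
      (mem_tailSpace.2 fun j hj hj' => by omega) hv
  have : Subsingleton (genEigen a N.obj) := by
    rw [h0]
    infer_instance
  exact this

theorem finrank_hom_subsingleton {P : Rep L k} (h : Subsingleton P.obj) :
    Module.finrank R (P.obj →ₗ[Hecke L k] P.obj) = 0 :=
  Module.finrank_zero_of_subsingleton

theorem exists_schur (hq : q ≠ 1) {P : Rep L k} {V : Submodule (Hecke L k) P.obj}
    (hV : IsSimpleModule (Hecke L k) V) (ψ : V →ₗ[Hecke L k] V) :
    ∃ c : R, ∀ v : V, ((ψ v : V) : P.obj) = c • (v : P.obj) := by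
  obtain ⟨c, hc⟩ := exists_eq_smul hq (subRep P V) hV ψ
  exact ⟨c, fun v => congrArg (fun z : V => (z : P.obj)) (hc v)⟩

theorem exists_cls_eStar {a : R} (ha : ((q : R) - 1) * a ≠ 0) (N : Rep L (k + 1))
    (hN : IsSimpleModule (Hecke L (k + 1)) N.obj) :
    ∃ (m : ℕ) (c : Fin m → ℕ) (M : Fin m → Rep L k),
      (∀ α, IsSimpleModule (Hecke L k) (M α).obj) ∧
      (∀ α, (epsilon a (M α) : ℤ) < (epsilon a N : ℤ) - 1) ∧
      cls (n := k) (eStar a N) =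
        epsilon a N • cls (n := k) (eTilde a N) + ∑ α, c α • cls (M α) := by
  obtain ⟨l, hl, ht⟩ := exists_repTail a N (IsSimpleModule.nontrivial (Hecke L (k + 1)) N.obj)
  rw [epsilon_eq ha N hN hl ht]
  rcases eq_or_lt_of_le hl with rfl | hl'
  · refine ⟨0, Fin.elim0, Fin.elim0, fun α => α.elim0, fun α => α.elim0, ?_⟩
    rw [cls_eq_zero (eStar_subsingleton N ht), Nat.sub_self, zero_smul, zero_add,
      Finset.univ_eq_empty, Finset.sum_empty]
  · have hlk : l ≤ k := Nat.lt_succ_iff.1 hl'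
    obtain ⟨m, hm⟩ := Nat.exists_eq_add_of_le hlk
    obtain ⟨x, V, D, ⟨e⟩⟩ := exists_tailData ha N hN hm.symm ht
    obtain ⟨x, hx, h⟩ := D.exists_cls_self hlk
    obtain ⟨r, c, M, hM, hM', rfl⟩ := exists_sum_of_mem_simpleClasses hx
    refine ⟨r, c, M, hM, fun α => ?_, ?_⟩
    -- Here ε(N) = k+1-l, so lacking a tail of length k-l means exactly ε < ε(N)-1.
    · have := epsilon_lt_of_noTail ha (M α) (hM α) hlk (hM' α)
      omega
    · rw [show k + 1 - l = m + 1 by omega]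
      exact h.trans (by rw [cls_equiv (P := eTilde a N) (P' := subRep (eStar a N) V) e])

theorem epsilon_eq_finrank (hq : q ≠ 1) {a : R} (ha : ((q : R) - 1) * a ≠ 0) (N : Rep L (k + 1))
    (hN : IsSimpleModule (Hecke L (k + 1)) N.obj) :
    epsilon a N = Module.finrank R ((eStar a N).obj →ₗ[Hecke L k] (eStar a N).obj) := by
  obtain ⟨l, hl, ht⟩ := exists_repTail a N (IsSimpleModule.nontrivial (Hecke L (k + 1)) N.obj)
  rw [epsilon_eq ha N hN hl ht]
  rcases eq_or_lt_of_le hl with rfl | hl'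
  · exact (Nat.sub_self _).trans (finrank_hom_subsingleton (eStar_subsingleton N ht)).symm
  · have hlk : l ≤ k := Nat.lt_succ_iff.1 hl'
    obtain ⟨m, hm⟩ := Nat.exists_eq_add_of_le hlk
    obtain ⟨x, V, D, -⟩ := exists_tailData ha N hN hm.symm ht
    have h := D.finrank_end hlk (exists_schur hq D.isSimple)
    rw [show k + 1 - l = m + 1 by omega]
    exact h.symm

end Assertions

end AffHecke

end

theorem mainTheorem6 {R : Type u} [Field R] (q : Rˣ) (hq : q ≠ 1) (L : AffHecke.Level q) (n : ℕ)
    (N : AffHecke.Rep L n) (hN : IsSimpleModule (AffHecke.Hecke L n) N.obj) (i : ℤ) (a : R)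
    (ha : a = ((q ^ i : Rˣ) : R)) :
    (∀ hn : 0 < n, AffHecke.epsilon a N =
      AffHecke.maxJordanBlock N.obj (AffHecke.X L (n - 1) (Nat.sub_lt hn Nat.one_pos)) a) ∧
    (∃ (m : ℕ) (c : Fin m → ℕ) (M : Fin m → AffHecke.Rep L (n - 1)),
      (∀ α, IsSimpleModule (AffHecke.Hecke L (n - 1)) (M α).obj) ∧
      (∀ α, (AffHecke.epsilon a (M α) : ℤ) < (AffHecke.epsilon a N : ℤ) - 1) ∧
      AffHecke.cls (AffHecke.eStar a N) =
        AffHecke.epsilon a N • AffHecke.cls (AffHecke.eTilde a N) +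
          ∑ α, c α • AffHecke.cls (M α)) ∧
    AffHecke.epsilon a N =
      Module.finrank R ((AffHecke.eStar a N).obj →ₗ[AffHecke.Hecke L (n - 1)]
        (AffHecke.eStar a N).obj) := by
  -- This is the scalar that makes the nilpotency index grow with the length of the tail.
  have ha' : ((q : R) - 1) * a ≠ 0 := by
    rw [ha]
    exact mul_ne_zero (sub_ne_zero.2 fun h => hq (Units.ext h)) (Units.ne_zero _)
  cases n with
  | zero =>
    have h0 : Subsingleton (AffHecke.zeroRep L 0).obj := inferInstanceAs (Subsingleton PUnit)
    have he : AffHecke.epsilon a N = 0 := AffHecke.epsilon_eq_zero h0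
    refine ⟨fun hn => absurd hn (lt_irrefl 0),
      ⟨0, Fin.elim0, Fin.elim0, fun α => α.elim0, fun α => α.elim0, ?_⟩, ?_⟩
    · rw [he, zero_smul, zero_add, Finset.univ_eq_empty, Finset.sum_empty]
      exact AffHecke.cls_eq_zero (P := AffHecke.zeroRep L 0) h0
    · rw [he]
      exact (AffHecke.finrank_hom_subsingleton (P := AffHecke.zeroRep L 0) h0).symm
  | succ k =>
    refine ⟨fun _ => ?_, AffHecke.exists_cls_eStar ha' N hN,
      AffHecke.epsilon_eq_finrank hq ha' N hN⟩
    obtain ⟨l, hl, ht⟩ := AffHecke.exists_repTail a N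
      (IsSimpleModule.nontrivial (AffHecke.Hecke L (k + 1)) N.obj)
    exact (AffHecke.epsilon_eq ha' N hN hl ht).trans
      (AffHecke.maxJordanBlock_X ha' N hN hl ht).symm
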